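/- **Setting.** For $0\le s\le 1$ let $|\psi_s\rangle\in\mathbb C^d$ be a unit eigenvector with eigenphase $\varphi_s$ of a unitary $U_s$, $U_s|\psi_s\rangle=e^{i\varphi_s}|\psi_s\rangle$, such that $\varphi_s$ is non-degenerate and every other eigenphase of $U_s$ is at distance at least $\Delta$ from $\varphi_s$, where $0<\Delta\le\pi$ (phases are taken modulo $2\pi$; no continuity in $s$ is assumed). Let $0<\delta<\pi$ and $\delta'=\min(\delta/2,\Delta/4)$. The eigenphase $\varphi_b$ is *$(g,\delta)$-dominant* in $|\psi_a\rangle$ if for every interval $I=[x-\delta,x+\delta]$, with $\Pi$ the projector onto the eigenspaces of $U_b$ with eigenphases in $I$, $\|\Pi\psi_a\|^2>g$ implies $\varphi_b\in I$. Let $L(a,b)=\sup\sum_j\arccos|\langle\psi_{t_{j}}|\psi_{t_{j-1}}\rangle|$ over $a=t_0<\dots<t_n=b$, let $L=L(0,1)$ and $v_{\rm avg}=L$. For $\theta>0$ let $v_{\max}=\sup\{L(a,b)/(b-a): 0\le a<b\le 1,\ L(a,b)>\theta\}$ if $L>\theta$, and $v_{\max}=v_{\rm avg}$ if $L\le\theta$.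 Let $$C=\frac{2L\left(\log_2(v_{\max}/v_{\rm avg})+3\right)}{\theta}+1$$ (with $C=1$ if $L=0$). **Procedures.** A procedure acts on $r$ copies of the system, which it accesses only through oracle calls, and on a work register. Apart from arbitrary operations on the work register and on the phase registers returned by oracles, including measurements on whose outcomes later steps may depend, it may use (controlled) calls of the following oracles, each call having its own, arbitrary instance, with its own inaccessible environment: * *phase estimation* ${\rm PE}(U_s,\rho)$ with resolution $\rho=\delta'/2$, and the inverse of an instance already used: it maps every eigenstate $|\chi\rangle$ of $U_s$ with eigenphase $\varphi$ to $|\chi\rangle$ times a state of a phase register and an environment, where the register holds only phases within $\rho$ of $\varphi$; * *reflections* ${\rm R}(U_s,\tilde\varphi,\Delta)$: they change the sign of eigenstates of $U_s$ with eigenphase within $\Delta/4$ of $\tilde\varphi$ and fix those with eigenphase farther than $3\Delta/4$ from $\tilde\varphi$. Both are $U_s$-controlled: they commute with all operators on the system that commute with $U_s$. The *error amplitude* of a procedure is at most $\epsilon$ if its final state (over all measurement records and environments) differs by a vector of norm at most $\epsilon$ from one of the required form, which is called the error-free part. **Theorem.** Let $r\in\mathbb N$, $\gamma>0$, $1-4\gamma\ge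 2/3$, and let $\delta,\Delta$ be as above. There is a one-step procedure $T_{px}$, depending only on $r,\gamma,\delta,\Delta$ and the format of the phase registers, and referring to the path only through oracle calls, such that the following holds for all $d$, all paths as above for which $\varphi_s$ is $(1-4\gamma,\delta)$-dominant in $|\psi_t\rangle$ for all $0\le t<s\le1$, and all oracle instances. 1. *(One step.)* Let $0\le a<b\le1$ and $p=|\langle\psi_a|\psi_b\rangle|^2$, and let a phase at distance less than $\Delta/4$ from $\varphi_a$ be given. Applied to $|\psi_a\rangle^{\otimes r}$, $T_{px}$ ends, up to error amplitude $6e^{-r\gamma^2/36}$, in a combination of $|\psi_a\rangle^{\otimes r}$ with the report "failure" and of $|\psi_b\rangle^{\otimes r}$ with the report of a phase within $\Delta/5$ of $\varphi_b$; the second does not occur if $p\le1-3\gamma$, and the first does not occur if $p>1-\gamma$. It uses at most $4r$ calls of phase estimation and a number $n$ of reflections with $\langle n\rangle\le5r$ and $\langle\Gamma^n\rangle\le\Gamma^{7r}$ for $1\le\Gamma\le7/4$. 2. *(Traversal.)* Let $0<\theta<\arccos\sqrt{1-\gamma}$, let $L$ and $v_{\max}$ be finite, and let a phase at distance less than $\Delta/4$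 from $\varphi_0$ be given. Consider the recursive binary subdivision of $[0,1]$ with $T_{px}$: to pass from $a$ to $b$, apply $T_{px}$ once; if it reports failure, pass from $a$ to $(a+b)/2$ and then from $(a+b)/2$ to $b$. Stopped after at most $\lfloor C\rfloor$ applications of $T_{px}$, this procedure transforms $|\psi_0\rangle^{\otimes r}$ into $|\psi_1\rangle^{\otimes r}$ with error amplitude at most $6Ce^{-r\gamma^2/36}$, using at most $4rC$ calls of phase estimation (inverses included) and a number $n$ of reflections with $\langle n\rangle\le5rC$ and $\langle\Gamma^n\rangle\le\Gamma^{7rC}$ for $1\le\Gamma\le7/4$. If it is stopped only after at most $M$ applications, for any integer $M\ge\lfloor C\rfloor$, the bound on the error amplitude remains valid with an error-free part that has reached $s=1$ and to which the same bounds on the numbers of calls apply. -/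

import Mathlib

open scoped Kronecker Matrix ENNReal

noncomputable section

namespace EigenPaths

/-! ## States, eigenphases and paths of eigenstates -/

/-- Vectors of a `d`-dimensional quantum system. -/
abbrev Ket (d : ℕ) := EuclideanSpace ℂ (Fin d)

/-- Squared norm of a vector given by its amplitudes. -/
def normSq {X : Type} [Fintype X] (v : X → ℂ) : ℝ := ∑ x, ‖v x‖ ^ 2

/-- Distance of two phases modulo `2π`. -/
def angDist (x y : ℝ) : ℝ := ‖((x - y : ℝ) : Real.Angle)‖

/-- `χ` is zero or an eigenvector of `U` with eigenphase `φ`. -/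
def IsEig {d : ℕ} (U : Matrix (Fin d) (Fin d) ℂ) (φ : ℝ) (χ : Ket d) : Prop :=
  U *ᵥ χ.ofLp = Complex.exp (φ * Complex.I) • χ.ofLp

/-- The sum of the eigenspaces of `U` with eigenphases in `[x - δ, x + δ]` modulo `2π`. -/
def phaseSpace {d : ℕ} (U : Matrix (Fin d) (Fin d) ℂ) (x δ : ℝ) : Submodule ℂ (Ket d) :=
  Submodule.span ℂ {χ | ∃ φ, IsEig U φ χ ∧ angDist φ x ≤ δ}

/-- `φV` is a `(g, δ)`-dominant eigenphase of `V` in `ψ`: whenever the eigenphases of `V` in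
`[x - δ, x + δ]` have total probability more than `g` in `ψ`, that interval contains `φV`. -/
def IsDominant {d : ℕ} (V : Matrix (Fin d) (Fin d) ℂ) (φV : ℝ) (ψ : Ket d) (g δ : ℝ) : Prop :=
  ∀ x : ℝ, g < ‖(phaseSpace V x δ).starProjection ψ‖ ^ 2 → angDist φV x ≤ δ

/-- A path of non-degenerate eigenstates `ψ s`, with eigenphases `φ s`, of unitary operators `U s`,
`0 ≤ s ≤ 1`, such that all other eigenphases of `U s` are at distance at least `Δ` from `φ s`.
No continuity is assumed. -/
structure EigenPath (d : ℕ) (Δ : ℝ) where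
  U : ℝ → Matrix.unitaryGroup (Fin d) ℂ
  ψ : ℝ → Ket d
  φ : ℝ → ℝ
  norm_ψ : ∀ s ∈ Set.Icc (0 : ℝ) 1, ‖ψ s‖ = 1
  isEig : ∀ s ∈ Set.Icc (0 : ℝ) 1, IsEig (U s).1 (φ s) (ψ s)
  gap : ∀ s ∈ Set.Icc (0 : ℝ) 1, ∀ (φ' : ℝ) (χ : Ket d), χ ≠ 0 → IsEig (U s).1 φ' χ →
    (∃ c : ℂ, χ = c • ψ s) ∨ Δ ≤ angDist φ' (φ s)

/-- The overlap probability `|⟨ψ|χ⟩|²`. -/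
def overlap {d : ℕ} (ψ χ : Ket d) : ℝ := ‖inner ℂ ψ χ‖ ^ 2

/-- Angular length of the path `ψ` restricted to `[a, b]`, as an extended real: the supremum of
`∑ arccos |⟨ψ (t (j+1)) | ψ (t j)⟩|` over all `a = t 0 < ⋯ < t n = b`. -/
def pathLength {d : ℕ} (ψ : ℝ → Ket d) (a b : ℝ) : ℝ≥0∞ :=
  ⨆ (n : ℕ) (t : Fin (n + 1) → ℝ) (_ : StrictMono t ∧ t 0 = a ∧ t (Fin.last n) = b),
    ∑ j : Fin n, ENNReal.ofReal (Real.arccos ‖inner ℂ (ψ (t j.succ)) (ψ (t j.castSucc))‖)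

/-- Angular length of the path `ψ` restricted to `[a, b]`, for paths of finite length. -/
def len {d : ℕ} (ψ : ℝ → Ket d) (a b : ℝ) : ℝ := (pathLength ψ a b).toReal

/-- The average angular velocities of `ψ` over those parts of `[0, 1]` that are longer than `θ`. -/
def velocities {d : ℕ} (ψ : ℝ → Ket d) (θ : ℝ) : Set ℝ :=
  {v | ∃ a b : ℝ, 0 ≤ a ∧ a < b ∧ b ≤ 1 ∧ θ < len ψ a b ∧ v = len ψ a b / (b - a)}

/-- Average angular velocity over the whole of `[0, 1]`. -/
def vAvg {d : ℕ} (ψ : ℝ → Ket d) : ℝ := len ψ 0 1 / (1 - 0)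

open Classical in
/-- Maximum locally averaged angular velocity at scale `θ`. -/
def vMax {d : ℕ} (ψ : ℝ → Ket d) (θ : ℝ) : ℝ :=
  if len ψ 0 1 ≤ θ then vAvg ψ else sSup (velocities ψ θ)

/-- The bound `2 L (log₂ (v_max / v_avg) + 3) / θ + 1`. -/
def costBound {d : ℕ} (ψ : ℝ → Ket d) (θ : ℝ) : ℝ :=
  2 * len ψ 0 1 * (Real.logb 2 (vMax ψ θ / vAvg ψ) + 3) / θ + 1

/-! ## Oracles -/

/-- `χ ⊗ |z⟩` for a basis state `|z⟩`. -/
def withBasis {d : ℕ} {Z : Type} [DecidableEq Z] (χ : Ket d) (z : Z) : Fin d × Z → ℂ :=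
  fun x => if x.2 = z then χ x.1 else 0

/-- An instance of a phase estimation oracle for `U` with resolution `ρ`. It is a unitary `mat` on
the system, a register with basis `Λ` (the label `l` stands for the phase `ph l`) and an
inaccessible environment with basis `E`; the last two start in the basis state `init`. It is
`U`-controlled (so that it preserves eigenstates of `U`), and eigenstates with eigenphase `φ`
produce only phases within `ρ` of `φ`. -/
structure PhaseEstimation {d : ℕ} (U : Matrix (Fin d) (Fin d) ℂ) (ρ : ℝ)
    {Λ : Type} [Fintype Λ] [DecidableEq Λ] (ph : Λ → ℝ) (E : Type) [Fintype E] [DecidableEq E] where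
  mat : Matrix (Fin d × (Λ × E)) (Fin d × (Λ × E)) ℂ
  init : Λ × E
  unitary : mat ∈ Matrix.unitaryGroup (Fin d × (Λ × E)) ℂ
  controlled : ∀ X : Matrix (Fin d) (Fin d) ℂ, Commute X U →
    Commute (X ⊗ₖ (1 : Matrix (Λ × E) (Λ × E) ℂ)) mat
  resolution : ∀ (φ : ℝ) (χ : Ket d), IsEig U φ χ → ∀ (j : Fin d) (l : Λ) (e : E),
    ρ < angDist (ph l) φ → (mat *ᵥ withBasis χ init) (j, (l, e)) = 0

/-- An instance of a reflection oracle for `U`, phase `φ₀` and resolution `Δ`. It is a unitary on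
the system and an inaccessible environment with basis `F`, which starts in the basis state `init`.
It is `U`-controlled, changes the sign of eigenstates with eigenphase within `Δ/4` of `φ₀`, and
fixes eigenstates with eigenphase farther than `3Δ/4` from `φ₀`. -/
structure Reflection {d : ℕ} (U : Matrix (Fin d) (Fin d) ℂ) (φ₀ Δ : ℝ)
    (F : Type) [Fintype F] [DecidableEq F] where
  mat : Matrix (Fin d × F) (Fin d × F) ℂ
  init : F
  unitary : mat ∈ Matrix.unitaryGroup (Fin d × F) ℂ
  controlled : ∀ X : Matrix (Fin d) (Fin d) ℂ, Commute X U →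
    Commute (X ⊗ₖ (1 : Matrix F F ℂ)) mat
  near : ∀ (φ : ℝ) (χ : Ket d), IsEig U φ χ → angDist φ φ₀ ≤ Δ / 4 →
    mat *ᵥ withBasis χ init = -withBasis χ init
  far : ∀ (φ : ℝ) (χ : Ket d), IsEig U φ χ → 3 * Δ / 4 < angDist φ φ₀ →
    mat *ᵥ withBasis χ init = withBasis χ init

/-- A choice of oracle instances for all `U s`: each occurrence of an oracle call in a computation,
identified by the measurement outcomes and the number of calls preceding it, has its own instance.
-/
structure Oracles {d : ℕ} (U : ℝ → Matrix.unitaryGroup (Fin d) ℂ) (ρ Δ : ℝ)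
    {Λ : Type} [Fintype Λ] [DecidableEq Λ] (ph : Λ → ℝ)
    (E F : Type) [Fintype E] [DecidableEq E] [Fintype F] [DecidableEq F] where
  pe : List ℕ → ℕ → (s : ℝ) → PhaseEstimation (U s).1 ρ ph E
  refl : List ℕ → ℕ → (s φ₀ : ℝ) → Reflection (U s).1 φ₀ Δ F

/-! ## Procedures -/

/-- Adaptive quantum procedures on `r` systems and a work register with basis `W`, which return a
value in `β`. The index is the number of phase registers (each with basis `Λ`) created so far.
The `r` systems are accessible only through oracle calls, and a procedure refers to the operators
`U s` only by the parameter `s`.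

* `done b`: return `b`.
* `gate G next`: apply the unitary `G` to the work register and the phase registers.
* `measure k f next`: measure the function `f` of the basis states of these registers.
* `phaseEst s i ctrl next`: apply a new instance of phase estimation for `U s` to system `i`; this
  creates a phase register and its environment.
* `phaseEstInv k i ctrl next`: apply the inverse of the `k`-th instance to system `i`, the `k`-th
  phase register and its environment.
* `reflect s φ₀ i ctrl next`: apply a new instance of the reflection oracle for `U s` and the phase
  `φ₀` to system `i`.

Oracle calls are controlled by a predicate `ctrl` of the basis states of the work register. -/
inductive Proc (r : ℕ) (W Λ : Type) [Fintype W] [DecidableEq W] [Fintype Λ] [DecidableEq Λ]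
    (β : Type) : ℕ → Type
  | done {n : ℕ} (b : β) : Proc r W Λ β n
  | gate {n : ℕ} (G : Matrix.unitaryGroup (W × (Fin n → Λ)) ℂ) (next : Proc r W Λ β n) :
      Proc r W Λ β n
  | measure {n : ℕ} (k : ℕ) (f : W × (Fin n → Λ) → Fin k) (next : Fin k → Proc r W Λ β n) :
      Proc r W Λ β n
  | phaseEst {n : ℕ} (s : ℝ) (i : Fin r) (ctrl : W → Bool) (next : Proc r W Λ β (n + 1)) :
      Proc r W Λ β n
  | phaseEstInv {n : ℕ} (k : Fin n) (i : Fin r) (ctrl : W → Bool) (next : Proc r W Λ β n) :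
      Proc r W Λ β n
  | reflect {n : ℕ} (s φ₀ : ℝ) (i : Fin r) (ctrl : W → Bool) (next : Proc r W Λ β n) :
      Proc r W Λ β n

/-- Sequential composition. -/
def Proc.bind {r : ℕ} {W Λ : Type} [Fintype W] [DecidableEq W] [Fintype Λ] [DecidableEq Λ]
    {β β' : Type} : {n : ℕ} → Proc r W Λ β n → ((n' : ℕ) → β → Proc r W Λ β' n') →
    Proc r W Λ β' n
  | n, .done b, g => g n b
  | _, .gate G next, g => .gate G (next.bind g)
  | _, .measure k f next, g => .measure k f fun o => (next o).bind g
  | _, .phaseEst s i ctrl next, g => .phaseEst s i ctrl (next.bind g)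
  | _, .phaseEstInv k i ctrl next, g => .phaseEstInv k i ctrl (next.bind g)
  | _, .reflect s φ₀ i ctrl next, g => .reflect s φ₀ i ctrl (next.bind g)

/-- A one-step procedure. Given `a < b` and an approximation of the eigenphase at `a`, it attempts
to transform the states at `a` into those at `b`. It returns `some` approximation of the
eigenphase at `b` to report success, and `none` to report that the states have been left at `a`. -/
abbrev StepProc (r : ℕ) (W Λ : Type) [Fintype W] [DecidableEq W] [Fintype Λ] [DecidableEq Λ] :=
  (n : ℕ) → (a b φa : ℝ) → Proc r W Λ (Option ℝ) n

/-- Recursive binary subdivision with the one-step procedure `T`, stopped after at most `M`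
attempts. The copies are at `a`, with approximate eigenphase `φa`, and are to be taken
through the points of the list in order; if the attempt from `a` to the next point `b` fails, the
interval `[a, b]` is replaced by `[a, (a+b)/2]` and `[(a+b)/2, b]`. The value returned tells
whether the end has been reached. -/
def subdivide {r : ℕ} {W Λ : Type} [Fintype W] [DecidableEq W] [Fintype Λ] [DecidableEq Λ]
    (T : StepProc r W Λ) : (M : ℕ) → (a φa : ℝ) → List ℝ → (n : ℕ) → Proc r W Λ Bool n
  | _, _, _, [], _ => .done true
  | 0, _, _, _ :: _, _ => .done false
  | M + 1, a, φa, b :: rest, n =>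
      (T n a b φa).bind fun n' res =>
        match res with
        | some φb => subdivide T M b φb rest n'
        | none => subdivide T M a φa ((a + b) / 2 :: b :: rest) n'

/-! ## Running a procedure -/

/-- Basis of the total system: the `r` systems, the work register, `n` phase registers with their
environments, and the environments of `m` reflections. -/
abbrev Basis (d r : ℕ) (W Λ E F : Type) (n m : ℕ) :=
  (Fin r → Fin d) × W × (Fin n → Λ) × (Fin n → E) × (Fin m → F)

/-- The end of one run of a procedure: number of phase registers, number `m` of reflections, value
returned, number of uses of phase estimation (forward or inverse), and the final unnormalized
state, whose squared norm is the probability of the run. -/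
structure Run (d r : ℕ) (W Λ E F β : Type) where
  n : ℕ
  m : ℕ
  result : β
  peCount : ℕ
  state : Basis d r W Λ E F n m → ℂ

section Semantics

variable {d r : ℕ} {W Λ E F : Type} [Fintype W] [DecidableEq W] [Fintype Λ] [DecidableEq Λ]
  [Fintype E] [DecidableEq E] [Fintype F] [DecidableEq F] {n m : ℕ}

def applyGate (G : Matrix (W × (Fin n → Λ)) (W × (Fin n → Λ)) ℂ)
    (v : Basis d r W Λ E F n m → ℂ) : Basis d r W Λ E F n m → ℂ :=
  fun (c, w, l, e, f) => ∑ y : W × (Fin n → Λ), G (w, l) y * v (c, y.1, y.2, e, f)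

def applyMeasure {k : ℕ} (g : W × (Fin n → Λ) → Fin k) (o : Fin k)
    (v : Basis d r W Λ E F n m → ℂ) : Basis d r W Λ E F n m → ℂ :=
  fun (c, w, l, e, f) => if g (w, l) = o then v (c, w, l, e, f) else 0

/-- A new phase register and its environment are adjoined in the state `init`, and `mat` is applied
to them and system `i` if `ctrl` holds. -/
def applyPE (mat : Matrix (Fin d × (Λ × E)) (Fin d × (Λ × E)) ℂ) (init : Λ × E) (i : Fin r)
    (ctrl : W → Bool) (v : Basis d r W Λ E F n m → ℂ) : Basis d r W Λ E F (n + 1) m → ℂ :=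
  fun (c, w, l, e, f) =>
    if ctrl w then
      ∑ y : Fin d, mat (c i, (l (Fin.last n), e (Fin.last n))) (y, init) *
        v (Function.update c i y, w, Fin.init l, Fin.init e, f)
    else if (l (Fin.last n), e (Fin.last n)) = init then v (c, w, Fin.init l, Fin.init e, f)
    else 0

/-- `mat` is applied to system `i` and the `k`-th phase register and its environment. -/
def applyOn (mat : Matrix (Fin d × (Λ × E)) (Fin d × (Λ × E)) ℂ) (k : Fin n) (i : Fin r)
    (ctrl : W → Bool) (v : Basis d r W Λ E F n m → ℂ) : Basis d r W Λ E F n m → ℂ :=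
  fun (c, w, l, e, f) =>
    if ctrl w then
      ∑ y : Fin d × (Λ × E), mat (c i, (l k, e k)) y *
        v (Function.update c i y.1, w, Function.update l k y.2.1, Function.update e k y.2.2, f)
    else v (c, w, l, e, f)

/-- A new environment is adjoined in the state `init`, and `mat` is applied to it and system `i` if
`ctrl` holds. -/
def applyRefl (mat : Matrix (Fin d × F) (Fin d × F) ℂ) (init : F) (i : Fin r)
    (ctrl : W → Bool) (v : Basis d r W Λ E F n m → ℂ) : Basis d r W Λ E F n (m + 1) → ℂ :=
  fun (c, w, l, e, f) =>
    if ctrl w then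
      ∑ y : Fin d, mat (c i, f (Fin.last m)) (y, init) *
        v (Function.update c i y, w, l, e, Fin.init f)
    else if f (Fin.last m) = init then v (c, w, l, e, Fin.init f)
    else 0

variable {U : ℝ → Matrix.unitaryGroup (Fin d) ℂ} {ρ Δ : ℝ} {ph : Λ → ℝ} {β : Type}

/-- All runs of a procedure. `hist` lists the measurement outcomes so far, `tab` the instances of
phase estimation used so far, and `q` counts the uses of phase estimation so far. -/
def Proc.runs (O : Oracles U ρ Δ ph E F) : {n : ℕ} → Proc r W Λ β n → (hist : List ℕ) →
    (tab : Fin n → Matrix (Fin d × (Λ × E)) (Fin d × (Λ × E)) ℂ) → (q m : ℕ) →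
    (Basis d r W Λ E F n m → ℂ) → List (Run d r W Λ E F β)
  | n, .done b, _, _, q, m, v => [⟨n, m, b, q, v⟩]
  | _, .gate G next, hist, tab, q, m, v => next.runs O hist tab q m (applyGate G.1 v)
  | _, .measure k f next, hist, tab, q, m, v =>
      (List.finRange k).flatMap fun o =>
        (next o).runs O (o.1 :: hist) tab q m (applyMeasure f o v)
  | n, .phaseEst s i ctrl next, hist, tab, q, m, v =>
      next.runs O hist (Fin.snoc tab (O.pe hist n s).mat) (q + 1) m
        (applyPE (O.pe hist n s).mat (O.pe hist n s).init i ctrl v)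
  | _, .phaseEstInv k i ctrl next, hist, tab, q, m, v =>
      next.runs O hist tab (q + 1) m (applyOn (tab k)ᴴ k i ctrl v)
  | _, .reflect s φ₀ i ctrl next, hist, tab, q, m, v =>
      next.runs O hist tab q (m + 1)
        (applyRefl (O.refl hist m s φ₀).mat (O.refl hist m s φ₀).init i ctrl v)

/-- The state `ψ^{⊗ r}` with the work register in the basis state `w₀`. -/
def startState (ψ : Ket d) (w₀ : W) : Basis d r W Λ E F 0 0 → ℂ :=
  fun (c, w, _) => if w = w₀ then ∏ i, ψ (c i) else 0

/-- All runs of a procedure that is applied to `ψ^{⊗ r}`. -/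
def Proc.runsOn (O : Oracles U ρ Δ ph E F) (p : Proc r W Λ β 0) (ψ : Ket d) (w₀ : W) :
    List (Run d r W Λ E F β) :=
  p.runs O [] Fin.elim0 0 0 (startState ψ w₀)

end Semantics

section Quality

variable {d r : ℕ} {W Λ E F β : Type} [Fintype W] [Fintype Λ] [Fintype E] [Fintype F]

/-- The state is `χ^{⊗ r}` times an arbitrary unnormalized state of all other registers. -/
def IsCopies (χ : Ket d) {n m : ℕ} (v : Basis d r W Λ E F n m → ℂ) : Prop :=
  ∃ g : W × (Fin n → Λ) × (Fin n → E) × (Fin m → F) → ℂ,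
    ∀ c x, v (c, x) = (∏ i, χ (c i)) * g x

/-- The probability of a run. -/
def Run.prob (R : Run d r W Λ E F β) : ℝ := normSq R.state

/-- The norm of the difference between the final states and given states `good`. -/
def errorAmplitude (runs : List (Run d r W Λ E F β))
    (good : (R : Run d r W Λ E F β) → Basis d r W Λ E F R.n R.m → ℂ) : ℝ :=
  Real.sqrt (runs.map fun R => normSq (R.state - good R)).sum

/-- With runs weighted by `wt`: there are at most `P` uses of phase estimation, the average of the
number `m` of reflections is at most `A`, and that of `Γ ^ m` is at most `Γ ^ B`
for `1 ≤ Γ ≤ 7/4`. -/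
structure CostAtMost (runs : List (Run d r W Λ E F β)) (wt : Run d r W Λ E F β → ℝ)
    (P A B : ℝ) : Prop where
  phaseEst : ∀ R ∈ runs, wt R ≠ 0 → (R.peCount : ℝ) ≤ P
  mean : (runs.map fun R => wt R * (R.m : ℝ)).sum ≤ A
  tail : ∀ Γ : ℝ, 1 ≤ Γ → Γ ≤ 7 / 4 → (runs.map fun R => wt R * Γ ^ R.m).sum ≤ Γ ^ B

/-- Up to error amplitude `ε`, the runs of a one-step procedure end with copies of `ψ` and the
report `none`, or with copies of `χ` and the report of a phase within `Δ/5` of `φχ`; the first is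
the case if the overlap probability of `ψ` and `χ` is at most `1 - 3γ`, the second if it is
more than `1 - γ`. -/
def StepCorrect (runs : List (Run d r W Λ E F (Option ℝ))) (ψ χ : Ket d) (φχ γ Δ ε : ℝ) : Prop :=
  ∃ good : (R : Run d r W Λ E F (Option ℝ)) → Basis d r W Λ E F R.n R.m → ℂ,
    errorAmplitude runs good ≤ ε ∧
    ∀ R ∈ runs, good R ≠ 0 →
      (R.result = none ∧ IsCopies ψ (good R) ∧ overlap ψ χ ≤ 1 - γ) ∨
      (∃ φ', R.result = some φ' ∧ angDist φ' φχ ≤ Δ / 5 ∧ IsCopies χ (good R) ∧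
        1 - 3 * γ < overlap ψ χ)

end Quality

end EigenPaths

end

/-! Every system carries an auxiliary qubit. A step from `a` to `b` begins with all pairs in A = ψ_a
⊗ H|1⟩ and aims at B = ψ_b ⊗ |1⟩. The qubit halves the overlap probability: |⟨A|B⟩|² = p/2
(`norm_inner_ketMinus_sq`). For p ≥ 2/3 this lies in [1/3, 1/2]. After a failed measurement of B, a
reflection about A then makes the next measurement succeed with probability 4(p/2)(1 - p/2) ≥ 8/9
(`norm_pr_reflect_sq`). Without the qubit, p close to 1 would make this probability small.
Alternating measurements and reflections thus bring all r pairs to B with at most 4r reflections, up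
to probability (64/81)^r (`defectSq_drive_le`).

The phase φ_b is not known beforehand. It is extracted from phase estimation of the copies, as a
phase close to more than half of the estimates of the first half of the systems. The phase registers
are consulted coherently: a function of them is measured and the estimation is undone. Because of
the gap, an estimate close to φ_b marks exactly the component along ψ_b. So this amounts to a
measurement of the projections onto B made before the estimation (`sift_chain`). The center found in
the data selects the same systems whenever the majority of estimates is close to φ_b
(`hits_eq_pat`), which for p ≥ 2/3 fails with exponentially small probability.

The function measured is whether a fraction of at least (1-2γ)/2 of the second half is marked.
Chernoff bounds (`chernoff_upper`, `chernoff_lower`) make "yes" improbable for p ≤ 1-3γ and "no"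
improbable for p > 1-γ. In the first case dominance is used: no window of phases, wherever the
center has landed, contains more than probability 1-3γ (`norm_phaseSpace_le`). After "no", the
second half is tested for being at A. If it passes, failure is reported with all systems at `a`. If
some test fails, or after "yes", a system in B is searched for in the first half, which the count
leaves in A. Its estimated phase approximates φ_b, and all systems are driven to B
(`defectSq_advance_le`).

Errors are measured by `defect`, the norm distance of the final states from subspaces of required
states. It is subadditive in the initial state (`defect_add_le`) and adds up under composition
(`defect_bind_le`), so the traversal has error at most the number of steps times that of one step
(`defect_subdivide_le`). In the error-free part only intervals of length more than θ fail. They are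
the inner nodes of a binary tree, and their number is bounded by an entropy-like potential
(`longCount_le`). The numbers of oracle calls are bounded in every run of a step, so all averages
are immediate. -/

noncomputable section

set_option linter.unusedSectionVars false

namespace EigenPaths

open scoped Kronecker Matrix ENNReal

/-! ## Norms and distances from subspaces -/

section Norms

variable {X : Type} [Fintype X]

/-- The norm of a vector of amplitudes. -/
def nrm (v : X → ℂ) : ℝ := ‖(WithLp.toLp 2 v : EuclideanSpace ℂ X)‖

lemma nrm_nonneg (v : X → ℂ) : 0 ≤ nrm v := norm_nonneg _

lemma nrm_sq (v : X → ℂ) : nrm v ^ 2 = normSq v := by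
  rw [nrm, EuclideanSpace.norm_sq_eq]; rfl

lemma nrm_eq_sqrt (v : X → ℂ) : nrm v = Real.sqrt (normSq v) := by
  rw [← nrm_sq, Real.sqrt_sq (nrm_nonneg v)]

lemma normSq_nonneg (v : X → ℂ) : 0 ≤ normSq v := by rw [← nrm_sq]; positivity

@[simp] lemma nrm_zero : nrm (0 : X → ℂ) = 0 := by simp [nrm]

@[simp] lemma normSq_zero : normSq (0 : X → ℂ) = 0 := by simp [normSq]

/-- Orthogonal projection onto a subspace. -/
def proj (S : Submodule ℂ (X → ℂ)) (v : X → ℂ) : X → ℂ :=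
  ((S.comap (WithLp.linearEquiv 2 ℂ (X → ℂ)).toLinearMap).starProjection
    (WithLp.toLp 2 v : EuclideanSpace ℂ X)).ofLp

lemma proj_mem (S : Submodule ℂ (X → ℂ)) (v : X → ℂ) : proj S v ∈ S := by
  have := Submodule.starProjection_apply_mem
    (S.comap (WithLp.linearEquiv 2 ℂ (X → ℂ)).toLinearMap)
    (WithLp.toLp 2 v : EuclideanSpace ℂ X)
  rwa [Submodule.mem_comap] at this

lemma nrm_proj_le (S : Submodule ℂ (X → ℂ)) (v : X → ℂ) : nrm (proj S v) ≤ nrm v := by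
  have := Submodule.norm_starProjection_apply_le
    (S.comap (WithLp.linearEquiv 2 ℂ (X → ℂ)).toLinearMap)
    (WithLp.toLp 2 v : EuclideanSpace ℂ X)
  simpa [proj, nrm] using this

lemma normSq_proj_le (S : Submodule ℂ (X → ℂ)) (v : X → ℂ) : normSq (proj S v) ≤ normSq v := by
  rw [← nrm_sq, ← nrm_sq]
  exact pow_le_pow_left₀ (nrm_nonneg _) (nrm_proj_le S v) 2

/-- Distance from a subspace. -/
def resid (S : Submodule ℂ (X → ℂ)) (v : X → ℂ) : ℝ := nrm (v - proj S v)

lemma resid_eq (S : Submodule ℂ (X → ℂ)) (v : X → ℂ) : resid S v =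
    ‖(S.comap (WithLp.linearEquiv 2 ℂ (X → ℂ)).toLinearMap)ᗮ.starProjection
      (WithLp.toLp 2 v : EuclideanSpace ℂ X)‖ := by
  rw [Submodule.starProjection_orthogonal_val]; rfl

lemma resid_nonneg (S : Submodule ℂ (X → ℂ)) (v : X → ℂ) : 0 ≤ resid S v := nrm_nonneg _

lemma resid_add_le (S : Submodule ℂ (X → ℂ)) (v w : X → ℂ) :
    resid S (v + w) ≤ resid S v + resid S w := by
  rw [resid_eq, resid_eq, resid_eq, WithLp.toLp_add, map_add]
  exact norm_add_le _ _

lemma resid_le_nrm (S : Submodule ℂ (X → ℂ)) (v : X → ℂ) : resid S v ≤ nrm v := by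
  rw [resid_eq]
  exact Submodule.norm_starProjection_apply_le _ _

lemma resid_eq_zero (S : Submodule ℂ (X → ℂ)) {v : X → ℂ} (hv : v ∈ S) : resid S v = 0 := by
  rw [resid_eq, norm_eq_zero, Submodule.starProjection_apply_eq_zero_iff]
  apply Submodule.le_orthogonal_orthogonal
  simpa using hv

end Norms

/-- Minkowski's inequality for square sums. -/
lemma sqrt_sum_add_sq_le {ι : Type*} (s : Finset ι) (f g : ι → ℝ) :
    Real.sqrt (∑ i ∈ s, (f i + g i) ^ 2) ≤
      Real.sqrt (∑ i ∈ s, f i ^ 2) + Real.sqrt (∑ i ∈ s, g i ^ 2) := by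
  have h := norm_add_le (WithLp.toLp 2 (fun i : s => f i) : EuclideanSpace ℝ s)
    (WithLp.toLp 2 (fun i : s => g i))
  rw [EuclideanSpace.norm_eq, EuclideanSpace.norm_eq, EuclideanSpace.norm_eq] at h
  simp only [PiLp.add_apply, Real.norm_eq_abs, sq_abs] at h
  rwa [Finset.sum_coe_sort s (fun i => (f i + g i) ^ 2), Finset.sum_coe_sort s (fun i => f i ^ 2),
    Finset.sum_coe_sort s (fun i => g i ^ 2)] at h

/-! ## Sums over configurations -/

/-- `get x` is a part of the configuration `x`, and `up x y` is `x` with that part replaced by `y`. -/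
structure IsLens {X Y : Type} (get : X → Y) (up : X → Y → X) : Prop where
  get_up : ∀ x y, get (up x y) = y
  up_up : ∀ x y y', up (up x y) y' = up x y'
  up_get : ∀ x, up x (get x) = x

section Lens

variable {X Y : Type} [Fintype X] [Fintype Y] {get : X → Y} {up : X → Y → X}

/-- The map (x, y) ↦ (up x y, get x) is an involution of X × Y. Reindexing by it turns f (up x y)
into f x, counted once for every y. -/
lemma IsLens.sum_sum (h : IsLens get up) (f : X → ℝ) :
    ∑ x, ∑ y, f (up x y) = Fintype.card Y * ∑ x, f x := by
  let e : X × Y → X × Y := fun p => (up p.1 p.2, get p.1)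
  have he : Function.Involutive e := by
    rintro ⟨x, y⟩
    simp [e, h.get_up, h.up_up, h.up_get]
  have h1 : ∑ x, ∑ y, f (up x y) = ∑ p : X × Y, f (up p.1 p.2) := by
    rw [Fintype.sum_prod_type]
  rw [h1, ← Equiv.sum_comp he.toPerm]
  simp [e, Fintype.sum_prod_type, h.up_up, h.up_get, Finset.mul_sum]

/-- Norms of states can be compared fibre by fibre, with all registers fixed that an operation does
not touch. This avoids reordering the product of registers for every operation. -/
lemma IsLens.sum_le_sum (h : IsLens get up) {f g : X → ℝ}
    (hfg : ∀ x, ∑ y, f (up x y) ≤ ∑ y, g (up x y)) : ∑ x, f x ≤ ∑ x, g x := by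
  rcases isEmpty_or_nonempty X with h0 | ⟨⟨x⟩⟩
  · simp
  · have h1 := Finset.sum_le_sum (fun x (_ : x ∈ Finset.univ) => hfg x)
    rw [h.sum_sum, h.sum_sum] at h1
    have : (0 : ℝ) < Fintype.card Y := by
      exact_mod_cast Fintype.card_pos_iff.mpr ⟨get x⟩
    exact le_of_mul_le_mul_left h1 this

lemma IsLens.sum_eq_sum (h : IsLens get up) {f g : X → ℝ}
    (hfg : ∀ x, ∑ y, f (up x y) = ∑ y, g (up x y)) : ∑ x, f x = ∑ x, g x :=
  le_antisymm (h.sum_le_sum fun x => (hfg x).le) (h.sum_le_sum fun x => (hfg x).ge)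

end Lens

/-- A unitary matrix preserves norms. -/
lemma normSq_mulVec {Y : Type} [Fintype Y] [DecidableEq Y] {M : Matrix Y Y ℂ}
    (hM : M ∈ Matrix.unitaryGroup Y ℂ) (v : Y → ℂ) : normSq (M *ᵥ v) = normSq v := by
  have key : ∀ u : Y → ℂ, ((normSq u : ℝ) : ℂ) = star u ⬝ᵥ u := by
    intro u
    simp only [normSq, dotProduct, Pi.star_apply, Complex.ofReal_sum, Complex.ofReal_pow]
    refine Finset.sum_congr rfl fun x _ => ?_
    rw [mul_comm]
    exact (Complex.mul_conj' (u x)).symm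
  have h : ((normSq (M *ᵥ v) : ℝ) : ℂ) = normSq v := by
    rw [key, key, Matrix.star_mulVec, Matrix.dotProduct_mulVec, Matrix.vecMul_vecMul,
      ← Matrix.star_eq_conjTranspose, (Matrix.mem_unitaryGroup_iff').1 hM, Matrix.vecMul_one]
  exact_mod_cast h

/-! ## Defect of a procedure -/

section Semantics

variable {d r : ℕ} {W Λ E F : Type} [Fintype W] [DecidableEq W] [Fintype Λ] [DecidableEq Λ]
  [Fintype E] [DecidableEq E] [Fintype F] [DecidableEq F] {n m : ℕ}

section Linear

lemma applyGate_add (G : Matrix (W × (Fin n → Λ)) (W × (Fin n → Λ)) ℂ)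
    (v v' : Basis d r W Λ E F n m → ℂ) :
    applyGate G (v + v') = applyGate G v + applyGate G v' := by
  funext ⟨c, w, l, e, f⟩
  simp [applyGate, mul_add, Finset.sum_add_distrib]

lemma applyMeasure_add {k : ℕ} (g : W × (Fin n → Λ) → Fin k) (o : Fin k)
    (v v' : Basis d r W Λ E F n m → ℂ) :
    applyMeasure g o (v + v') = applyMeasure g o v + applyMeasure g o v' := by
  funext ⟨c, w, l, e, f⟩
  by_cases h : g (w, l) = o <;> simp [applyMeasure, h]

lemma applyPE_add (mat : Matrix (Fin d × (Λ × E)) (Fin d × (Λ × E)) ℂ) (init : Λ × E) (i : Fin r)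
    (ctrl : W → Bool) (v v' : Basis d r W Λ E F n m → ℂ) :
    applyPE mat init i ctrl (v + v') = applyPE mat init i ctrl v + applyPE mat init i ctrl v' := by
  funext ⟨c, w, l, e, f⟩
  simp only [applyPE, Pi.add_apply]
  split_ifs <;> simp [mul_add, Finset.sum_add_distrib]

lemma applyOn_add (mat : Matrix (Fin d × (Λ × E)) (Fin d × (Λ × E)) ℂ) (k : Fin n) (i : Fin r)
    (ctrl : W → Bool) (v v' : Basis d r W Λ E F n m → ℂ) :
    applyOn mat k i ctrl (v + v') = applyOn mat k i ctrl v + applyOn mat k i ctrl v' := by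
  funext ⟨c, w, l, e, f⟩
  simp only [applyOn, Pi.add_apply]
  split_ifs <;> simp [mul_add, Finset.sum_add_distrib]

lemma applyRefl_add (mat : Matrix (Fin d × F) (Fin d × F) ℂ) (init : F) (i : Fin r)
    (ctrl : W → Bool) (v v' : Basis d r W Λ E F n m → ℂ) :
    applyRefl mat init i ctrl (v + v') =
      applyRefl mat init i ctrl v + applyRefl mat init i ctrl v' := by
  funext ⟨c, w, l, e, f⟩
  simp only [applyRefl, Pi.add_apply]
  split_ifs <;> simp [mul_add, Finset.sum_add_distrib]

end Linear

section Isometry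

lemma lens_gate : IsLens (fun x : Basis d r W Λ E F n m => (x.2.1, x.2.2.1))
    (fun x y => (x.1, y.1, y.2, x.2.2.2.1, x.2.2.2.2)) :=
  ⟨fun _ _ => rfl, fun _ _ _ => rfl, fun _ => rfl⟩

/-- Replace the state of system `i`. -/
def setC (i : Fin r) (x : Basis d r W Λ E F n m) (y : Fin d) : Basis d r W Λ E F n m :=
  (Function.update x.1 i y, x.2)

lemma lens_setC (i : Fin r) : IsLens (fun x : Basis d r W Λ E F n m => x.1 i) (setC i) :=
  ⟨fun x y => by simp [setC], fun x y y' => by simp [setC], fun x => by simp [setC]⟩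

/-- Adjoin a phase register and its environment to a configuration. -/
def addReg (x : Basis d r W Λ E F n m) (z : Λ × E) : Basis d r W Λ E F (n + 1) m :=
  (x.1, x.2.1, Fin.snoc (α := fun _ => Λ) x.2.2.1 z.1, Fin.snoc (α := fun _ => E) x.2.2.2.1 z.2,
    x.2.2.2.2)

/-- Adjoin the environment of a reflection to a configuration. -/
def addEnv (x : Basis d r W Λ E F n m) (z : F) : Basis d r W Λ E F n (m + 1) :=
  (x.1, x.2.1, x.2.2.1, x.2.2.2.1, Fin.snoc (α := fun _ => F) x.2.2.2.2 z)

lemma exists_addReg (x : Basis d r W Λ E F (n + 1) m) : ∃ y z, x = addReg y z := by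
  obtain ⟨c, w, l, e, f⟩ := x
  exact ⟨(c, w, Fin.init l, Fin.init e, f), (l (Fin.last n), e (Fin.last n)), by simp [addReg]⟩

lemma exists_addEnv (x : Basis d r W Λ E F n (m + 1)) : ∃ y z, x = addEnv y z := by
  obtain ⟨c, w, l, e, f⟩ := x
  exact ⟨(c, w, l, e, Fin.init f), f (Fin.last m), by simp [addEnv]⟩

lemma sum_addReg (f : Basis d r W Λ E F (n + 1) m → ℝ) :
    ∑ x, f x = ∑ x : Basis d r W Λ E F n m, ∑ z, f (addReg x z) := by
  rw [← Fintype.sum_prod_type']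
  refine (Function.Bijective.sum_comp (e := fun p : Basis d r W Λ E F n m × (Λ × E) =>
    addReg p.1 p.2) ⟨?_, ?_⟩ f).symm
  · rintro ⟨⟨c, w, l, e, f⟩, z, t⟩ ⟨⟨c', w', l', e', f'⟩, z', t'⟩ h
    simp only [addReg, Prod.mk.injEq, Fin.snoc_inj] at h
    obtain ⟨rfl, rfl, ⟨rfl, rfl⟩, ⟨rfl, rfl⟩, rfl⟩ := h
    rfl
  · intro x
    obtain ⟨y, z, rfl⟩ := exists_addReg x
    exact ⟨(y, z), rfl⟩

lemma sum_addEnv (f : Basis d r W Λ E F n (m + 1) → ℝ) :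
    ∑ x, f x = ∑ x : Basis d r W Λ E F n m, ∑ z, f (addEnv x z) := by
  rw [← Fintype.sum_prod_type']
  refine (Function.Bijective.sum_comp (e := fun p : Basis d r W Λ E F n m × F =>
    addEnv p.1 p.2) ⟨?_, ?_⟩ f).symm
  · rintro ⟨⟨c, w, l, e, f⟩, z⟩ ⟨⟨c', w', l', e', f'⟩, z'⟩ h
    simp only [addEnv, Prod.mk.injEq, Fin.snoc_inj] at h
    obtain ⟨rfl, rfl, rfl, rfl, ⟨rfl, rfl⟩⟩ := h
    rfl
  · intro x
    obtain ⟨y, z, rfl⟩ := exists_addEnv x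
    exact ⟨(y, z), rfl⟩

lemma normSq_applyGate (G : Matrix.unitaryGroup (W × (Fin n → Λ)) ℂ)
    (v : Basis d r W Λ E F n m → ℂ) : normSq (applyGate G.1 v) = normSq v :=
  lens_gate.sum_eq_sum fun x =>
    normSq_mulVec G.2 (fun y : W × (Fin n → Λ) => v (x.1, y.1, y.2, x.2.2.2.1, x.2.2.2.2))

lemma sum_normSq_applyMeasure {k : ℕ} (g : W × (Fin n → Λ) → Fin k)
    (v : Basis d r W Λ E F n m → ℂ) :
    ∑ o, normSq (applyMeasure g o v) = normSq v := by
  unfold normSq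
  rw [Finset.sum_comm]
  refine Finset.sum_congr rfl fun ⟨c, w, l, e, f⟩ _ => ?_
  simp only [applyMeasure]
  rw [Finset.sum_eq_single (g (w, l))]
  · simp
  · intro o _ ho
    simp [ho.symm]
  · simp

lemma mulVec_single_snd {Z : Type} [Fintype Z] [DecidableEq Z]
    (M : Matrix (Fin d × Z) (Fin d × Z) ℂ) (z₀ : Z) (u : Fin d → ℂ) (p : Fin d × Z) :
    (M *ᵥ fun x => if x.2 = z₀ then u x.1 else 0) p = ∑ y, M p (y, z₀) * u y := by
  simp [Matrix.mulVec, dotProduct, Fintype.sum_prod_type]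

lemma applyPE_addReg (mat : Matrix (Fin d × (Λ × E)) (Fin d × (Λ × E)) ℂ) (init : Λ × E)
    (i : Fin r) (ctrl : W → Bool) (v : Basis d r W Λ E F n m → ℂ) (x : Basis d r W Λ E F n m)
    (z : Λ × E) : applyPE mat init i ctrl v (addReg x z) =
      if ctrl x.2.1 then
        (mat *ᵥ fun p => if p.2 = init then v (setC i x p.1) else 0) (x.1 i, z)
      else if z = init then v x else 0 := by
  rw [mulVec_single_snd mat init (fun y => v (setC i x y))]
  simp [applyPE, addReg, setC]

lemma applyRefl_addEnv (mat : Matrix (Fin d × F) (Fin d × F) ℂ) (init : F)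
    (i : Fin r) (ctrl : W → Bool) (v : Basis d r W Λ E F n m → ℂ) (x : Basis d r W Λ E F n m)
    (z : F) : applyRefl mat init i ctrl v (addEnv x z) =
      if ctrl x.2.1 then
        (mat *ᵥ fun p => if p.2 = init then v (setC i x p.1) else 0) (x.1 i, z)
      else if z = init then v x else 0 := by
  rw [mulVec_single_snd mat init (fun y => v (setC i x y))]
  simp [applyRefl, addEnv, setC]

lemma sum_normSq_withInit {Z : Type} [Fintype Z] [DecidableEq Z] (z₀ : Z) (u : Fin d → ℂ) :
    normSq (fun p : Fin d × Z => if p.2 = z₀ then u p.1 else 0) = ∑ y, ‖u y‖ ^ 2 := by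
  simp only [normSq, Fintype.sum_prod_type]
  refine Finset.sum_congr rfl fun y _ => ?_
  rw [Finset.sum_eq_single z₀] <;> simp +contextual

lemma normSq_applyPE {mat : Matrix (Fin d × (Λ × E)) (Fin d × (Λ × E)) ℂ}
    (hm : mat ∈ Matrix.unitaryGroup (Fin d × (Λ × E)) ℂ) (init : Λ × E) (i : Fin r)
    (ctrl : W → Bool) (v : Basis d r W Λ E F n m → ℂ) :
    normSq (applyPE mat init i ctrl v) = normSq v := by
  unfold normSq
  rw [sum_addReg]
  refine (lens_setC i).sum_eq_sum fun x => ?_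
  simp only [applyPE_addReg, show ∀ y, (setC i x y).2.1 = x.2.1 from fun _ => rfl]
  by_cases hc : ctrl x.2.1
  · simp only [hc, if_true, (lens_setC i).up_up, (lens_setC i).get_up]
    rw [← Fintype.sum_prod_type', ← sum_normSq_withInit init, ← normSq_mulVec hm]
    rfl
  · simp only [hc]
    refine Finset.sum_congr rfl fun y _ => ?_
    rw [Finset.sum_eq_single init] <;> simp +contextual

lemma normSq_applyRefl {mat : Matrix (Fin d × F) (Fin d × F) ℂ}
    (hm : mat ∈ Matrix.unitaryGroup (Fin d × F) ℂ) (init : F) (i : Fin r)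
    (ctrl : W → Bool) (v : Basis d r W Λ E F n m → ℂ) :
    normSq (applyRefl mat init i ctrl v) = normSq v := by
  unfold normSq
  rw [sum_addEnv]
  refine (lens_setC i).sum_eq_sum fun x => ?_
  simp only [applyRefl_addEnv, show ∀ y, (setC i x y).2.1 = x.2.1 from fun _ => rfl]
  by_cases hc : ctrl x.2.1
  · simp only [hc, if_true, (lens_setC i).up_up, (lens_setC i).get_up]
    rw [← Fintype.sum_prod_type', ← sum_normSq_withInit init, ← normSq_mulVec hm]
    rfl
  · simp only [hc]
    refine Finset.sum_congr rfl fun y _ => ?_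
    rw [Finset.sum_eq_single init] <;> simp +contextual

lemma lens_on (k : Fin n) (i : Fin r) :
    IsLens (fun x : Basis d r W Λ E F n m => (x.1 i, (x.2.2.1 k, x.2.2.2.1 k)))
    (fun x y => (Function.update x.1 i y.1, x.2.1, Function.update x.2.2.1 k y.2.1,
      Function.update x.2.2.2.1 k y.2.2, x.2.2.2.2)) :=
  ⟨fun x y => by simp, fun x y y' => by simp, fun x => by simp⟩

lemma normSq_applyOn {mat : Matrix (Fin d × (Λ × E)) (Fin d × (Λ × E)) ℂ}
    (hm : mat ∈ Matrix.unitaryGroup (Fin d × (Λ × E)) ℂ) (k : Fin n) (i : Fin r)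
    (ctrl : W → Bool) (v : Basis d r W Λ E F n m → ℂ) :
    normSq (applyOn mat k i ctrl v) = normSq v := by
  refine (lens_on k i).sum_eq_sum fun x => ?_
  by_cases hc : ctrl x.2.1
  · simp only [applyOn, hc, if_true, Function.update_idem, Function.update_self]
    exact normSq_mulVec hm (fun y => v (Function.update x.1 i y.1, x.2.1,
      Function.update x.2.2.1 k y.2.1, Function.update x.2.2.2.1 k y.2.2, x.2.2.2.2))
  · simp [applyOn, hc]

end Isometry

section Defect

variable {U : ℝ → Matrix.unitaryGroup (Fin d) ℂ} {ρ Δ : ℝ} {ph : Λ → ℝ} {β : Type}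

/-- The final states that are required of a procedure: a subspace for all numbers of registers,
numbers of uses of phase estimation and values returned. -/
abbrev Target (d r : ℕ) (W Λ E F β : Type) :=
  (n m q : ℕ) → β → Submodule ℂ (Basis d r W Λ E F n m → ℂ)

/-- The squared distance of the final states of a procedure from the required ones. -/
def defectSq (O : Oracles U ρ Δ ph E F) (S : Target d r W Λ E F β) {n : ℕ}
    (p : Proc r W Λ β n) (hist : List ℕ)
    (tab : Fin n → Matrix (Fin d × (Λ × E)) (Fin d × (Λ × E)) ℂ) (q m : ℕ)
    (v : Basis d r W Λ E F n m → ℂ) : ℝ :=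
  ((p.runs O hist tab q m v).map fun R =>
    resid (S R.n R.m R.peCount R.result) R.state ^ 2).sum

variable (O : Oracles U ρ Δ ph E F) (S : Target d r W Λ E F β)
  (hist : List ℕ) (tab : Fin n → Matrix (Fin d × (Λ × E)) (Fin d × (Λ × E)) ℂ) (q : ℕ)

lemma defectSq_done (b : β) (v : Basis d r W Λ E F n m → ℂ) :
    defectSq O S (.done b) hist tab q m v = resid (S n m q b) v ^ 2 := by
  simp [defectSq, Proc.runs]

lemma defectSq_gate (G : Matrix.unitaryGroup (W × (Fin n → Λ)) ℂ) (p : Proc r W Λ β n)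
    (v : Basis d r W Λ E F n m → ℂ) :
    defectSq O S (.gate G p) hist tab q m v = defectSq O S p hist tab q m (applyGate G.1 v) := rfl

lemma sum_runs_measure {M : Type*} [AddCommMonoid M] {k : ℕ} (f : W × (Fin n → Λ) → Fin k)
    (p : Fin k → Proc r W Λ β n)
    (v : Basis d r W Λ E F n m → ℂ) (g : Run d r W Λ E F β → M) :
    (((Proc.measure k f p).runs O hist tab q m v).map g).sum = ∑ o,
      (((p o).runs O (o.1 :: hist) tab q m (applyMeasure f o v)).map g).sum := by
  rw [Proc.runs, List.map_flatMap, List.flatMap_def, List.sum_flatten, List.map_map,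
    ← List.ofFn_eq_map, List.sum_ofFn]
  rfl

lemma defectSq_measure {k : ℕ} (f : W × (Fin n → Λ) → Fin k) (p : Fin k → Proc r W Λ β n)
    (v : Basis d r W Λ E F n m → ℂ) :
    defectSq O S (.measure k f p) hist tab q m v = ∑ o, defectSq O S (p o) (o.1 :: hist) tab q m
      (applyMeasure f o v) := sum_runs_measure O hist tab q f p v _

lemma defectSq_phaseEst (s : ℝ) (i : Fin r) (ctrl : W → Bool) (p : Proc r W Λ β (n + 1))
    (v : Basis d r W Λ E F n m → ℂ) :
    defectSq O S (.phaseEst s i ctrl p) hist tab q m v =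
      defectSq O S p hist (Fin.snoc tab (O.pe hist n s).mat) (q + 1) m
        (applyPE (O.pe hist n s).mat (O.pe hist n s).init i ctrl v) := rfl

lemma defectSq_phaseEstInv (k : Fin n) (i : Fin r) (ctrl : W → Bool) (p : Proc r W Λ β n)
    (v : Basis d r W Λ E F n m → ℂ) :
    defectSq O S (.phaseEstInv k i ctrl p) hist tab q m v =
      defectSq O S p hist tab (q + 1) m (applyOn (tab k)ᴴ k i ctrl v) := rfl

lemma defectSq_reflect (s φ₀ : ℝ) (i : Fin r) (ctrl : W → Bool) (p : Proc r W Λ β n)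
    (v : Basis d r W Λ E F n m → ℂ) :
    defectSq O S (.reflect s φ₀ i ctrl p) hist tab q m v =
      defectSq O S p hist tab q (m + 1)
        (applyRefl (O.refl hist m s φ₀).mat (O.refl hist m s φ₀).init i ctrl v) := rfl

lemma defectSq_nonneg (p : Proc r W Λ β n) (v : Basis d r W Λ E F n m → ℂ) :
    0 ≤ defectSq O S p hist tab q m v := by
  refine List.sum_nonneg fun x hx => ?_
  obtain ⟨R, -, rfl⟩ := List.mem_map.1 hx
  positivity

/-- Tables of instances of phase estimation. -/
def UnitaryTab (tab : Fin n → Matrix (Fin d × (Λ × E)) (Fin d × (Λ × E)) ℂ) : Prop :=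
  ∀ k, tab k ∈ Matrix.unitaryGroup (Fin d × (Λ × E)) ℂ

lemma UnitaryTab.snoc {tab : Fin n → Matrix (Fin d × (Λ × E)) (Fin d × (Λ × E)) ℂ}
    (h : UnitaryTab tab) {M : Matrix (Fin d × (Λ × E)) (Fin d × (Λ × E)) ℂ}
    (hM : M ∈ Matrix.unitaryGroup (Fin d × (Λ × E)) ℂ) :
    UnitaryTab (Fin.snoc (α := fun _ => Matrix (Fin d × (Λ × E)) (Fin d × (Λ × E)) ℂ) tab M) := by
  intro k
  refine Fin.lastCases ?_ (fun j => ?_) k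
  · simpa using hM
  · simpa using h j

/-- Oracle calls and gates are isometries, and a measurement splits the state into orthogonal parts.
-/
lemma sum_prob {n m : ℕ} (p : Proc r W Λ β n) (hist : List ℕ)
    (tab : Fin n → Matrix (Fin d × (Λ × E)) (Fin d × (Λ × E)) ℂ) (htab : UnitaryTab tab) (q : ℕ)
    (v : Basis d r W Λ E F n m → ℂ) :
    ((p.runs O hist tab q m v).map fun R => normSq R.state).sum = normSq v := by
  induction p generalizing hist q m with
  | done b => simp [Proc.runs]
  | gate G p ih => rw [Proc.runs, ih _ _ htab, normSq_applyGate]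
  | measure k f p ih =>
    rw [sum_runs_measure]
    simp only [ih _ _ _ htab]
    exact sum_normSq_applyMeasure f v
  | phaseEst s i ctrl p ih =>
    rw [Proc.runs, ih _ _ (htab.snoc (O.pe _ _ s).unitary), normSq_applyPE (O.pe _ _ s).unitary]
  | phaseEstInv k i ctrl p ih =>
    rw [Proc.runs, ih _ _ htab, normSq_applyOn]
    rw [← Matrix.star_eq_conjTranspose]
    exact Unitary.star_mem (htab k)
  | reflect s φ₀ i ctrl p ih =>
    rw [Proc.runs, ih _ _ htab, normSq_applyRefl (O.refl _ _ s φ₀).unitary]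

/-- The distance of the final states of a procedure from the required ones. -/
def defect (O : Oracles U ρ Δ ph E F) (S : Target d r W Λ E F β) {n : ℕ}
    (p : Proc r W Λ β n) (hist : List ℕ)
    (tab : Fin n → Matrix (Fin d × (Λ × E)) (Fin d × (Λ × E)) ℂ) (q m : ℕ)
    (v : Basis d r W Λ E F n m → ℂ) : ℝ :=
  Real.sqrt (defectSq O S p hist tab q m v)

lemma defect_nonneg (p : Proc r W Λ β n) (v : Basis d r W Λ E F n m → ℂ) :
    0 ≤ defect O S p hist tab q m v := Real.sqrt_nonneg _

lemma defect_sq (p : Proc r W Λ β n) (v : Basis d r W Λ E F n m → ℂ) :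
    defect O S p hist tab q m v ^ 2 = defectSq O S p hist tab q m v :=
  Real.sq_sqrt (defectSq_nonneg O S hist tab q p v)

lemma defectSq_le_normSq (htab : UnitaryTab tab) (p : Proc r W Λ β n)
    (v : Basis d r W Λ E F n m → ℂ) : defectSq O S p hist tab q m v ≤ normSq v := by
  rw [← sum_prob O p hist tab htab q v]
  refine List.sum_le_sum fun R _ => ?_
  rw [← nrm_sq]
  exact pow_le_pow_left₀ (resid_nonneg _ _) (resid_le_nrm _ _) 2

lemma defect_le_nrm (htab : UnitaryTab tab) (p : Proc r W Λ β n)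
    (v : Basis d r W Λ E F n m → ℂ) : defect O S p hist tab q m v ≤ nrm v := by
  rw [nrm_eq_sqrt]
  exact Real.sqrt_le_sqrt (defectSq_le_normSq O S hist tab q htab p v)

/-- Each run is linear in the initial state and the distance from a subspace is subadditive; the
runs combine by Minkowski's inequality. Together with `defect_le_nrm` this permits replacing a state
by an ideal one at the cost of the norm of the difference. -/
lemma defect_add_le {n m : ℕ} (p : Proc r W Λ β n) (hist : List ℕ)
    (tab : Fin n → Matrix (Fin d × (Λ × E)) (Fin d × (Λ × E)) ℂ) (q : ℕ)
    (v v' : Basis d r W Λ E F n m → ℂ) :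
    defect O S p hist tab q m (v + v') ≤
      defect O S p hist tab q m v + defect O S p hist tab q m v' := by
  induction p generalizing hist q m with
  | done b =>
    simp only [defect, defectSq_done, Real.sqrt_sq (resid_nonneg _ _)]
    exact resid_add_le _ _ _
  | gate G p ih =>
    simp only [defect, defectSq_gate, applyGate_add]
    exact ih _ _ _ _ _
  | measure k f p ih =>
    unfold defect
    simp only [defectSq_measure, applyMeasure_add]
    simp only [← defect_sq]
    refine le_trans (Real.sqrt_le_sqrt (Finset.sum_le_sum fun o _ =>
      pow_le_pow_left₀ (defect_nonneg _ _ _ _ _ _ _) (ih o _ _ _ _ _) 2))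
      (sqrt_sum_add_sq_le _ _ _)
  | phaseEst s i ctrl p ih =>
    simp only [defect, defectSq_phaseEst, applyPE_add]
    exact ih _ _ _ _ _
  | phaseEstInv k i ctrl p ih =>
    simp only [defect, defectSq_phaseEstInv, applyOn_add]
    exact ih _ _ _ _ _
  | reflect s φ₀ i ctrl p ih =>
    simp only [defect, defectSq_reflect, applyRefl_add]
    exact ih _ _ _ _ _

end Defect
end Semantics

/-! ### Bounds on oracle calls, and errors under sequential composition -/

section Bind

variable {d r : ℕ} {W Λ E F : Type} [Fintype W] [DecidableEq W] [Fintype Λ] [DecidableEq Λ]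
  [Fintype E] [DecidableEq E] [Fintype F] [DecidableEq F] {n m : ℕ} {β β' : Type}
  {U : ℝ → Matrix.unitaryGroup (Fin d) ℂ} {ρ Δ : ℝ} {ph : Λ → ℝ}

/-- The procedure contains at most `P` uses of phase estimation and `A` reflections in every run. -/
inductive Proc.Bounded : {n : ℕ} → Proc r W Λ β n → ℕ → ℕ → Prop
  | done {n : ℕ} (b : β) (P A : ℕ) : Proc.Bounded (n := n) (.done b) P A
  | gate {n : ℕ} (G : Matrix.unitaryGroup (W × (Fin n → Λ)) ℂ) {p : Proc r W Λ β n} {P A : ℕ} :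
      Proc.Bounded p P A → Proc.Bounded (.gate G p) P A
  | measure {n k : ℕ} (f : W × (Fin n → Λ) → Fin k) {p : Fin k → Proc r W Λ β n} {P A : ℕ} :
      (∀ o, Proc.Bounded (p o) P A) → Proc.Bounded (.measure k f p) P A
  | phaseEst {n : ℕ} (s : ℝ) (i : Fin r) (ctrl : W → Bool) {p : Proc r W Λ β (n + 1)} {P A : ℕ} :
      Proc.Bounded p P A → Proc.Bounded (.phaseEst s i ctrl p) (P + 1) A
  | phaseEstInv {n : ℕ} (k : Fin n) (i : Fin r) (ctrl : W → Bool) {p : Proc r W Λ β n}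
      {P A : ℕ} : Proc.Bounded p P A → Proc.Bounded (.phaseEstInv k i ctrl p) (P + 1) A
  | reflect {n : ℕ} (s φ₀ : ℝ) (i : Fin r) (ctrl : W → Bool) {p : Proc r W Λ β n}
      {P A : ℕ} : Proc.Bounded p P A → Proc.Bounded (.reflect s φ₀ i ctrl p) P (A + 1)

lemma Proc.Bounded.mono {n : ℕ} {p : Proc r W Λ β n} {P A : ℕ} (h : p.Bounded P A) :
    ∀ {P' A' : ℕ}, P ≤ P' → A ≤ A' → p.Bounded P' A' := by
  induction h with
  | done b P A => intro P' A' _ _; exact .done b P' A'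
  | gate G _ ih => intro P' A' h1 h2; exact .gate G (ih h1 h2)
  | measure f _ ih => intro P' A' h1 h2; exact .measure f fun o => ih o h1 h2
  | phaseEst s i ctrl _ ih =>
    intro P' A' h1 h2
    obtain ⟨P', rfl⟩ : ∃ k, P' = k + 1 := ⟨P' - 1, by omega⟩
    exact .phaseEst s i ctrl (ih (by omega) h2)
  | phaseEstInv k i ctrl _ ih =>
    intro P' A' h1 h2
    obtain ⟨P', rfl⟩ : ∃ k, P' = k + 1 := ⟨P' - 1, by omega⟩
    exact .phaseEstInv k i ctrl (ih (by omega) h2)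
  | reflect s φ₀ i ctrl _ ih =>
    intro P' A' h1 h2
    obtain ⟨A', rfl⟩ : ∃ k, A' = k + 1 := ⟨A' - 1, by omega⟩
    exact .reflect s φ₀ i ctrl (ih h1 (by omega))

variable (O : Oracles U ρ Δ ph E F)

lemma Proc.Bounded.runs_le {n m : ℕ} {p : Proc r W Λ β n} {P A : ℕ} (h : p.Bounded P A)
    (hist : List ℕ) (tab : Fin n → Matrix (Fin d × (Λ × E)) (Fin d × (Λ × E)) ℂ) (q : ℕ)
    (v : Basis d r W Λ E F n m → ℂ) {R : Run d r W Λ E F β}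
    (hR : R ∈ p.runs O hist tab q m v) : R.peCount ≤ q + P ∧ R.m ≤ m + A := by
  induction h generalizing hist q m with
  | done b P A =>
    rw [Proc.runs, List.mem_singleton] at hR
    subst hR
    simp
  | gate G _ ih => exact ih _ _ _ _ hR
  | measure f _ ih =>
    rw [Proc.runs, List.mem_flatMap] at hR
    obtain ⟨o, -, hR⟩ := hR
    exact ih o _ _ _ _ hR
  | phaseEst s i ctrl _ ih =>
    have := ih _ _ _ _ hR
    omega
  | phaseEstInv k i ctrl _ ih =>
    have := ih _ _ _ _ hR
    omega
  | reflect s φ₀ i ctrl _ ih =>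
    have := ih _ _ _ _ hR
    omega

lemma Proc.Bounded.bind {n : ℕ} {p : Proc r W Λ β n} {P A P' A' : ℕ} (h : p.Bounded P A)
    {g : (n' : ℕ) → β → Proc r W Λ β' n'} (hg : ∀ n' b, (g n' b).Bounded P' A') :
    (p.bind g).Bounded (P + P') (A + A') := by
  induction h with
  | done b P A => exact (hg _ b).mono (by omega) (by omega)
  | gate G _ ih => exact .gate G ih
  | measure f _ ih => exact .measure f ih
  | phaseEst s i ctrl _ ih => rw [Nat.add_right_comm]; exact .phaseEst s i ctrl ih
  | phaseEstInv k i ctrl _ ih => rw [Nat.add_right_comm]; exact .phaseEstInv k i ctrl ih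
  | reflect s φ₀ i ctrl _ ih => rw [Nat.add_right_comm _ 1]; exact .reflect s φ₀ i ctrl ih

lemma sqrt_list_sum_add_sq_le {α : Type*} (l : List α) (f g : α → ℝ) :
    Real.sqrt (l.map fun a => (f a + g a) ^ 2).sum ≤
      Real.sqrt (l.map fun a => f a ^ 2).sum + Real.sqrt (l.map fun a => g a ^ 2).sum := by
  rw [← Fin.sum_univ_fun_getElem, ← Fin.sum_univ_fun_getElem, ← Fin.sum_univ_fun_getElem]
  exact sqrt_sum_add_sq_le _ _ _

/-- At the end of each run of `p` the state is split into its projection onto the required subspace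
and the rest. The rest costs at most its norm; the projection is an admissible input of `g`. The
bounds `Q` and `M` restrict the hypothesis on `g` to counter values that `p` can reach, so that
targets may depend on the counters. -/
lemma defectSq_bind_le {n m : ℕ} (S : Target d r W Λ E F β) (S' : Target d r W Λ E F β')
    {p : Proc r W Λ β n} {P A Q M : ℕ} (hb : p.Bounded P A)
    (g : (n' : ℕ) → β → Proc r W Λ β' n') {ε : ℝ} (hε : 0 ≤ ε)
    (hg : ∀ (n' : ℕ) (b : β) (hist : List ℕ)
      (tab : Fin n' → Matrix (Fin d × (Λ × E)) (Fin d × (Λ × E)) ℂ) (q m : ℕ)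
      (v : Basis d r W Λ E F n' m → ℂ), UnitaryTab tab → q ≤ Q → m ≤ M → v ∈ S n' m q b →
      defect O S' (g n' b) hist tab q m v ≤ ε * nrm v)
    (hist : List ℕ) (tab : Fin n → Matrix (Fin d × (Λ × E)) (Fin d × (Λ × E)) ℂ)
    (htab : UnitaryTab tab) (q : ℕ) (hq : q + P ≤ Q) (hm : m + A ≤ M)
    (v : Basis d r W Λ E F n m → ℂ) :
    defectSq O S' (p.bind g) hist tab q m v ≤ ((p.runs O hist tab q m v).map fun R =>
      (resid (S R.n R.m R.peCount R.result) R.state + ε * nrm R.state) ^ 2).sum := by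
  induction hb generalizing hist q m with
  | done b P A =>
    simp only [Proc.bind, Proc.runs, List.map_cons, List.map_nil, List.sum_cons, List.sum_nil,
      add_zero]
    rw [← defect_sq]
    refine pow_le_pow_left₀ (defect_nonneg _ _ _ _ _ _ _) ?_ 2
    have h1 := defect_add_le O S' (g _ b) hist tab q (v - proj (S _ m q b) v)
      (proj (S _ m q b) v)
    rw [sub_add_cancel] at h1
    refine h1.trans (add_le_add (defect_le_nrm O S' hist tab q htab _ _) ?_)
    refine (hg _ b hist tab q m _ htab (by omega) (by omega) (proj_mem _ _)).trans ?_
    exact mul_le_mul_of_nonneg_left (nrm_proj_le _ _) hε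
  | gate G _ ih => exact ih _ _ htab _ hq hm _
  | measure f _ ih =>
    rw [Proc.bind, defectSq_measure, sum_runs_measure]
    exact Finset.sum_le_sum fun o _ => ih o _ _ htab _ hq hm _
  | phaseEst s i ctrl _ ih =>
    exact ih _ _ (htab.snoc (O.pe _ _ s).unitary) _ (by omega) hm _
  | phaseEstInv k i ctrl _ ih => exact ih _ _ htab _ (by omega) hm _
  | reflect s φ₀ i ctrl _ ih => exact ih _ _ htab _ hq (by omega) _

/-- Error amplitudes add: Minkowski's inequality over the runs of `p`, whose squared norms sum to
that of `v`. -/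
lemma defect_bind_le {n m : ℕ} (S : Target d r W Λ E F β) (S' : Target d r W Λ E F β')
    {p : Proc r W Λ β n} {P A Q M : ℕ} (hb : p.Bounded P A)
    (g : (n' : ℕ) → β → Proc r W Λ β' n') {ε : ℝ} (hε : 0 ≤ ε)
    (hg : ∀ (n' : ℕ) (b : β) (hist : List ℕ)
      (tab : Fin n' → Matrix (Fin d × (Λ × E)) (Fin d × (Λ × E)) ℂ) (q m : ℕ)
      (v : Basis d r W Λ E F n' m → ℂ), UnitaryTab tab → q ≤ Q → m ≤ M → v ∈ S n' m q b →
      defect O S' (g n' b) hist tab q m v ≤ ε * nrm v)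
    (hist : List ℕ) (tab : Fin n → Matrix (Fin d × (Λ × E)) (Fin d × (Λ × E)) ℂ)
    (htab : UnitaryTab tab) (q : ℕ) (hq : q + P ≤ Q) (hm : m + A ≤ M)
    (v : Basis d r W Λ E F n m → ℂ) :
    defect O S' (p.bind g) hist tab q m v ≤ defect O S p hist tab q m v + ε * nrm v := by
  refine (Real.sqrt_le_sqrt (defectSq_bind_le O S S' hb g hε hg hist tab htab q hq hm v)).trans ?_
  refine (sqrt_list_sum_add_sq_le _ _ _).trans (add_le_add le_rfl ?_)
  simp only [mul_pow, nrm_sq, List.sum_map_mul_left]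
  rw [sum_prob O p hist tab htab q v, ← nrm_sq, ← mul_pow,
    Real.sqrt_sq (mul_nonneg hε (nrm_nonneg _))]

end Bind

/-! ## Eigenvectors of unitary matrices -/

section Spectral

variable {d : ℕ} {U : Matrix (Fin d) (Fin d) ℂ}

/-- The span of the eigenvectors with eigenphases that satisfy `Q`. -/
def eigSpan (U : Matrix (Fin d) (Fin d) ℂ) (Q : ℝ → Prop) : Submodule ℂ (Ket d) :=
  Submodule.span ℂ {χ | ∃ φ, IsEig U φ χ ∧ Q φ}

/-- The linear map of a matrix. -/
def opOf (U : Matrix (Fin d) (Fin d) ℂ) : Ket d →ₗ[ℂ] Ket d :=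
  (WithLp.linearEquiv 2 ℂ (Fin d → ℂ)).symm.toLinearMap ∘ₗ U.mulVecLin ∘ₗ
    (WithLp.linearEquiv 2 ℂ (Fin d → ℂ)).toLinearMap

lemma opOf_apply (χ : Ket d) : opOf U χ = WithLp.toLp 2 (U *ᵥ χ.ofLp) := rfl

lemma isEig_iff {φ : ℝ} {χ : Ket d} :
    IsEig U φ χ ↔ opOf U χ = Complex.exp (φ * Complex.I) • χ := by
  rw [opOf_apply, IsEig]
  constructor
  · intro h
    rw [h]; rfl
  · intro h
    simpa using congrArg WithLp.ofLp h

lemma inner_opOf (hU : U ∈ Matrix.unitaryGroup (Fin d) ℂ) (x y : Ket d) :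
    inner ℂ (opOf U x) (opOf U y) = inner ℂ x y := by
  rw [EuclideanSpace.inner_eq_star_dotProduct, EuclideanSpace.inner_eq_star_dotProduct, opOf_apply,
    opOf_apply]
  simp only [Matrix.star_mulVec]
  rw [dotProduct_comm, Matrix.dotProduct_mulVec, Matrix.vecMul_vecMul,
    ← Matrix.star_eq_conjTranspose, (Matrix.mem_unitaryGroup_iff').1 hU, Matrix.vecMul_one,
    dotProduct_comm]

lemma inner_eq_zero_of_isEig (hU : U ∈ Matrix.unitaryGroup (Fin d) ℂ) {φ φ' : ℝ} {χ χ' : Ket d}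
    (h : IsEig U φ χ) (h' : IsEig U φ' χ')
    (hne : Complex.exp (φ * Complex.I) ≠ Complex.exp (φ' * Complex.I)) : inner ℂ χ χ' = 0 := by
  have h1 := inner_opOf hU χ χ'
  rw [isEig_iff.1 h, isEig_iff.1 h', inner_smul_left, inner_smul_right, ← Complex.exp_conj] at h1
  simp only [map_mul, Complex.conj_ofReal, Complex.conj_I] at h1
  by_contra h0
  apply hne
  have h2 : Complex.exp (φ * -Complex.I) * Complex.exp (φ' * Complex.I) = 1 := by
    apply mul_right_cancel₀ h0
    rw [mul_assoc, h1, one_mul]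
  have h3 : Complex.exp (φ * Complex.I) * Complex.exp (φ * -Complex.I) = 1 := by
    rw [← Complex.exp_add]; simp
  calc Complex.exp (φ * Complex.I) = Complex.exp (φ * Complex.I) *
        (Complex.exp (φ * -Complex.I) * Complex.exp (φ' * Complex.I)) := by rw [h2, mul_one]
    _ = _ := by rw [← mul_assoc, h3, one_mul]

/-- The orthogonal complement of all eigenvectors is invariant under U. If it were nonzero it would
contain an eigenvector, whose eigenvalue has modulus one and hence an eigenphase. -/
lemma eigSpan_true (hU : U ∈ Matrix.unitaryGroup (Fin d) ℂ) : eigSpan U (fun _ => True) = ⊤ := by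
  rw [← Submodule.orthogonal_eq_bot_iff]
  by_contra hne
  set S := eigSpan U (fun _ => True) with hS
  have hinv : ∀ u ∈ Sᗮ, opOf U u ∈ Sᗮ := by
    intro u hu
    rw [Submodule.mem_orthogonal] at hu ⊢
    intro w hw
    induction hw using Submodule.span_induction with
    | mem χ hχ =>
      obtain ⟨φ, hφ, -⟩ := hχ
      have h1 : inner ℂ (opOf U χ) (opOf U u) = 0 := by
        rw [inner_opOf hU]
        exact hu χ (Submodule.subset_span ⟨φ, hφ, trivial⟩)
      rw [isEig_iff.1 hφ, inner_smul_left] at h1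
      rcases mul_eq_zero.1 h1 with h2 | h2
      · simp at h2
      · exact h2
    | zero => simp
    | add a b _ _ ha hb => rw [inner_add_left, ha, hb, add_zero]
    | smul c a _ ha => rw [inner_smul_left, ha, mul_zero]
  have : Nontrivial Sᗮ := Submodule.nontrivial_iff_ne_bot.2 hne
  obtain ⟨μ, hμ⟩ := Module.End.exists_eigenvalue ((opOf U).restrict hinv)
  obtain ⟨u, hu⟩ := hμ.exists_hasEigenvector
  have hu1 : opOf U u.1 = μ • u.1 := by
    have := congrArg Subtype.val hu.apply_eq_smul
    simpa using this
  have hu0 : u.1 ≠ 0 := fun h => hu.2 (Subtype.ext h)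
  have hn : ‖μ‖ = 1 := by
    have h1 := inner_opOf hU u.1 u.1
    have h2 := congrArg RCLike.re h1
    rw [hu1, inner_self_eq_norm_sq, inner_self_eq_norm_sq, norm_smul, mul_pow] at h2
    have h3 : ‖μ‖ ^ 2 = 1 := by
      have : ‖u.1‖ ^ 2 ≠ 0 := by simpa using hu0
      exact mul_right_cancel₀ this (by rw [h2, one_mul])
    nlinarith [norm_nonneg μ]
  have hmem : u.1 ∈ S := by
    refine Submodule.subset_span ⟨Complex.arg μ, ?_, trivial⟩
    rw [isEig_iff, hu1]
    congr 1
    conv_lhs => rw [← Complex.norm_mul_exp_arg_mul_I μ, hn]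
    simp
  have := Submodule.inner_right_of_mem_orthogonal hmem u.2
  exact hu0 (inner_self_eq_zero.1 this)

/-- The eigenvectors with and without `Q` are mutually orthogonal and span everything together. An
eigenvector has many real eigenphases, so `Q` has to be invariant under shifts by multiples of 2π.
-/
lemma orthogonal_eigSpan_le (hU : U ∈ Matrix.unitaryGroup (Fin d) ℂ) {Q : ℝ → Prop}
    (hQ : ∀ φ φ' : ℝ, Complex.exp (φ * Complex.I) = Complex.exp (φ' * Complex.I) → Q φ → Q φ') :
    (eigSpan U Q)ᗮ ≤ eigSpan U (fun φ => ¬ Q φ) := by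
  intro u hu
  have htop : u ∈ eigSpan U Q ⊔ eigSpan U (fun φ => ¬ Q φ) := by
    have h : eigSpan U (fun _ => True) ≤ eigSpan U Q ⊔ eigSpan U (fun φ => ¬ Q φ) := by
      refine Submodule.span_le.2 ?_
      rintro χ ⟨φ, hφ, -⟩
      by_cases h : Q φ
      · exact Submodule.mem_sup_left (Submodule.subset_span ⟨φ, hφ, h⟩)
      · exact Submodule.mem_sup_right (Submodule.subset_span ⟨φ, hφ, h⟩)
    rw [eigSpan_true hU] at h
    exact h trivial
  obtain ⟨a, ha, b, hb, rfl⟩ := Submodule.mem_sup.1 htop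
  have hab : inner ℂ a b = 0 := by
    have : eigSpan U Q ⟂ eigSpan U (fun φ => ¬ Q φ) := by
      rw [eigSpan, eigSpan, Submodule.isOrtho_span]
      rintro χ ⟨φ, hφ, h⟩ χ' ⟨φ', hφ', h'⟩
      exact inner_eq_zero_of_isEig hU hφ hφ' fun he => h' (hQ _ _ he h)
    exact this.inner_eq ha hb
  have h0 := Submodule.inner_right_of_mem_orthogonal ha hu
  rw [inner_add_right, hab, add_zero, inner_self_eq_zero] at h0
  rw [h0, zero_add]
  exact hb

lemma angDist_comm (x y : ℝ) : angDist x y = angDist y x := by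
  rw [angDist, angDist, ← norm_neg, ← Real.Angle.coe_neg, neg_sub]

lemma angDist_triangle (x y z : ℝ) : angDist x z ≤ angDist x y + angDist y z := by
  rw [angDist, angDist, angDist, show x - z = (x - y) + (y - z) by ring, Real.Angle.coe_add]
  exact norm_add_le _ _

lemma angle_eq_of_exp_eq {φ φ' : ℝ}
    (h : Complex.exp (φ * Complex.I) = Complex.exp (φ' * Complex.I)) :
    (φ : Real.Angle) = φ' := by
  rw [Complex.exp_eq_exp_iff_exists_int] at h
  obtain ⟨k, hk⟩ := h
  rw [Real.Angle.angle_eq_iff_two_pi_dvd_sub]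
  refine ⟨k, ?_⟩
  have h1 : ((φ : ℂ)) = φ' + k * (2 * Real.pi) := by
    apply mul_right_cancel₀ Complex.I_ne_zero
    rw [hk]; ring
  have h2 : φ = φ' + k * (2 * Real.pi) := by exact_mod_cast h1
  rw [h2]; ring

lemma angDist_eq_of_exp_eq {φ φ' : ℝ} (x : ℝ)
    (h : Complex.exp (φ * Complex.I) = Complex.exp (φ' * Complex.I)) :
    angDist φ x = angDist φ' x := by
  rw [angDist, angDist, Real.Angle.coe_sub, Real.Angle.coe_sub, angle_eq_of_exp_eq h]

end Spectral

/-! ## Operators on one system and its qubit -/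

/-- Basis of the work register: a qubit for each system, and one for measurements. -/
abbrev Qubits (r : ℕ) := Option (Fin r) → Bool

/-- Vectors of a system and its qubit. -/
abbrev Loc (d : ℕ) := EuclideanSpace ℂ (Fin d × Bool)

section Local

variable {d r : ℕ} {Λ E F : Type} [Fintype Λ] [DecidableEq Λ]
  [Fintype E] [DecidableEq E] [Fintype F] [DecidableEq F] {n m : ℕ}

/-- Replace the state of system `i` and its qubit. -/
def setL (i : Fin r) (x : Basis d r (Qubits r) Λ E F n m) (y : Fin d × Bool) :
    Basis d r (Qubits r) Λ E F n m :=
  (Function.update x.1 i y.1, Function.update x.2.1 (some i) y.2, x.2.2)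

lemma lens_setL (i : Fin r) : IsLens
    (fun x : Basis d r (Qubits r) Λ E F n m => (x.1 i, x.2.1 (some i))) (setL i) :=
  ⟨fun x y => by simp [setL], fun x y y' => by simp [setL], fun x => by simp [setL]⟩

lemma setL_comm {i j : Fin r} (h : i ≠ j) (x : Basis d r (Qubits r) Λ E F n m)
    (y z : Fin d × Bool) : setL i (setL j x y) z = setL j (setL i x z) y := by
  have h' : some i ≠ some j := by simpa using h
  simp [setL, Function.update_comm h, Function.update_comm h']

/-- The dependence of a state on system `i` and its qubit. -/
def slice (i : Fin r) (v : Basis d r (Qubits r) Λ E F n m → ℂ)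
    (x : Basis d r (Qubits r) Λ E F n m) : Loc d := WithLp.toLp 2 fun y => v (setL i x y)

lemma slice_apply (i : Fin r) (v : Basis d r (Qubits r) Λ E F n m → ℂ)
    (x : Basis d r (Qubits r) Λ E F n m) (y : Fin d × Bool) :
    slice i v x y = v (setL i x y) := rfl

lemma slice_self (i : Fin r) (v : Basis d r (Qubits r) Λ E F n m → ℂ)
    (x : Basis d r (Qubits r) Λ E F n m) : slice i v x (x.1 i, x.2.1 (some i)) = v x := by
  rw [slice_apply, (lens_setL i).up_get x]

lemma slice_setL (i : Fin r) (v : Basis d r (Qubits r) Λ E F n m → ℂ)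
    (x : Basis d r (Qubits r) Λ E F n m) (y : Fin d × Bool) :
    slice i v (setL i x y) = slice i v x := by
  ext z; rw [slice_apply, slice_apply, (lens_setL i).up_up]

lemma slice_add (i : Fin r) (v v' : Basis d r (Qubits r) Λ E F n m → ℂ)
    (x : Basis d r (Qubits r) Λ E F n m) : slice i (v + v') x = slice i v x + slice i v' x := rfl

lemma slice_smul (i : Fin r) (a : ℂ) (v : Basis d r (Qubits r) Λ E F n m → ℂ)
    (x : Basis d r (Qubits r) Λ E F n m) : slice i (a • v) x = a • slice i v x := rfl

/-- In the state `v`, system `i` and its qubit are in states of the subspace `K`. -/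
def At (i : Fin r) (K : Submodule ℂ (Loc d)) (v : Basis d r (Qubits r) Λ E F n m → ℂ) : Prop :=
  ∀ x, slice i v x ∈ K

/-- `T` applied to system `i` and its qubit. -/
def tloc (i : Fin r) (T : Loc d →ₗ[ℂ] Loc d) (v : Basis d r (Qubits r) Λ E F n m → ℂ) :
    Basis d r (Qubits r) Λ E F n m → ℂ := fun x => T (slice i v x) (x.1 i, x.2.1 (some i))

lemma slice_tloc (i : Fin r) (T : Loc d →ₗ[ℂ] Loc d) (v : Basis d r (Qubits r) Λ E F n m → ℂ)
    (x : Basis d r (Qubits r) Λ E F n m) : slice i (tloc i T v) x = T (slice i v x) := by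
  ext y
  rw [slice_apply, tloc, slice_setL]
  simp [setL]

lemma ext_slice (i : Fin r) {v v' : Basis d r (Qubits r) Λ E F n m → ℂ}
    (h : ∀ x, slice i v x = slice i v' x) : v = v' := by
  funext x
  rw [← slice_self i v x, h, slice_self]

lemma tloc_add (i : Fin r) (T : Loc d →ₗ[ℂ] Loc d) (v v' : Basis d r (Qubits r) Λ E F n m → ℂ) :
    tloc i T (v + v') = tloc i T v + tloc i T v' :=
  ext_slice i fun x => by simp [slice_tloc, slice_add]

lemma tloc_sub_op (i : Fin r) (T T' : Loc d →ₗ[ℂ] Loc d)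
    (v : Basis d r (Qubits r) Λ E F n m → ℂ) :
    tloc i (T - T') v = tloc i T v - tloc i T' v := by
  funext x; simp [tloc]

lemma tloc_id (i : Fin r) (v : Basis d r (Qubits r) Λ E F n m → ℂ) :
    tloc i LinearMap.id v = v := ext_slice i fun x => by simp [slice_tloc]

lemma tloc_tloc (i : Fin r) (T T' : Loc d →ₗ[ℂ] Loc d)
    (v : Basis d r (Qubits r) Λ E F n m → ℂ) :
    tloc i T (tloc i T' v) = tloc i (T ∘ₗ T') v :=
  ext_slice i fun x => by simp [slice_tloc]

lemma apply_eq_sum (T : Loc d →ₗ[ℂ] Loc d) (u : Loc d) (y : Fin d × Bool) :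
    T u y = ∑ z, T (EuclideanSpace.single z 1) y * u z := by
  have h : u = ∑ z, u z • EuclideanSpace.single z (1 : ℂ) := by
    ext y; simp [Finset.sum_apply, Pi.single_apply]
  conv_lhs => rw [h]
  simp [mul_comm]

lemma tloc_eq_sum (i : Fin r) (T : Loc d →ₗ[ℂ] Loc d) (v : Basis d r (Qubits r) Λ E F n m → ℂ)
    (x : Basis d r (Qubits r) Λ E F n m) : tloc i T v x =
      ∑ z, T (EuclideanSpace.single z 1) (x.1 i, x.2.1 (some i)) * v (setL i x z) := by
  rw [tloc, apply_eq_sum]; rfl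

lemma slice_tloc_ne {i j : Fin r} (h : i ≠ j) (T : Loc d →ₗ[ℂ] Loc d)
    (v : Basis d r (Qubits r) Λ E F n m → ℂ) (x : Basis d r (Qubits r) Λ E F n m) :
    slice j (tloc i T v) x = ∑ z, T (EuclideanSpace.single z 1) (x.1 i, x.2.1 (some i)) •
      slice j v (setL i x z) := by
  ext y
  rw [slice_apply, tloc_eq_sum]
  simp only [WithLp.ofLp_sum, WithLp.ofLp_smul, Finset.sum_apply, Pi.smul_apply, smul_eq_mul,
    slice_apply]
  refine Finset.sum_congr rfl fun z _ => ?_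
  rw [setL_comm h]
  have h' : some i ≠ some j := by simpa using h
  simp [setL, h]

section At

variable {i j : Fin r} {K K' : Submodule ℂ (Loc d)} {v v' : Basis d r (Qubits r) Λ E F n m → ℂ}

lemma At.mono (h : At i K v) (hK : K ≤ K') : At i K' v := fun x => hK (h x)

lemma At.add (h : At i K v) (h' : At i K v') : At i K (v + v') := fun x => by
  rw [slice_add]; exact K.add_mem (h x) (h' x)

lemma At.smul (a : ℂ) (h : At i K v) : At i K (a • v) := fun x => by
  rw [slice_smul]; exact K.smul_mem a (h x)

lemma At.zero : At i K (0 : Basis d r (Qubits r) Λ E F n m → ℂ) := fun _ => K.zero_mem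

lemma At.sub (h : At i K v) (h' : At i K v') : At i K (v - v') := by
  rw [sub_eq_add_neg, ← neg_one_smul ℂ v']; exact h.add (h'.smul _)

lemma At.tloc {T : Loc d →ₗ[ℂ] Loc d} (h : At i K v) (hT : ∀ u ∈ K, T u ∈ K') :
    At i K' (tloc i T v) := fun x => by
  rw [slice_tloc]; exact hT _ (h x)

lemma At.tloc_ne (hij : i ≠ j) (T : Loc d →ₗ[ℂ] Loc d) (h : At j K v) :
    At j K (EigenPaths.tloc i T v) := fun x => by
  rw [slice_tloc_ne hij]
  exact K.sum_mem fun z _ => K.smul_mem _ (h _)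

end At

lemma normSq_le_of_slice (i : Fin r) {v v' : Basis d r (Qubits r) Λ E F n m → ℂ}
    {a : ℝ} (h : ∀ x, ‖slice i v x‖ ^ 2 ≤ a * ‖slice i v' x‖ ^ 2) :
    normSq v ≤ a * normSq v' := by
  unfold normSq
  rw [Finset.mul_sum]
  refine (lens_setL i).sum_le_sum fun x => ?_
  have := h x
  rw [EuclideanSpace.norm_sq_eq, EuclideanSpace.norm_sq_eq, Finset.mul_sum] at this
  exact this

lemma tloc_congr (i : Fin r) {K : Submodule ℂ (Loc d)} {T T' : Loc d →ₗ[ℂ] Loc d}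
    {v : Basis d r (Qubits r) Λ E F n m → ℂ} (h : At i K v) (hT : ∀ u ∈ K, T u = T' u) :
    tloc i T v = tloc i T' v :=
  ext_slice i fun x => by rw [slice_tloc, slice_tloc, hT _ (h x)]

/-! ## Adjoining registers in their initial states -/

/-- Adjoin a phase register and its environment in the state `ι`. -/
def adjReg (ι : Λ × E) (v : Basis d r (Qubits r) Λ E F n m → ℂ) :
    Basis d r (Qubits r) Λ E F (n + 1) m → ℂ :=
  fun (c, w, l, e, f) => if (l (Fin.last n), e (Fin.last n)) = ι then
    v (c, w, Fin.init l, Fin.init e, f) else 0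

/-- Adjoin the environment of a reflection in the state `ι`. -/
def adjEnv (ι : F) (v : Basis d r (Qubits r) Λ E F n m → ℂ) :
    Basis d r (Qubits r) Λ E F n (m + 1) → ℂ :=
  fun (c, w, l, e, f) => if f (Fin.last m) = ι then v (c, w, l, e, Fin.init f) else 0

lemma adjReg_addReg (ι z : Λ × E) (v : Basis d r (Qubits r) Λ E F n m → ℂ)
    (x : Basis d r (Qubits r) Λ E F n m) :
    adjReg ι v (addReg x z) = if z = ι then v x else 0 := by
  simp [adjReg, addReg]

lemma adjEnv_addEnv (ι z : F) (v : Basis d r (Qubits r) Λ E F n m → ℂ)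
    (x : Basis d r (Qubits r) Λ E F n m) :
    adjEnv ι v (addEnv x z) = if z = ι then v x else 0 := by
  simp [adjEnv, addEnv]

lemma normSq_adjReg (ι : Λ × E) (v : Basis d r (Qubits r) Λ E F n m → ℂ) :
    normSq (adjReg ι v) = normSq v := by
  unfold normSq
  rw [sum_addReg]
  refine Finset.sum_congr rfl fun x _ => ?_
  simp only [adjReg_addReg]
  rw [Finset.sum_eq_single ι] <;> simp +contextual

lemma normSq_adjEnv (ι : F) (v : Basis d r (Qubits r) Λ E F n m → ℂ) :
    normSq (adjEnv ι v) = normSq v := by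
  unfold normSq
  rw [sum_addEnv]
  refine Finset.sum_congr rfl fun x _ => ?_
  simp only [adjEnv_addEnv]
  rw [Finset.sum_eq_single ι] <;> simp +contextual

lemma setL_addReg (i : Fin r) (x : Basis d r (Qubits r) Λ E F n m) (z : Λ × E)
    (y : Fin d × Bool) : setL i (addReg x z) y = addReg (setL i x y) z := rfl

lemma setL_addEnv (i : Fin r) (x : Basis d r (Qubits r) Λ E F n m) (z : F)
    (y : Fin d × Bool) : setL i (addEnv x z) y = addEnv (setL i x y) z := rfl

lemma slice_adjReg (i : Fin r) (ι z : Λ × E) (v : Basis d r (Qubits r) Λ E F n m → ℂ)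
    (x : Basis d r (Qubits r) Λ E F n m) :
    slice i (adjReg ι v) (addReg x z) = if z = ι then slice i v x else 0 := by
  ext y
  rw [slice_apply, setL_addReg, adjReg_addReg]
  split_ifs <;> rfl

lemma slice_adjEnv (i : Fin r) (ι z : F) (v : Basis d r (Qubits r) Λ E F n m → ℂ)
    (x : Basis d r (Qubits r) Λ E F n m) :
    slice i (adjEnv ι v) (addEnv x z) = if z = ι then slice i v x else 0 := by
  ext y
  rw [slice_apply, setL_addEnv, adjEnv_addEnv]
  split_ifs <;> rfl

lemma At.adjReg {i : Fin r} {K : Submodule ℂ (Loc d)} {v : Basis d r (Qubits r) Λ E F n m → ℂ}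
    (h : At i K v) (ι : Λ × E) : At i K (adjReg ι v) := fun x => by
  obtain ⟨x, z, rfl⟩ := exists_addReg x
  rw [slice_adjReg]
  split_ifs
  · exact h x
  · exact K.zero_mem

lemma At.adjEnv {i : Fin r} {K : Submodule ℂ (Loc d)} {v : Basis d r (Qubits r) Λ E F n m → ℂ}
    (h : At i K v) (ι : F) : At i K (adjEnv ι v) := fun x => by
  obtain ⟨x, z, rfl⟩ := exists_addEnv x
  rw [slice_adjEnv]
  split_ifs
  · exact h x
  · exact K.zero_mem

/-- The measurement qubit is in the state `|0⟩`. -/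
def Ready (v : Basis d r (Qubits r) Λ E F n m → ℂ) : Prop :=
  ∀ x, x.2.1 none = true → v x = 0

section Ready

variable {v v' : Basis d r (Qubits r) Λ E F n m → ℂ}

lemma Ready.add (h : Ready v) (h' : Ready v') : Ready (v + v') := fun x hx => by
  simp [h x hx, h' x hx]

lemma Ready.smul (a : ℂ) (h : Ready v) : Ready (a • v) := fun x hx => by
  simp [h x hx]

lemma Ready.sub (h : Ready v) (h' : Ready v') : Ready (v - v') := fun x hx => by
  simp [h x hx, h' x hx]

lemma Ready.tloc (h : Ready v) (i : Fin r) (T : Loc d →ₗ[ℂ] Loc d) :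
    Ready (tloc i T v) := fun x hx => by
  rw [tloc_eq_sum]
  exact Finset.sum_eq_zero fun z _ => by rw [h _ (by simpa [setL] using hx), mul_zero]

lemma Ready.adjReg (h : Ready v) (ι : Λ × E) : Ready (adjReg ι v) := fun x hx => by
  obtain ⟨x, z, rfl⟩ := exists_addReg x
  rw [adjReg_addReg, h x hx, ite_self]

lemma Ready.adjEnv (h : Ready v) (ι : F) : Ready (adjEnv ι v) := fun x hx => by
  obtain ⟨x, z, rfl⟩ := exists_addEnv x
  rw [adjEnv_addEnv, h x hx, ite_self]

end Ready

end Local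

/-! ## Oracles on eigenstates -/

/-- `ψ` is a unit eigenvector of `U` with a non-degenerate eigenphase `φ` and gap `Δ`. -/
structure IsGapped {d : ℕ} (U : Matrix (Fin d) (Fin d) ℂ) (φ : ℝ) (ψ : Ket d) (Δ : ℝ) : Prop where
  unitary : U ∈ Matrix.unitaryGroup (Fin d) ℂ
  norm_eq : ‖ψ‖ = 1
  isEig : IsEig U φ ψ
  gap : ∀ (φ' : ℝ) (χ : Ket d), χ ≠ 0 → IsEig U φ' χ →
    (∃ c : ℂ, χ = c • ψ) ∨ Δ ≤ angDist φ' φ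

section Oracle

variable {d : ℕ} {U : Matrix (Fin d) (Fin d) ℂ} {φ Δ ρ : ℝ} {ψ : Ket d}

lemma IsGapped.inner_self (h : IsGapped U φ ψ Δ) : inner ℂ ψ ψ = 1 := by
  rw [inner_self_eq_norm_sq_to_K, h.norm_eq]; simp

lemma IsGapped.inner_sub (h : IsGapped U φ ψ Δ) (u : Ket d) :
    inner ℂ ψ (u - inner ℂ ψ u • ψ) = 0 := by
  rw [inner_sub_right, inner_smul_right, h.inner_self, mul_one, sub_self]

lemma IsEig.smul {χ : Ket d} (h : IsEig U φ χ) (c : ℂ) : IsEig U φ (c • χ) := by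
  rw [isEig_iff] at *
  rw [map_smul, h, smul_comm]

/-- By the gap, eigenvectors with phases closer than Δ are multiples of ψ, hence orthogonal to `u`.
-/
lemma IsGapped.mem_eigSpan (h : IsGapped U φ ψ Δ) {u : Ket d} (hu : inner ℂ ψ u = 0) :
    u ∈ eigSpan U (fun φ' => Δ ≤ angDist φ' φ) := by
  have h1 : u ∈ (eigSpan U (fun φ' => ¬ Δ ≤ angDist φ' φ))ᗮ := by
    rw [Submodule.mem_orthogonal]
    intro w hw
    induction hw using Submodule.span_induction with
    | mem χ hχ =>
      obtain ⟨φ', hφ', hn⟩ := hχ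
      by_cases h0 : χ = 0
      · simp [h0]
      · obtain ⟨c, rfl⟩ := (h.gap φ' χ h0 hφ').resolve_right hn
        rw [inner_smul_left, hu, mul_zero]
    | zero => simp
    | add a b _ _ ha hb => rw [inner_add_left, ha, hb, add_zero]
    | smul c a _ ha => rw [inner_smul_left, ha, mul_zero]
  have h2 := orthogonal_eigSpan_le h.unitary (Q := fun φ' => ¬ Δ ≤ angDist φ' φ)
    (fun a b hab => by rw [angDist_eq_of_exp_eq φ hab]; exact id) h1
  simpa using h2

/-- The state `u ⊗ |z⟩`. -/
def wb {Z : Type} [DecidableEq Z] (z : Z) : Ket d →ₗ[ℂ] (Fin d × Z → ℂ) where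
  toFun u := withBasis u z
  map_add' u u' := by
    funext x; simp only [withBasis, Pi.add_apply]; split_ifs <;> simp
  map_smul' c u := by
    funext x; simp only [withBasis, Pi.smul_apply]; split_ifs <;> simp

/-- The oracle is unspecified between Δ/4 and 3Δ/4, but no eigenphase lies there: those other than φ
are at least Δ from φ and so farther than 3Δ/4 from `φ₀`. Hence the reflection about ψ is exact, and
the environment stays in its initial state. -/
lemma Reflection.mulVec_withBasis {φ₀ : ℝ} {F : Type} [Fintype F] [DecidableEq F]
    (R : Reflection U φ₀ Δ F) (h : IsGapped U φ ψ Δ) (hφ : angDist φ₀ φ < Δ / 4) (u : Ket d) :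
    R.mat *ᵥ withBasis u R.init = withBasis (u - (2 * inner ℂ ψ u) • ψ) R.init := by
  have key : ∀ u' ∈ eigSpan U (fun φ' => Δ ≤ angDist φ' φ),
      R.mat *ᵥ withBasis u' R.init = withBasis u' R.init := by
    intro u' hu'
    change (R.mat.mulVecLin ∘ₗ wb R.init) u' = wb R.init u'
    induction hu' using Submodule.span_induction with
    | mem χ hχ =>
      obtain ⟨φ', hφ', hn⟩ := hχ
      refine R.far φ' χ hφ' ?_
      have := angDist_triangle φ' φ₀ φ
      linarith
    | zero => simp
    | add a b _ _ ha hb => rw [map_add, ha, hb, map_add]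
    | smul c a _ ha => rw [map_smul, ha, map_smul]
  have h1 := key _ (h.mem_eigSpan (h.inner_sub u))
  have h2 := R.near φ (inner ℂ ψ u • ψ) (h.isEig.smul _) (by rw [angDist_comm]; exact hφ.le)
  have e1 : withBasis u R.init = withBasis (u - inner ℂ ψ u • ψ) R.init +
      withBasis (inner ℂ ψ u • ψ) R.init := by
    have := (wb (d := d) R.init).map_add (u - inner ℂ ψ u • ψ) (inner ℂ ψ u • ψ)
    rwa [sub_add_cancel] at this
  rw [e1, Matrix.mulVec_add, h1, h2]
  have e2 : u - (2 * inner ℂ ψ u) • ψ = (u - inner ℂ ψ u • ψ) - inner ℂ ψ u • ψ := by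
    rw [two_mul, add_smul]; abel
  rw [e2]
  conv_rhs => exact (wb R.init).map_sub _ _
  rw [sub_eq_add_neg]; rfl

section PE

variable {Λ E : Type} [Fintype Λ] [DecidableEq Λ] [Fintype E] [DecidableEq E] {ph : Λ → ℝ}
  (P : PhaseEstimation U ρ ph E)

/-- The state produced by phase estimation. -/
def PhaseEstimation.out : Ket d →ₗ[ℂ] (Fin d × (Λ × E) → ℂ) := P.mat.mulVecLin ∘ₗ wb P.init

lemma PhaseEstimation.normSq_out (u : Ket d) : normSq (P.out u) = ‖u‖ ^ 2 := by
  rw [EuclideanSpace.norm_sq_eq, ← sum_normSq_withInit P.init]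
  exact normSq_mulVec P.unitary _

lemma PhaseEstimation.out_eq_zero {Q : ℝ → Prop} {u : Ket d} (hu : u ∈ eigSpan U Q) {l : Λ}
    (hl : ∀ φ', Q φ' → ρ < angDist (ph l) φ') (j : Fin d) (e : E) : P.out u (j, (l, e)) = 0 := by
  induction hu using Submodule.span_induction with
  | mem χ hχ =>
    obtain ⟨φ', hφ', hn⟩ := hχ
    exact P.resolution φ' χ hφ' j l e (hl φ' hn)
  | zero => simp
  | add a b _ _ ha hb => rw [map_add, Pi.add_apply, ha, hb, add_zero]
  | smul c a _ ha => rw [map_smul, Pi.smul_apply, ha, smul_zero]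

/-- The component orthogonal to ψ has phases at least Δ from φ and produces no estimate closer than
Δ - ρ. With `out_far`, the register thus records the projection onto ψ exactly, although the
estimates themselves are only approximate. -/
lemma PhaseEstimation.out_near (h : IsGapped U φ ψ Δ) (u : Ket d) {l : Λ}
    (hl : angDist (ph l) φ < Δ - ρ) (j : Fin d) (e : E) :
    P.out u (j, (l, e)) = P.out (inner ℂ ψ u • ψ) (j, (l, e)) := by
  have h1 := P.out_eq_zero (h.mem_eigSpan (h.inner_sub u)) (l := l) (fun φ' hφ' => by
    have := angDist_triangle φ' (ph l) φ
    rw [angDist_comm φ' (ph l)] at this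
    linarith) j e
  rw [map_sub, Pi.sub_apply, sub_eq_zero] at h1
  exact h1

lemma PhaseEstimation.out_far (h : IsGapped U φ ψ Δ) (c : ℂ) {l : Λ}
    (hl : ρ < angDist (ph l) φ) (j : Fin d) (e : E) : P.out (c • ψ) (j, (l, e)) = 0 :=
  P.resolution φ _ (h.isEig.smul c) j l e hl

lemma PhaseEstimation.out_mid (h : IsGapped U φ ψ Δ) (u : Ket d) {l : Λ}
    (hl : ρ < angDist (ph l) φ) (hl' : angDist (ph l) φ < Δ - ρ) (j : Fin d) (e : E) :
    P.out u (j, (l, e)) = 0 := by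
  rw [P.out_near h u hl', P.out_far h _ hl]

/-- Phase estimation preserves the eigenstate `ψ`. -/
lemma PhaseEstimation.out_self (h : IsGapped U φ ψ Δ) (z : Λ × E) :
    ∃ c : ℂ, ∀ j, P.out ψ (j, z) = ψ j * c := by
  -- The projector onto an eigenvector of the unitary U commutes with U, so X ⊗ 1 commutes with
  -- `mat`. It fixes the input and therefore the output.
  set X : Matrix (Fin d) (Fin d) ℂ := Matrix.vecMulVec ψ.ofLp (star ψ.ofLp) with hX
  have hXu : ∀ u : Ket d, X *ᵥ u.ofLp = (inner ℂ ψ u) • ψ.ofLp := by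
    intro u
    rw [hX, Matrix.vecMulVec_mulVec, EuclideanSpace.inner_eq_star_dotProduct, dotProduct_comm]
    funext j; simp [mul_comm]
  have hcomm : Commute X U := by
    have h1 : ∀ u : Ket d, (X * U) *ᵥ u.ofLp = (U * X) *ᵥ u.ofLp := by
      intro u
      rw [← Matrix.mulVec_mulVec, ← Matrix.mulVec_mulVec, hXu u, Matrix.mulVec_smul, h.isEig]
      have h2 := hXu (opOf U u)
      rw [opOf_apply] at h2
      dsimp only at h2
      rw [h2]
      have h3 : inner ℂ ψ (opOf U u) = Complex.exp (φ * Complex.I) * inner ℂ ψ u := by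
        have h4 := inner_opOf h.unitary ψ u
        rw [isEig_iff.1 h.isEig, inner_smul_left, ← Complex.exp_conj] at h4
        rw [← h4, ← mul_assoc, ← Complex.exp_add]
        simp
      rw [← opOf_apply, h3, smul_smul, mul_comm]
    exact Matrix.toLin'.injective (LinearMap.ext fun u => h1 (WithLp.toLp 2 u))
  have h5 := P.controlled X hcomm
  have hk : ∀ w : Fin d × (Λ × E) → ℂ, ∀ j, ((X ⊗ₖ (1 : Matrix (Λ × E) (Λ × E) ℂ)) *ᵥ w) (j, z) =
      ψ j * ∑ y, star (ψ y) * w (y, z) := by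
    intro w j
    simp only [Matrix.mulVec, dotProduct, Fintype.sum_prod_type (f := fun p : Fin d × (Λ × E) => _),
      Matrix.kroneckerMap_apply, hX, Matrix.vecMulVec_apply, Matrix.one_apply, Finset.mul_sum]
    refine Finset.sum_congr rfl fun y _ => ?_
    simp [mul_assoc]
  refine ⟨∑ y, star (ψ y) * P.out ψ (y, z), fun j => ?_⟩
  rw [← hk]
  change (P.mat *ᵥ withBasis ψ P.init) (j, z) = _
  have h6 : (X ⊗ₖ (1 : Matrix (Λ × E) (Λ × E) ℂ)) *ᵥ withBasis ψ P.init = withBasis ψ P.init := by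
    funext ⟨j, z'⟩
    simp only [Matrix.mulVec, dotProduct, Fintype.sum_prod_type (f := fun p : Fin d × (Λ × E) => _),
      Matrix.kroneckerMap_apply, hX, Matrix.vecMulVec_apply, Matrix.one_apply, withBasis]
    by_cases hz : z' = P.init
    · have h7 := congrFun (hXu ψ) j
      rw [h.inner_self, one_smul] at h7
      simp only [Matrix.mulVec, dotProduct, hX, Matrix.vecMulVec_apply] at h7
      simpa [hz] using h7
    · simp [hz]
  conv_lhs => rw [← h6]
  rw [Matrix.mulVec_mulVec, ← h5.eq, ← Matrix.mulVec_mulVec]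
  rfl

end PE
end Oracle

/-! ## Gates and measurements -/

section Gates

variable {d r : ℕ} {Λ E F : Type} [Fintype Λ] [DecidableEq Λ]
  [Fintype E] [DecidableEq E] [Fintype F] [DecidableEq F] {n m : ℕ} {β : Type}

/-- Replace the value of a qubit. -/
def setW (k : Option (Fin r)) (x : Basis d r (Qubits r) Λ E F n m) (y : Bool) :
    Basis d r (Qubits r) Λ E F n m := (x.1, Function.update x.2.1 k y, x.2.2)

/-- A `2 × 2` matrix applied to a qubit of the work register. -/
def qubitMatrix (k : Option (Fin r)) (h : Matrix Bool Bool ℂ) :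
    Matrix (Qubits r) (Qubits r) ℂ :=
  fun w w' => if Function.update w k (w' k) = w' then h (w k) (w' k) else 0

lemma qubitMatrix_mulVec (k : Option (Fin r)) (h : Matrix Bool Bool ℂ) (v : Qubits r → ℂ)
    (w : Qubits r) : (qubitMatrix k h *ᵥ v) w = ∑ y, h (w k) y * v (Function.update w k y) := by
  have h1 : ∀ w' : Qubits r, qubitMatrix k h w w' * v w' =
      ∑ y, if Function.update w k y = w' then h (w k) y * v w' else 0 := by
    intro w'
    rw [qubitMatrix, Finset.sum_eq_single (w' k)]
    · split_ifs <;> simp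
    · intro y _ hy
      rw [if_neg]
      rintro rfl
      simp at hy
    · simp
  simp only [Matrix.mulVec, dotProduct, h1]
  rw [Finset.sum_comm]
  refine Finset.sum_congr rfl fun y _ => ?_
  simp

/-- The matrix is Hermitian and equal to its inverse. -/
def IsInvolutive (h : Matrix Bool Bool ℂ) : Prop := h * h = 1 ∧ hᴴ = h

lemma qubitMatrix_mem (k : Option (Fin r)) {h : Matrix Bool Bool ℂ} (hh : IsInvolutive h) :
    qubitMatrix k h ∈ Matrix.unitaryGroup (Qubits r) ℂ := by
  have h1 : star (qubitMatrix k h) = qubitMatrix k h := by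
    ext w w'
    rw [Matrix.star_apply, qubitMatrix, qubitMatrix]
    have h2 : Function.update w' k (w k) = w ↔ Function.update w k (w' k) = w' := by
      constructor
      · intro h; conv_lhs => rw [← h]
        simp
      · intro h; conv_lhs => rw [← h]
        simp
    simp only [h2]
    split_ifs
    · conv_rhs => rw [← hh.2]
      rfl
    · simp
  rw [Matrix.mem_unitaryGroup_iff, h1]
  refine Matrix.toLin'.injective (LinearMap.ext fun v => ?_)
  rw [Matrix.toLin'_apply, Matrix.toLin'_apply, ← Matrix.mulVec_mulVec, Matrix.one_mulVec]
  funext w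
  have h3 := congrFun (congrFun hh.1 (w k))
  simp only [Matrix.mul_apply] at h3
  simp only [qubitMatrix_mulVec, Function.update_self, Function.update_idem, Finset.mul_sum]
  rw [Finset.sum_comm]
  have h4 : ∀ y, ∑ x, h (w k) x * (h x y * v (Function.update w k y)) =
      (1 : Matrix Bool Bool ℂ) (w k) y * v (Function.update w k y) := by
    intro y
    rw [← h3 y, Finset.sum_mul]
    exact Finset.sum_congr rfl fun _ _ => by ring
  simp only [h4, Matrix.one_apply, ite_mul, one_mul, zero_mul, Finset.sum_ite_eq,
    Finset.mem_univ, if_true, Function.update_eq_self]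

/-- A gate on a qubit of the work register. -/
def qubitGate (n : ℕ) (Λ : Type) [Fintype Λ] [DecidableEq Λ] (k : Option (Fin r))
    {h : Matrix Bool Bool ℂ} (hh : IsInvolutive h) :
    Matrix.unitaryGroup (Qubits r × (Fin n → Λ)) ℂ :=
  ⟨qubitMatrix k h ⊗ₖ (1 : Matrix (Fin n → Λ) (Fin n → Λ) ℂ),
    Matrix.kronecker_mem_unitary (qubitMatrix_mem k hh) (one_mem _)⟩

/-- The action of a gate on a qubit. -/
def qapp (k : Option (Fin r)) (h : Matrix Bool Bool ℂ) (v : Basis d r (Qubits r) Λ E F n m → ℂ) :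
    Basis d r (Qubits r) Λ E F n m → ℂ := fun x => ∑ y, h (x.2.1 k) y * v (setW k x y)

lemma applyGate_qubitGate (k : Option (Fin r)) {h : Matrix Bool Bool ℂ} (hh : IsInvolutive h)
    (v : Basis d r (Qubits r) Λ E F n m → ℂ) :
    applyGate (qubitGate n Λ k hh).1 v = qapp k h v := by
  funext ⟨c, w, l, e, f⟩
  have := qubitMatrix_mulVec k h (fun w' => v (c, w', l, e, f)) w
  simp only [Matrix.mulVec, dotProduct] at this
  simp only [applyGate, qubitGate, Fintype.sum_prod_type, Matrix.kroneckerMap_apply,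
    Matrix.one_apply, qapp, setW]
  rw [← this]
  refine Finset.sum_congr rfl fun w' _ => ?_
  simp

lemma qapp_adjEnv (k : Option (Fin r)) (h : Matrix Bool Bool ℂ) (ι : F)
    (v : Basis d r (Qubits r) Λ E F n m → ℂ) :
    qapp k h (adjEnv ι v) = adjEnv ι (qapp k h v) := by
  funext x
  obtain ⟨x, z, rfl⟩ := exists_addEnv x
  have h1 : ∀ y, setW k (addEnv x z) y = addEnv (setW k x y) z := fun _ => rfl
  simp only [qapp, h1, adjEnv_addEnv, show (addEnv x z).2.1 = x.2.1 from rfl]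
  split_ifs <;> simp

/-- The Hadamard matrix. -/
def hadamard : Matrix Bool Bool ℂ := fun y z => ((Real.sqrt 2)⁻¹ : ℝ) * if y && z then -1 else 1

/-- The bit flip. -/
def bitFlip : Matrix Bool Bool ℂ := fun y z => if y = z then 0 else 1

lemma sqrt_two_inv_mul : (((Real.sqrt 2)⁻¹ : ℝ) : ℂ) * ((Real.sqrt 2)⁻¹ : ℝ) = 1 / 2 := by
  rw [← Complex.ofReal_mul, ← mul_inv, Real.mul_self_sqrt (by norm_num)]
  norm_num

lemma isInvolutive_hadamard : IsInvolutive hadamard := by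
  refine ⟨?_, ?_⟩
  · ext y z
    simp only [Matrix.mul_apply, hadamard, Fintype.sum_bool]
    have := sqrt_two_inv_mul
    have h2 : ∀ a b : ℂ, ((Real.sqrt 2)⁻¹ : ℝ) * a * (((Real.sqrt 2)⁻¹ : ℝ) * b)
      = 1 / 2 * (a * b) := fun a b => by rw [← this]; ring
    rw [h2, h2]
    cases y <;> cases z <;> norm_num
  · ext y z
    simp only [Matrix.conjTranspose_apply, hadamard, Bool.and_comm]
    split_ifs <;> simp

lemma isInvolutive_bitFlip : IsInvolutive bitFlip := by
  refine ⟨?_, ?_⟩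
  · ext y z
    simp only [Matrix.mul_apply, bitFlip, Fintype.sum_bool]
    cases y <;> cases z <;> simp
  · ext y z
    simp only [Matrix.conjTranspose_apply, bitFlip, eq_comm]
    split_ifs <;> simp

/-- The Hadamard gate on the qubit of a system, as an operator on that system and its qubit. -/
def hadOp (d : ℕ) : Loc d →ₗ[ℂ] Loc d where
  toFun u := WithLp.toLp 2 fun p => ∑ z, hadamard p.2 z * u (p.1, z)
  map_add' u u' := by ext p; simp [mul_add]; ring
  map_smul' a u := by ext p; simp; ring

lemma hadOp_apply (u : Loc d) (p : Fin d × Bool) :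
    hadOp d u p = ∑ z, hadamard p.2 z * u (p.1, z) := rfl

lemma hadOp_hadOp (u : Loc d) : hadOp d (hadOp d u) = u := by
  ext ⟨j, y⟩
  simp only [hadOp_apply, Finset.mul_sum]
  rw [Finset.sum_comm]
  have h3 := congrFun (congrFun isInvolutive_hadamard.1 y)
  simp only [Matrix.mul_apply] at h3
  have h4 : ∀ z, ∑ x, hadamard y x * (hadamard x z * u (j, z)) =
      (1 : Matrix Bool Bool ℂ) y z * u (j, z) := by
    intro z
    rw [← h3 z, Finset.sum_mul]
    exact Finset.sum_congr rfl fun _ _ => by ring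
  simp only [h4, Matrix.one_apply, ite_mul, one_mul, zero_mul, Finset.sum_ite_eq,
    Finset.mem_univ, if_true]

lemma inner_hadOp (u u' : Loc d) : inner ℂ (hadOp d u) u' = inner ℂ u (hadOp d u') := by
  simp only [PiLp.inner_apply, Fintype.sum_prod_type, hadOp_apply, RCLike.inner_apply, Fintype.sum_bool]
  refine Finset.sum_congr rfl fun j _ => ?_
  simp [hadamard]
  ring

lemma norm_hadOp (u : Loc d) : ‖hadOp d u‖ = ‖u‖ := by
  have : ‖hadOp d u‖ ^ 2 = ‖u‖ ^ 2 := by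
    rw [← inner_self_eq_norm_sq (𝕜 := ℂ), ← inner_self_eq_norm_sq (𝕜 := ℂ), inner_hadOp,
      hadOp_hadOp]
  exact (pow_left_inj₀ (norm_nonneg _) (norm_nonneg _) two_ne_zero).1 this

lemma qapp_some (i : Fin r) (v : Basis d r (Qubits r) Λ E F n m → ℂ) :
    qapp (some i) hadamard v = tloc i (hadOp d) v := by
  funext x
  rw [tloc, hadOp_apply, qapp]
  refine Finset.sum_congr rfl fun z _ => ?_
  rw [slice_apply]
  congr 2
  simp [setW, setL]

/-- Projection onto the span of the unit vector `χ`. -/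
def pr {H : Type*} [NormedAddCommGroup H] [InnerProductSpace ℂ H] (χ : H) : H →ₗ[ℂ] H :=
  ((innerSL ℂ χ).toLinearMap).smulRight χ

lemma pr_apply {H : Type*} [NormedAddCommGroup H] [InnerProductSpace ℂ H] (χ u : H) :
    pr χ u = inner ℂ χ u • χ := rfl

/-- The state `ψ ⊗ |1⟩`. -/
def ketOne (ψ : Ket d) : Loc d := WithLp.toLp 2 fun p => if p.2 then ψ p.1 else 0

lemma inner_ketOne (ψ : Ket d) (u : Loc d) :
    inner ℂ (ketOne ψ) u = inner ℂ ψ (WithLp.toLp 2 fun j => u (j, true) : Ket d) := by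
  simp [PiLp.inner_apply, Fintype.sum_prod_type, ketOne]

lemma norm_ketOne (ψ : Ket d) : ‖ketOne ψ‖ = ‖ψ‖ := by
  have : ‖ketOne ψ‖ ^ 2 = ‖ψ‖ ^ 2 := by
    simp [EuclideanSpace.norm_sq_eq, Fintype.sum_prod_type, ketOne]
  exact (pow_left_inj₀ (norm_nonneg _) (norm_nonneg _) two_ne_zero).1 this

lemma inner_ketOne_slice (ψ : Ket d) (i : Fin r) (v : Basis d r (Qubits r) Λ E F n m → ℂ)
    {x : Basis d r (Qubits r) Λ E F n m} (hx : x.2.1 (some i) = true) :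
    inner ℂ (ketOne ψ) (slice i v x) =
      inner ℂ ψ (WithLp.toLp 2 fun y => v (setC i x y) : Ket d) := by
  rw [inner_ketOne]
  congr 3
  funext j
  rw [slice_apply]
  congr 1
  simp [setL, setC, ← hx]

lemma tloc_pr_ketOne (ψ : Ket d) (i : Fin r) (v : Basis d r (Qubits r) Λ E F n m → ℂ)
    (x : Basis d r (Qubits r) Λ E F n m) :
    tloc i (pr (ketOne ψ)) v x = if x.2.1 (some i) then
      inner ℂ ψ (WithLp.toLp 2 fun y => v (setC i x y) : Ket d) * ψ (x.1 i) else 0 := by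
  rw [tloc, pr_apply]
  by_cases hx : x.2.1 (some i) = true
  · rw [inner_ketOne_slice ψ i v hx]
    simp [ketOne, hx]
  · simp [ketOne, hx]

variable {U : Matrix (Fin d) (Fin d) ℂ} {φ Δ : ℝ} {ψ : Ket d}

lemma applyRefl_eq {φ₀ : ℝ} (R : Reflection U φ₀ Δ F) (h : IsGapped U φ ψ Δ)
    (hφ : angDist φ₀ φ < Δ / 4) (i : Fin r) (g : Qubits r → Bool)
    (v : Basis d r (Qubits r) Λ E F n m → ℂ) :
    applyRefl R.mat R.init i (fun w => w (some i) && g w) v = adjEnv R.init (fun x =>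
      if g x.2.1 then v x - 2 * tloc i (pr (ketOne ψ)) v x else v x) := by
  funext x
  obtain ⟨x, z, rfl⟩ := exists_addEnv x
  rw [applyRefl_addEnv, adjEnv_addEnv]
  by_cases hg : g x.2.1 = true
  · by_cases hx : x.2.1 (some i) = true
    · rw [if_pos (by simp [hg, hx])]
      have h1 := R.mulVec_withBasis h hφ (WithLp.toLp 2 fun y => v (setC i x y) : Ket d)
      have h2 := congrFun h1 (x.1 i, z)
      change (R.mat *ᵥ withBasis (WithLp.toLp 2 fun y => v (setC i x y) : Ket d) R.init) _ = _
      rw [h2]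
      simp only [withBasis, hg, if_true, tloc_pr_ketOne, hx]
      by_cases hz : z = R.init
      · rw [if_pos hz, if_pos hz]
        have : v (setC i x (x.1 i)) = v x := by rw [(lens_setC i).up_get x]
        simp [this, mul_assoc]
      · rw [if_neg hz, if_neg hz]
    · simp [hg, hx, tloc_pr_ketOne]
  · simp [hg]

section Procedures

variable {W : Type} [Fintype W] [DecidableEq W]

/-- Measurement with outcomes in a finite type. -/
def measureTo {Z : Type} [Fintype Z] (f : W × (Fin n → Λ) → Z) (next : Z → Proc r W Λ β n) :
    Proc r W Λ β n :=
  .measure (Fintype.card Z) (fun x => Fintype.equivFin Z (f x))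
    fun o => next ((Fintype.equivFin Z).symm o)

open Classical in
/-- The state after the outcome `o` of a measurement of `f`. -/
def keep {Z : Type} (f : W × (Fin n → Λ) → Z) (o : Z) (v : Basis d r W Λ E F n m → ℂ) :
    Basis d r W Λ E F n m → ℂ :=
  fun x => if f (x.2.1, x.2.2.1) = o then v x else 0

variable {V : ℝ → Matrix.unitaryGroup (Fin d) ℂ} {ρ : ℝ} {ph : Λ → ℝ}
  (O : Oracles V ρ Δ ph E F) (S : Target d r W Λ E F β)
  (hist : List ℕ) (tab : Fin n → Matrix (Fin d × (Λ × E)) (Fin d × (Λ × E)) ℂ) (q : ℕ)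

lemma defectSq_measureTo {Z : Type} [Fintype Z] (f : W × (Fin n → Λ) → Z)
    (next : Z → Proc r W Λ β n) (v : Basis d r W Λ E F n m → ℂ) :
    defectSq O S (measureTo f next) hist tab q m v = ∑ o, defectSq O S (next o)
      ((Fintype.equivFin Z o).1 :: hist) tab q m (keep f o v) := by
  rw [measureTo, defectSq_measure, ← (Fintype.equivFin Z).sum_comp]
  refine Finset.sum_congr rfl fun o _ => ?_
  rw [Equiv.symm_apply_apply]
  congr 1
  funext ⟨c, w, l, e, t⟩
  by_cases h : f (w, l) = o
  · simp [applyMeasure, keep, h]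
  · have h' : Fintype.equivFin Z (f (w, l)) ≠ Fintype.equivFin Z o := by simpa using h
    simp only [applyMeasure, keep, if_neg h, if_neg h']

lemma sum_normSq_keep {Z : Type} [Fintype Z] (f : W × (Fin n → Λ) → Z)
    (v : Basis d r W Λ E F n m → ℂ) : ∑ o, normSq (keep f o v) = normSq v := by
  classical
  unfold normSq
  rw [Finset.sum_comm]
  refine Finset.sum_congr rfl fun x _ => ?_
  simp only [keep]
  rw [Finset.sum_eq_single (f (x.2.1, x.2.2.1))] <;> simp +contextual [eq_comm]

lemma Proc.Bounded.measureTo {Z : Type} [Fintype Z] (f : W × (Fin n → Λ) → Z)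
    {next : Z → Proc r W Λ β n} {P A : ℕ} (h : ∀ o, (next o).Bounded P A) :
    (EigenPaths.measureTo f next).Bounded P A := .measure _ fun _ => h _

end Procedures

/-- The measurement of the projection onto `ψ ⊗ |1⟩` of system `i` and its qubit, where `ψ` is the
eigenstate of `U s` with eigenphase close to `φ₀`. -/
def projMeasure (s φ₀ : ℝ) (i : Fin r) (next : Bool → Proc r (Qubits r) Λ β n) :
    Proc r (Qubits r) Λ β n :=
  .gate (qubitGate n Λ none isInvolutive_hadamard) <|
  .reflect s φ₀ i (fun w => w (some i) && w none) <|
  .gate (qubitGate n Λ none isInvolutive_hadamard) <|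
  measureTo (fun x => x.1 none) fun o =>
    if o then .gate (qubitGate n Λ none isInvolutive_bitFlip) (next true) else next false

lemma Proc.Bounded.projMeasure (s φ₀ : ℝ) (i : Fin r) {next : Bool → Proc r (Qubits r) Λ β n}
    {P A : ℕ} (h : ∀ o, (next o).Bounded P A) :
    (EigenPaths.projMeasure s φ₀ i next).Bounded P (A + 1) := by
  refine .gate _ (.reflect _ _ _ _ (.gate _ (.measureTo _ fun o => ?_)))
  cases o
  · exact h false
  · exact .gate _ (h true)

/-- A Hadamard test: with T the projection, the controlled reflection 1 - 2T between two Hadamard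
gates on the measurement qubit leaves (v + (v - 2Tv))/2 = v - Tv for the outcome 0 and (v - (v -
2Tv))/2 = Tv for the outcome 1. The bit flip resets the qubit in the latter case. -/
lemma defectSq_projMeasure {V : ℝ → Matrix.unitaryGroup (Fin d) ℂ} {ρ : ℝ} {ph : Λ → ℝ}
    (O : Oracles V ρ Δ ph E F) (S : Target d r (Qubits r) Λ E F β)
    {s φ₀ : ℝ} (h : IsGapped (V s).1 φ ψ Δ) (hφ : angDist φ₀ φ < Δ / 4) (i : Fin r)
    (next : Bool → Proc r (Qubits r) Λ β n)
    (hist : List ℕ) (tab : Fin n → Matrix (Fin d × (Λ × E)) (Fin d × (Λ × E)) ℂ) (q : ℕ)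
    {v : Basis d r (Qubits r) Λ E F n m → ℂ} (hv : Ready v) :
    ∃ (ι : F) (hist₁ hist₂ : List ℕ),
      defectSq O S (projMeasure s φ₀ i next) hist tab q m v =
        defectSq O S (next true) hist₁ tab q (m + 1) (adjEnv ι (tloc i (pr (ketOne ψ)) v)) +
        defectSq O S (next false) hist₂ tab q (m + 1)
          (adjEnv ι (v - tloc i (pr (ketOne ψ)) v)) := by
  refine ⟨(O.refl hist m s φ₀).init, (Fintype.equivFin Bool true).1 :: hist,
    (Fintype.equivFin Bool false).1 :: hist, ?_⟩
  rw [projMeasure, defectSq_gate, applyGate_qubitGate, defectSq_reflect,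
    applyRefl_eq _ h hφ i (fun w => w none), defectSq_gate, applyGate_qubitGate, qapp_adjEnv,
    defectSq_measureTo, Fintype.sum_bool, if_pos rfl, if_neg (by simp), defectSq_gate,
    applyGate_qubitGate]
  set ι := (O.refl hist m s φ₀).init
  set T := tloc i (pr (ketOne ψ)) v with hT
  set v₁ := qapp none hadamard v with hv₁
  have e0 : ∀ x, v₁ x = ((Real.sqrt 2)⁻¹ : ℝ) * v (setW none x false) := by
    intro x
    rw [hv₁, qapp, Fintype.sum_bool, hv _ (by simp [setW])]
    simp [hadamard]
  have e1 : ∀ x, tloc i (pr (ketOne ψ)) v₁ x = ((Real.sqrt 2)⁻¹ : ℝ) * T (setW none x false) := by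
    intro x
    rw [hT, tloc_eq_sum, tloc_eq_sum, Finset.mul_sum]
    refine Finset.sum_congr rfl fun z _ => ?_
    rw [e0]
    have : setW none (setL i x z) false = setL i (setW none x false) z := by
      simp [setW, setL, Function.update_comm (show some i ≠ none by simp)]
    rw [this]
    have h1 : (setW none x false).1 = x.1 := rfl
    have h2 : (setW none x false).2.1 (some i) = x.2.1 (some i) := by simp [setW]
    rw [h1, h2]
    ring
  set u : Basis d r (Qubits r) Λ E F n m → ℂ := qapp none hadamard (fun x =>
    if x.2.1 none = true then v₁ x - 2 * tloc i (pr (ketOne ψ)) v₁ x else v₁ x) with hu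
  have e2 : ∀ x, u x = if x.2.1 none = true then T (setW none x false) else
      v (setW none x false) - T (setW none x false) := by
    intro x
    have hW : ∀ y, setW none (setW none x y) false = setW none x false := fun y => by
      simp [setW]
    rw [hu]
    simp only [qapp, Fintype.sum_bool, e0, e1, hW]
    have h3 : ∀ y, (setW none x y).2.1 none = y := fun y => by simp [setW]
    have h4 := sqrt_two_inv_mul
    simp only [h3, if_true, Bool.false_eq_true, if_false, hadamard, Bool.and_true, Bool.and_false]
    set t : ℂ := (((Real.sqrt 2)⁻¹ : ℝ) : ℂ)
    split_ifs with hx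
    · linear_combination (2 * T (setW none x false)) * h4
    · linear_combination (2 * v (setW none x false) - 2 * T (setW none x false)) * h4
  have hT0 : Ready T := hv.tloc _ _
  have hset : ∀ x : Basis d r (Qubits r) Λ E F n m, x.2.1 none = false →
      setW none x false = x := by
    rintro ⟨c, w, y⟩ hx
    simp only [setW] at *
    rw [← hx, Function.update_eq_self]
  congr 2
  · funext x
    obtain ⟨x, z, rfl⟩ := exists_addEnv x
    rw [qapp, Fintype.sum_bool, adjEnv_addEnv]
    have h5 : ∀ y, setW none (addEnv x z) y = addEnv (setW none x y) z := fun _ => rfl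
    have h6 : ∀ y, ((addEnv (setW none x y) z).2.1 none) = y := fun y => by simp [addEnv, setW]
    have h7 : ∀ y, ((setW none x y).2.1 none) = y := fun y => by simp [setW]
    have hW : ∀ y, setW none (setW none x y) false = setW none x false := fun y => by
      simp [setW]
    simp only [h5, keep, h6, adjEnv_addEnv, e2, h7, if_true, Bool.false_eq_true, if_false, hW,
      mul_zero, add_zero, show (addEnv x z).2.1 = x.2.1 from rfl, bitFlip]
    by_cases hx : x.2.1 none = true
    · simp [hx, hT0 x hx]
    · rw [hset x (by simpa using hx)]
      simp [hx]
  · funext x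
    obtain ⟨x, z, rfl⟩ := exists_addEnv x
    simp only [keep, adjEnv_addEnv, show (addEnv x z).2.1 = x.2.1 from rfl, e2]
    by_cases hx : x.2.1 none = true
    · simp [hx, hT0 x hx, hv x hx]
    · rw [hset x (by simpa using hx)]
      simp [hx]

lemma defectSq_reflect_eq {V : ℝ → Matrix.unitaryGroup (Fin d) ℂ} {ρ : ℝ} {ph : Λ → ℝ}
    (O : Oracles V ρ Δ ph E F) (S : Target d r (Qubits r) Λ E F β)
    {s φ₀ : ℝ} (h : IsGapped (V s).1 φ ψ Δ) (hφ : angDist φ₀ φ < Δ / 4) (i : Fin r)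
    (next : Proc r (Qubits r) Λ β n)
    (hist : List ℕ) (tab : Fin n → Matrix (Fin d × (Λ × E)) (Fin d × (Λ × E)) ℂ) (q : ℕ)
    (v : Basis d r (Qubits r) Λ E F n m → ℂ) :
    ∃ ι : F, defectSq O S (.reflect s φ₀ i (fun w => w (some i)) next) hist tab q m v =
        defectSq O S next hist tab q (m + 1)
          (adjEnv ι (tloc i (LinearMap.id - (2 : ℂ) • pr (ketOne ψ)) v)) := by
  refine ⟨(O.refl hist m s φ₀).init, ?_⟩
  have h1 := applyRefl_eq (O.refl hist m s φ₀) h hφ i (fun _ => true) v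
  simp only [Bool.and_true, if_true] at h1
  rw [defectSq_reflect, h1]
  congr 2
  funext x
  rw [tloc_sub_op, tloc_id]
  simp [tloc]

end Gates

/-! ## Geometry of two states -/

section Geometry

variable {H : Type*} [NormedAddCommGroup H] [InnerProductSpace ℂ H] {A B : H}

lemma inner_self_of_unit {χ : H} (h : ‖χ‖ = 1) : inner ℂ χ χ = 1 := by
  rw [inner_self_eq_norm_sq_to_K, h]; simp

lemma pr_mem {K : Submodule ℂ H} {χ : H} (h : χ ∈ K) (u : H) : pr χ u ∈ K := K.smul_mem _ h

lemma norm_pr_sq {χ : H} (h : ‖χ‖ = 1) (u : H) : ‖pr χ u‖ ^ 2 = ‖inner ℂ χ u‖ ^ 2 := by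
  rw [pr_apply, norm_smul, h, mul_one]

lemma inner_sub_pr {χ : H} (h : ‖χ‖ = 1) (u : H) : inner ℂ χ (u - pr χ u) = 0 := by
  rw [pr_apply, inner_sub_right, inner_smul_right, inner_self_of_unit h, mul_one, sub_self]

lemma norm_pr_add {χ : H} (h : ‖χ‖ = 1) (u : H) :
    ‖pr χ u‖ ^ 2 + ‖u - pr χ u‖ ^ 2 = ‖u‖ ^ 2 := by
  have h1 : inner ℂ (pr χ u) (u - pr χ u) = 0 := by
    change inner ℂ (inner ℂ χ u • χ) (u - pr χ u) = 0
    rw [inner_smul_left, inner_sub_pr h, mul_zero]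
  have h2 := norm_add_sq_eq_norm_sq_add_norm_sq_of_inner_eq_zero _ _ h1
  rw [add_sub_cancel] at h2
  nlinarith [h2]

/-- The span of two states. -/
def span2 (A B : H) : Submodule ℂ H := Submodule.span ℂ {A, B}

lemma left_mem_span2 : A ∈ span2 A B := Submodule.subset_span (by simp)

lemma right_mem_span2 : B ∈ span2 A B := Submodule.subset_span (by simp)

/-- A reflection about A doubles angles in the plane of A and B. With |⟨A|B⟩|² = cos²α, a vector
orthogonal to B acquires probability sin²(2α) = 4 cos²α (1 - cos²α) in B. -/
lemma norm_pr_reflect_sq (hA : ‖A‖ = 1) {u : H} (hB : ‖B‖ = 1) (hu : u ∈ span2 A B)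
    (h0 : inner ℂ B u = 0) : ‖pr B (u - (2 : ℂ) • pr A u)‖ ^ 2 =
      4 * ‖inner ℂ A B‖ ^ 2 * (1 - ‖inner ℂ A B‖ ^ 2) * ‖u‖ ^ 2 := by
  obtain ⟨x, y, rfl⟩ := Submodule.mem_span_pair.1 hu
  set p := ‖inner ℂ A B‖ ^ 2 with hp
  have hP : inner ℂ B A * inner ℂ A B = (p : ℂ) := by
    rw [← inner_conj_symm, hp, Complex.conj_mul']
    simp
  -- Orthogonality to B leaves one free coefficient; the rest is expressed by `x` and `p`.
  have h1 : y = -(x * inner ℂ B A) := by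
    rw [inner_add_right, inner_smul_right, inner_smul_right, inner_self_of_unit hB] at h0
    linear_combination h0
  have h2 : inner ℂ A (x • A + y • B) = x * (1 - p) := by
    rw [inner_add_right, inner_smul_right, inner_smul_right, inner_self_of_unit hA, h1, ← hP]
    ring
  have h3 : ‖x • A + y • B‖ ^ 2 = ‖x‖ ^ 2 * (1 - p) := by
    have h4 : inner ℂ (x • A + y • B) (x • A + y • B) = ((‖x‖ ^ 2 * (1 - p) : ℝ) : ℂ) := by
      conv_lhs => rw [inner_add_left, inner_smul_left, inner_smul_left, h0, h2]
      push_cast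
      rw [← Complex.conj_mul']
      ring
    rw [inner_self_eq_norm_sq_to_K] at h4
    refine Complex.ofReal_injective ?_
    rw [← h4, Complex.ofReal_pow]
    rfl
  rw [norm_pr_sq hB, inner_sub_right, h0, inner_smul_right, pr_apply, inner_smul_right, h2, h3,
    zero_sub, norm_neg, norm_mul, norm_mul, norm_mul]
  have h5 : ‖(1 - p : ℂ)‖ ^ 2 = (1 - p) ^ 2 := by
    rw [← Complex.ofReal_one, ← Complex.ofReal_sub, Complex.norm_real, Real.norm_eq_abs, sq_abs]
  have h6 : ‖inner ℂ B A‖ ^ 2 = p := by rw [hp, norm_inner_symm]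
  calc _ = ‖(2 : ℂ)‖ ^ 2 * ‖x‖ ^ 2 * ‖(1 - p : ℂ)‖ ^ 2 * ‖inner ℂ B A‖ ^ 2 := by ring
    _ = _ := by rw [h5, h6]; norm_num; ring

lemma norm_reflect (hA : ‖A‖ = 1) (u : H) : ‖u - (2 : ℂ) • pr A u‖ ^ 2 = ‖u‖ ^ 2 := by
  rw [← norm_pr_add hA u]
  have h1 : inner ℂ (u - pr A u) (pr A u) = 0 := by
    change inner ℂ (u - pr A u) (inner ℂ A u • A) = 0
    rw [inner_smul_right, inner_eq_zero_symm.1 (inner_sub_pr hA u), mul_zero]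
  have h2 : u - (2 : ℂ) • pr A u = (u - pr A u) - pr A u := by rw [two_smul]; abel
  have h4 : inner ℂ (u - pr A u) (-pr A u) = 0 := by rw [inner_neg_right, h1, neg_zero]
  have h3 := norm_add_sq_eq_norm_sq_add_norm_sq_of_inner_eq_zero _ _ h4
  rw [norm_neg, ← sub_eq_add_neg] at h3
  rw [h2]
  nlinarith [h3]

/-- On [1/3, 1/2] the function 4P(1 - P) is smallest at 1/3, with the value 8/9. -/
lemma norm_reflect_sub_pr_le (hA : ‖A‖ = 1) (hB : ‖B‖ = 1) (h1 : 1 / 3 ≤ ‖inner ℂ A B‖ ^ 2)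
    (h2 : ‖inner ℂ A B‖ ^ 2 ≤ 1 / 2) {u : H} (hu : u ∈ span2 A B) (h0 : inner ℂ B u = 0) :
    ‖(u - (2 : ℂ) • pr A u) - pr B (u - (2 : ℂ) • pr A u)‖ ^ 2 ≤
      1 / 9 * ‖u - (2 : ℂ) • pr A u‖ ^ 2 := by
  have h3 := norm_pr_add hB (u - (2 : ℂ) • pr A u)
  have h4 := norm_pr_reflect_sq hA hB hu h0
  have h5 := norm_reflect hA u
  rw [h5] at h3 ⊢
  have h6 : 8 / 9 ≤ 4 * ‖inner ℂ A B‖ ^ 2 * (1 - ‖inner ℂ A B‖ ^ 2) := by nlinarith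
  have h7 := mul_le_mul_of_nonneg_right h6 (sq_nonneg ‖u‖)
  linarith

end Geometry

/-! ## Driving the systems to the target state -/

section Drive

variable {d r : ℕ} {Λ E F : Type} [Fintype Λ] [DecidableEq Λ]
  [Fintype E] [DecidableEq E] [Fintype F] [DecidableEq F] {n m : ℕ} {β : Type}

lemma normSq_tloc_pr_add (i : Fin r) {χ : Loc d} (h : ‖χ‖ = 1)
    (v : Basis d r (Qubits r) Λ E F n m → ℂ) :
    normSq (tloc i (pr χ) v) + normSq (v - tloc i (pr χ) v) = normSq v := by
  unfold normSq
  rw [← Finset.sum_add_distrib]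
  refine (lens_setL i).sum_eq_sum fun x => ?_
  have h1 := norm_pr_add h (slice i v x)
  rw [← slice_tloc, EuclideanSpace.norm_sq_eq, EuclideanSpace.norm_sq_eq,
    EuclideanSpace.norm_sq_eq, ← Finset.sum_add_distrib] at h1
  exact h1

/-- The state `ψ ⊗ H|1⟩`. -/
def ketMinus (ψ : Ket d) : Loc d := hadOp d (ketOne ψ)

lemma norm_ketMinus (ψ : Ket d) : ‖ketMinus ψ‖ = ‖ψ‖ := by
  rw [ketMinus, norm_hadOp, norm_ketOne]

/-- The Hadamard gate is self-adjoint and its own inverse, so conjugation by it moves the axis of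
the reflection. -/
lemma hadOp_reflect (ψ : Ket d) :
    hadOp d ∘ₗ (LinearMap.id - (2 : ℂ) • pr (ketOne ψ)) ∘ₗ hadOp d =
      LinearMap.id - (2 : ℂ) • pr (ketMinus ψ) := by
  ext1 u
  simp only [LinearMap.comp_apply, LinearMap.sub_apply, LinearMap.id_apply, LinearMap.smul_apply,
    map_sub, map_smul, hadOp_hadOp, pr_apply, ketMinus, inner_hadOp]

/-- The reflection about `ψ ⊗ H|1⟩`. -/
def reflectMinus (s φ₀ : ℝ) (i : Fin r) (next : Proc r (Qubits r) Λ β n) :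
    Proc r (Qubits r) Λ β n :=
  .gate (qubitGate n Λ (some i) isInvolutive_hadamard) <|
  .reflect s φ₀ i (fun w => w (some i)) <|
  .gate (qubitGate n Λ (some i) isInvolutive_hadamard) next

/-- The systems in the list are taken to the state at `b`, with at most `N` reflections. -/
def drive (a φa b φb : ℝ) (res abort : β) : ℕ → List (Fin r) → Proc r (Qubits r) Λ β n
  | _, [] => .done res
  | 0, _ :: _ => .done abort
  | 1, i :: L => projMeasure b φb i fun ok =>
      if ok then drive a φa b φb res abort 0 L else .done abort
  | N + 2, i :: L => projMeasure b φb i fun ok =>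
      if ok then drive a φa b φb res abort (N + 1) L
      else reflectMinus a φa i (drive a φa b φb res abort N (i :: L))

lemma Proc.Bounded.reflectMinus (s φ₀ : ℝ) (i : Fin r) {next : Proc r (Qubits r) Λ β n}
    {P A : ℕ} (h : next.Bounded P A) :
    (EigenPaths.reflectMinus s φ₀ i next).Bounded P (A + 1) :=
  .gate _ (.reflect _ _ _ _ (.gate _ h))

lemma drive_bounded (a φa b φb : ℝ) (res abort : β) : ∀ (N : ℕ) (L : List (Fin r)),
    (drive (Λ := Λ) (n := n) a φa b φb res abort N L).Bounded 0 N
  | N, [] => by rw [drive]; exact .done _ _ _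
  | 0, _ :: _ => .done _ _ _
  | 1, i :: L => by
    rw [drive]
    refine .projMeasure _ _ _ fun ok => ?_
    cases ok
    · exact .done _ _ _
    · exact drive_bounded a φa b φb res abort 0 L
  | N + 2, i :: L => by
    rw [drive]
    refine .projMeasure _ _ _ fun ok => ?_
    cases ok
    · exact .reflectMinus _ _ _ (drive_bounded a φa b φb res abort N (i :: L))
    · exact drive_bounded a φa b φb res abort (N + 1) L

variable {V : ℝ → Matrix.unitaryGroup (Fin d) ℂ} {ρ Δ φ φ' : ℝ} {ph : Λ → ℝ} {ψ χ : Ket d}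
  (O : Oracles V ρ Δ ph E F) (S : Target d r (Qubits r) Λ E F β)

lemma defectSq_reflectMinus {s φ₀ : ℝ} (h : IsGapped (V s).1 φ ψ Δ)
    (hφ : angDist φ₀ φ < Δ / 4) (i : Fin r) (next : Proc r (Qubits r) Λ β n) (hist : List ℕ)
    (tab : Fin n → Matrix (Fin d × (Λ × E)) (Fin d × (Λ × E)) ℂ) (q : ℕ)
    (v : Basis d r (Qubits r) Λ E F n m → ℂ) :
    ∃ ι : F, defectSq O S (reflectMinus s φ₀ i next) hist tab q m v =
      defectSq O S next hist tab q (m + 1)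
        (adjEnv ι (tloc i (LinearMap.id - (2 : ℂ) • pr (ketMinus ψ)) v)) := by
  obtain ⟨ι, hι⟩ := defectSq_reflect_eq O S h hφ i
    (.gate (qubitGate n Λ (some i) isInvolutive_hadamard) next) hist tab q (tloc i (hadOp d) v)
  refine ⟨ι, ?_⟩
  rw [reflectMinus, defectSq_gate, applyGate_qubitGate, qapp_some, hι, defectSq_gate,
    applyGate_qubitGate, qapp_adjEnv, qapp_some, tloc_tloc, tloc_tloc, LinearMap.comp_assoc,
    hadOp_reflect]

lemma tloc_adjEnv (i : Fin r) (T : Loc d →ₗ[ℂ] Loc d) (ι : F)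
    (v : Basis d r (Qubits r) Λ E F n m → ℂ) :
    tloc i T (adjEnv ι v) = adjEnv ι (tloc i T v) := by
  refine ext_slice i fun x => ?_
  obtain ⟨x, z, rfl⟩ := exists_addEnv x
  rw [slice_tloc, slice_adjEnv, slice_adjEnv, slice_tloc]
  split_ifs <;> simp

lemma adjEnv_sub (ι : F) (v v' : Basis d r (Qubits r) Λ E F n m → ℂ) :
    adjEnv ι (v - v') = adjEnv ι v - adjEnv ι v' := by
  funext x
  obtain ⟨x, z, rfl⟩ := exists_addEnv x
  simp only [adjEnv_addEnv, Pi.sub_apply]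
  split_ifs <;> simp

/-- The state `v` is contained in the span of the states at `a` and `b` for the systems in `L`, and
all other systems are at `b`. -/
structure Driving (A B : Loc d) (L : List (Fin r))
    (v : Basis d r (Qubits r) Λ E F n m → ℂ) : Prop where
  ready : Ready v
  mem : ∀ i ∈ L, At i (span2 A B) v
  not_mem : ∀ i ∉ L, At i (Submodule.span ℂ {B}) v

lemma Driving.adjEnv {A B : Loc d} {L : List (Fin r)} {v : Basis d r (Qubits r) Λ E F n m → ℂ}
    (h : Driving A B L v) (ι : F) : Driving A B L (adjEnv ι v) :=
  ⟨h.ready.adjEnv ι, fun i hi => (h.mem i hi).adjEnv ι, fun i hi => (h.not_mem i hi).adjEnv ι⟩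

lemma Driving.tail {A B : Loc d} {i : Fin r} {L : List (Fin r)}
    {v : Basis d r (Qubits r) Λ E F n m → ℂ} (h : Driving A B (i :: L) v) (hL : i ∉ L) :
    Driving A B L (tloc i (pr B) v) := by
  refine ⟨h.ready.tloc _ _, fun j hj => ?_, fun j hj => ?_⟩
  · have hij : i ≠ j := by rintro rfl; exact hL hj
    exact (h.mem j (List.mem_cons_of_mem _ hj)).tloc_ne hij _
  · by_cases hij : i = j
    · subst hij
      exact (h.mem i (by simp)).tloc fun u _ => pr_mem (Submodule.mem_span_singleton_self B) u
    · refine (h.not_mem j ?_).tloc_ne hij _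
      rw [List.mem_cons]; rintro (rfl | h')
      · exact hij rfl
      · exact hj h'

lemma Driving.tloc {A B : Loc d} {i : Fin r} {L : List (Fin r)}
    {v : Basis d r (Qubits r) Λ E F n m → ℂ} (h : Driving A B L v) (hi : i ∈ L)
    {T : Loc d →ₗ[ℂ] Loc d} (hT : ∀ u ∈ span2 A B, T u ∈ span2 A B) :
    Driving A B L (tloc i T v) := by
  refine ⟨h.ready.tloc _ _, fun j hj => ?_, fun j hj => ?_⟩
  · by_cases hij : i = j
    · subst hij
      exact (h.mem i hj).tloc hT
    · exact (h.mem j hj).tloc_ne hij _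
  · exact (h.not_mem j hj).tloc_ne (by rintro rfl; exact hj hi) _

section

variable {a φa b φb : ℝ} {res abort : β}

/-- The factor 4^(systems left) (2/3)^(reflections left) is a potential that does not increase on
average. The second bound, smaller by 4/9, applies when the pending measurement fails with
probability at most 1/9, as it does after a reflection about A. A success removes one system for one
reflection. A failure costs two reflections but leads to the second situation, whose gain 4/9 =
(2/3)² compensates exactly. -/
theorem defectSq_drive_le (ha : IsGapped (V a).1 φ ψ Δ) (hφa : angDist φa φ < Δ / 4)
    (hb : IsGapped (V b).1 φ' χ Δ) (hφb : angDist φb φ' < Δ / 4)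
    (h1 : 1 / 3 ≤ ‖inner ℂ (ketMinus ψ) (ketOne χ)‖ ^ 2)
    (h2 : ‖inner ℂ (ketMinus ψ) (ketOne χ)‖ ^ 2 ≤ 1 / 2)
    {tab : Fin n → Matrix (Fin d × (Λ × E)) (Fin d × (Λ × E)) ℂ} (htab : UnitaryTab tab) {q : ℕ}
    (hS : ∀ (m : ℕ) (v : Basis d r (Qubits r) Λ E F n m → ℂ), Ready v →
      (∀ i, At i (Submodule.span ℂ {ketOne χ}) v) → v ∈ S n m q res) (N : ℕ) :
    ∀ (L : List (Fin r)) (m : ℕ) (hist : List ℕ) (v : Basis d r (Qubits r) Λ E F n m → ℂ),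
      L.Nodup → Driving (ketMinus ψ) (ketOne χ) L v →
      defectSq O S (drive a φa b φb res abort N L) hist tab q m v ≤
        4 ^ L.length * (2 / 3) ^ N * normSq v ∧
      ∀ (i : Fin r) (L' : List (Fin r)), L = i :: L' →
        normSq (v - tloc i (pr (ketOne χ)) v) ≤ 1 / 9 * normSq v →
        defectSq O S (drive a φa b φb res abort N L) hist tab q m v ≤
          4 / 9 * (4 ^ L.length * (2 / 3) ^ N * normSq v) := by
  set A := ketMinus ψ
  set B := ketOne χ
  have hA : ‖A‖ = 1 := by rw [norm_ketMinus, ha.norm_eq]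
  have hB : ‖B‖ = 1 := by rw [norm_ketOne, hb.norm_eq]
  -- the recursion
  have step : ∀ (i : Fin r) (L : List (Fin r)) (m : ℕ)
      (v : Basis d r (Qubits r) Λ E F n m → ℂ) (D D₁ D₂ : ℝ) (M : ℕ), D = D₁ + D₂ →
      D₁ ≤ 4 ^ L.length * (2 / 3) ^ M * normSq (tloc i (pr B) v) →
      D₂ ≤ 4 ^ (L.length + 1) * (2 / 3) ^ (M + 1) * normSq (v - tloc i (pr B) v) →
      D ≤ 4 ^ (L.length + 1) * (2 / 3) ^ (M + 1) * normSq v ∧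
      (normSq (v - tloc i (pr B) v) ≤ 1 / 9 * normSq v →
        D ≤ 4 / 9 * (4 ^ (L.length + 1) * (2 / 3) ^ (M + 1) * normSq v)) := by
    intro i L m v D D₁ D₂ M hD hD₁ hD₂
    have hsum := normSq_tloc_pr_add i hB v
    have hpos : (0 : ℝ) ≤ 4 ^ (L.length + 1) * (2 / 3) ^ (M + 1) := by positivity
    set X : ℝ := 4 ^ (L.length + 1) * (2 / 3) ^ (M + 1) with hX
    -- One system less and one reflection less change the potential by the factor (1/4)(3/2) = 3/8.
    have hD₁' : D₁ ≤ 3 / 8 * X * normSq (tloc i (pr B) v) := by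
      refine hD₁.trans (le_of_eq ?_)
      rw [hX, pow_succ, pow_succ]; ring
    have n1 := normSq_nonneg (tloc i (pr B) v)
    have n2 := normSq_nonneg (v - tloc i (pr B) v)
    constructor
    · rw [hD, ← hsum]
      nlinarith [mul_nonneg hpos n1]
    -- With failure probability at most 1/9, the total factor is at most (3/8)(8/9) + 1/9 = 4/9.
    · intro hle
      rw [hD]
      have h3 := mul_le_mul_of_nonneg_left hle hpos
      have h4 : normSq (tloc i (pr B) v) = normSq v - normSq (v - tloc i (pr B) v) := by linarith
      rw [h4] at hD₁'
      nlinarith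
  induction N using Nat.strong_induction_on with
  | _ N ih =>
    intro L m hist v hL hv
    match N, L with
    | N, [] =>
      refine ⟨?_, fun i L' h => by simp at h⟩
      have : drive (Λ := Λ) (n := n) a φa b φb res abort N ([] : List (Fin r)) = .done res := by
        rw [drive]
      rw [this, defectSq_done, resid_eq_zero _ (hS m v hv.ready fun i => hv.not_mem i (by simp))]
      have := normSq_nonneg v
      rw [zero_pow two_ne_zero]
      exact mul_nonneg (by positivity) this
    | 0, i :: L =>
      have h3 := defectSq_le_normSq O S hist tab q htab
        (drive a φa b φb res abort 0 (i :: L)) v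
      -- Without reflections left the trivial bound suffices, since 4 · 4/9 ≥ 1 with a system left.
      have h4 : (4 : ℝ) ≤ 4 ^ (i :: L).length := by
        rw [List.length_cons, pow_succ]
        have : (1 : ℝ) ≤ 4 ^ L.length := one_le_pow₀ (by norm_num)
        linarith
      have h5 := normSq_nonneg v
      have h6 := mul_le_mul_of_nonneg_right h4 h5
      rw [pow_zero, mul_one]
      exact ⟨by linarith, fun _ _ _ _ => by linarith⟩
    | 1, i :: L =>
      obtain ⟨hiL, hL⟩ := List.nodup_cons.1 hL
      rw [drive]
      obtain ⟨ι, hist₁, hist₂, hD⟩ := defectSq_projMeasure O S hb hφb i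
        (fun ok => if ok then drive a φa b φb res abort 0 L else .done abort) hist tab q hv.ready
      have hD₁ := ((ih 0 (by omega)) L (m + 1) hist₁ _ hL ((hv.tail hiL).adjEnv ι)).1
      rw [normSq_adjEnv] at hD₁
      have hD₂ := defectSq_le_normSq O S hist₂ tab q htab (.done abort)
        (adjEnv ι (v - tloc i (pr B) v))
      rw [normSq_adjEnv] at hD₂
      have h3 := step i L m v _ _ _ 0 hD hD₁ (hD₂.trans ?_)
      · refine ⟨h3.1, fun j L' h hle => ?_⟩
        obtain ⟨rfl, rfl⟩ := List.cons.inj h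
        exact h3.2 hle
      · have : (1 : ℝ) ≤ 4 ^ L.length := one_le_pow₀ (by norm_num)
        have h5 := normSq_nonneg (v - tloc i (pr B) v)
        rw [pow_succ]
        nlinarith
    | N + 2, i :: L =>
      obtain ⟨hiL, hL'⟩ := List.nodup_cons.1 hL
      rw [drive]
      obtain ⟨ι, hist₁, hist₂, hD⟩ := defectSq_projMeasure O S hb hφb i
        (fun ok => if ok then drive a φa b φb res abort (N + 1) L
          else reflectMinus a φa i (drive a φa b φb res abort N (i :: L))) hist tab q hv.ready
      have hD₁ := ((ih (N + 1) (by omega)) L (m + 1) hist₁ _ hL' ((hv.tail hiL).adjEnv ι)).1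
      rw [normSq_adjEnv] at hD₁
      have h3 := step i L m v _ _ _ (N + 1) hD hD₁ ?_
      · refine ⟨h3.1, fun j L' h hle => ?_⟩
        obtain ⟨rfl, rfl⟩ := List.cons.inj h
        exact h3.2 hle
      · simp only [Bool.false_eq_true, if_false]
        obtain ⟨ι', hι'⟩ := defectSq_reflectMinus O S ha hφa i
          (drive a φa b φb res abort N (i :: L)) hist₂ tab q (adjEnv ι (v - tloc i (pr B) v))
        rw [hι', tloc_adjEnv]
        set u := v - tloc i (pr B) v with hu
        set T : Loc d →ₗ[ℂ] Loc d := LinearMap.id - (2 : ℂ) • pr A with hT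
        have hTspan : ∀ x ∈ span2 A B, T x ∈ span2 A B := fun x hx => by
          rw [hT]
          exact Submodule.sub_mem _ hx (Submodule.smul_mem _ _ (pr_mem left_mem_span2 x))
        have hdu : Driving A B (i :: L) u := by
          have : u = tloc i (LinearMap.id - pr B) v := by rw [tloc_sub_op, tloc_id]
          rw [this]
          exact hv.tloc (by simp) fun x hx =>
            Submodule.sub_mem _ hx (pr_mem right_mem_span2 x)
        have hslice : ∀ x, slice i u x ∈ span2 A B ∧ inner ℂ B (slice i u x) = 0 := by
          intro x
          refine ⟨hdu.mem i (by simp) x, ?_⟩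
          have : slice i u x = slice i v x - pr B (slice i v x) := by
            rw [← slice_tloc]; rfl
          rw [this, inner_sub_pr hB]
        have hnorm : normSq (tloc i T u) ≤ normSq u := by
          have := normSq_le_of_slice i (v := tloc i T u) (v' := u) (a := 1) fun x => by
            rw [slice_tloc, one_mul]
            exact (norm_reflect hA _).le
          rwa [one_mul] at this
        have h9 : normSq (tloc i T u - tloc i (pr B) (tloc i T u)) ≤
            1 / 9 * normSq (tloc i T u) := by
          refine normSq_le_of_slice i fun x => ?_
          have : slice i (tloc i T u - tloc i (pr B) (tloc i T u)) x =
              T (slice i u x) - pr B (T (slice i u x)) := by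
            rw [← slice_tloc, ← slice_tloc]; rfl
          rw [this, slice_tloc]
          exact norm_reflect_sub_pr_le hA hB h1 h2 (hslice x).1 (hslice x).2
        have h10 := ((ih N (by omega)) (i :: L) (m + 1 + 1) hist₂
          (adjEnv ι' (adjEnv ι (tloc i T u))) hL
          (((hdu.tloc (by simp) hTspan).adjEnv ι).adjEnv ι')).2 i L rfl (by
            rw [tloc_adjEnv, tloc_adjEnv, ← adjEnv_sub, ← adjEnv_sub, normSq_adjEnv,
              normSq_adjEnv, normSq_adjEnv, normSq_adjEnv]
            exact h9)
        rw [normSq_adjEnv, normSq_adjEnv] at h10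
        refine h10.trans ?_
        -- The two reflections that have been spent account for 4/9.
        have e : (4 : ℝ) ^ (L.length + 1) * (2 / 3) ^ (N + 1 + 1) * normSq u =
            4 / 9 * (4 ^ (i :: L).length * (2 / 3) ^ N * normSq u) := by
          rw [List.length_cons, pow_succ _ (N + 1), pow_succ _ N]; ring
        rw [e]
        gcongr

end
end Drive

/-! ## Phase estimation of several systems -/

section Chains

variable {d r : ℕ} {Λ E F : Type} [Fintype Λ] [DecidableEq Λ]
  [Fintype E] [DecidableEq E] [Fintype F] [DecidableEq F] {n m : ℕ} {β : Type}
  {U : Matrix (Fin d) (Fin d) ℂ} {φ Δ ρ : ℝ} {ψ χ : Ket d} {ph : Λ → ℝ}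

/-- The dependence of a state on system `i`. -/
def col (i : Fin r) (v : Basis d r (Qubits r) Λ E F n m → ℂ)
    (x : Basis d r (Qubits r) Λ E F n m) : Ket d := WithLp.toLp 2 fun y => v (setC i x y)

/-- Phase estimation of system `i`. -/
def PhaseEstimation.act (P : PhaseEstimation U ρ ph E) (i : Fin r)
    (v : Basis d r (Qubits r) Λ E F n m → ℂ) : Basis d r (Qubits r) Λ E F (n + 1) m → ℂ :=
  applyPE P.mat P.init i (fun _ => true) v

variable (P : PhaseEstimation U ρ ph E)

lemma PhaseEstimation.act_addReg (i : Fin r) (v : Basis d r (Qubits r) Λ E F n m → ℂ)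
    (x : Basis d r (Qubits r) Λ E F n m) (z : Λ × E) :
    P.act i v (addReg x z) = P.out (col i v x) (x.1 i, z) := by
  rw [act, applyPE_addReg, if_pos rfl]; rfl

lemma PhaseEstimation.act_addReg_sum (i : Fin r) (v : Basis d r (Qubits r) Λ E F n m → ℂ)
    (x : Basis d r (Qubits r) Λ E F n m) (z : Λ × E) :
    P.act i v (addReg x z) = ∑ y, P.mat (x.1 i, z) (y, P.init) * v (setC i x y) := by
  rw [act, applyPE_addReg, if_pos rfl, mulVec_single_snd P.mat P.init fun y => v (setC i x y)]

lemma PhaseEstimation.act_add (i : Fin r) (v v' : Basis d r (Qubits r) Λ E F n m → ℂ) :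
    P.act i (v + v') = P.act i v + P.act i v' := applyPE_add _ _ _ _ _ _

lemma PhaseEstimation.normSq_act (i : Fin r) (v : Basis d r (Qubits r) Λ E F n m → ℂ) :
    normSq (P.act i v) = normSq v := normSq_applyPE P.unitary _ _ _ _

lemma setL_setC {i j : Fin r} (h : j ≠ i) (x : Basis d r (Qubits r) Λ E F n m) (y : Fin d)
    (t : Fin d × Bool) : setL j (setC i x y) t = setC i (setL j x t) y := by
  simp [setL, setC, Function.update_comm h]

lemma PhaseEstimation.act_tloc {i j : Fin r} (h : j ≠ i) (T : Loc d →ₗ[ℂ] Loc d)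
    (v : Basis d r (Qubits r) Λ E F n m → ℂ) : P.act i (tloc j T v) = tloc j T (P.act i v) := by
  funext x
  obtain ⟨x, z, rfl⟩ := exists_addReg x
  rw [act_addReg_sum, tloc_eq_sum]
  simp only [tloc_eq_sum, setL_addReg, act_addReg_sum, Finset.mul_sum]
  rw [Finset.sum_comm]
  refine Finset.sum_congr rfl fun t _ => Finset.sum_congr rfl fun y _ => ?_
  rw [setL_setC h]
  simp [setC, setL, addReg, h, h.symm]
  ring

lemma At.act_ne {i j : Fin r} (h : j ≠ i) {K : Submodule ℂ (Loc d)}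
    {v : Basis d r (Qubits r) Λ E F n m → ℂ} (hv : At j K v) : At j K (P.act i v) := fun x => by
  obtain ⟨x, z, rfl⟩ := exists_addReg x
  have : slice j (P.act i v) (addReg x z) =
      ∑ y, P.mat (x.1 i, z) (y, P.init) • slice j v (setC i x y) := by
    ext t
    rw [slice_apply, setL_addReg, P.act_addReg_sum]
    simp only [WithLp.ofLp_sum, WithLp.ofLp_smul, Finset.sum_apply, Pi.smul_apply, smul_eq_mul,
      slice_apply]
    refine Finset.sum_congr rfl fun y _ => ?_
    rw [setL_setC h]
    simp [setL, h.symm]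
  rw [this]
  exact K.sum_mem fun y _ => K.smul_mem _ (hv _)

lemma Ready.act {v : Basis d r (Qubits r) Λ E F n m → ℂ} (hv : Ready v) (i : Fin r) :
    Ready (P.act i v) := fun x hx => by
  obtain ⟨x, z, rfl⟩ := exists_addReg x
  rw [P.act_addReg_sum]
  exact Finset.sum_eq_zero fun y _ => by rw [hv _ (by simpa [setC, addReg] using hx), mul_zero]

lemma col_eq_slice (i : Fin r) (v : Basis d r (Qubits r) Λ E F n m → ℂ)
    (x : Basis d r (Qubits r) Λ E F n m) (y : Fin d) :
    col i v x y = slice i v x (y, x.2.1 (some i)) := by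
  change v (setC i x y) = v (setL i x _)
  congr 1
  simp [setC, setL]

lemma col_setC (i : Fin r) (v : Basis d r (Qubits r) Λ E F n m → ℂ)
    (x : Basis d r (Qubits r) Λ E F n m) (y : Fin d) : col i v (setC i x y) = col i v x := by
  ext y'
  change v (setC i (setC i x y) y') = v (setC i x y')
  rw [(lens_setC i).up_up]

lemma col_tloc_pr (i : Fin r) (v : Basis d r (Qubits r) Λ E F n m → ℂ)
    (x : Basis d r (Qubits r) Λ E F n m) : col i (tloc i (pr (ketOne ψ)) v) x =
      if x.2.1 (some i) then inner ℂ ψ (col i v x) • ψ else 0 := by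
  ext y
  change tloc i (pr (ketOne ψ)) v (setC i x y) = _
  have h1 := col_setC i v x y
  rw [col] at h1
  rw [tloc_pr_ketOne, h1]
  have h2 : (setC i x y).2.1 = x.2.1 := rfl
  have h3 : (setC i x y).1 i = y := by simp [setC]
  rw [h2, h3]
  split_ifs <;> rfl

/-- Projecting before the estimation is the same as selecting afterwards qubit 1 and a phase within
ρ of φ: ψ produces no other phases, and its complement only phases at distance at least Δ - ρ > ρ.
-/
lemma PhaseEstimation.act_near (h : IsGapped U φ ψ Δ) (hρ : 2 * ρ < Δ) (i : Fin r)
    (v : Basis d r (Qubits r) Λ E F n m → ℂ) (x : Basis d r (Qubits r) Λ E F n m) (z : Λ × E) :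
    P.act i (tloc i (pr (ketOne ψ)) v) (addReg x z) =
      if x.2.1 (some i) = true ∧ angDist (ph z.1) φ ≤ ρ then P.act i v (addReg x z) else 0 := by
  rw [P.act_addReg, P.act_addReg, col_tloc_pr]
  by_cases hx : x.2.1 (some i) = true
  · rw [if_pos hx]
    by_cases hz : angDist (ph z.1) φ ≤ ρ
    · rw [if_pos ⟨hx, hz⟩]
      exact (P.out_near h _ (by linarith) _ _).symm
    · rw [if_neg fun h => hz h.2]
      exact P.out_far h _ (not_le.1 hz) _ _
  · rw [if_neg hx, if_neg fun h => hx h.1, map_zero]; rfl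

lemma PhaseEstimation.act_mid (h : IsGapped U φ ψ Δ) (i : Fin r)
    (v : Basis d r (Qubits r) Λ E F n m → ℂ) (x : Basis d r (Qubits r) Λ E F n m) {z : Λ × E}
    (hz : ρ < angDist (ph z.1) φ) (hz' : angDist (ph z.1) φ < Δ - ρ) :
    P.act i v (addReg x z) = 0 := by
  rw [P.act_addReg]
  exact P.out_mid h _ hz hz' _ _

/-- A system already in the eigenstate is left there by `out_self`, and only good estimates result.
Its estimated phase may therefore be measured without disturbing the system. -/
lemma At.act_ketOne (h : IsGapped U φ ψ Δ) {i : Fin r}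
    {v : Basis d r (Qubits r) Λ E F n m → ℂ} (hv : At i (Submodule.span ℂ {ketOne ψ}) v) :
    At i (Submodule.span ℂ {ketOne ψ}) (P.act i v) ∧ ∀ x z, ρ < angDist (ph z.1) φ →
      P.act i v (addReg x z) = 0 := by
  have hcol : ∀ x, ∃ c : ℂ, ∀ b y, v (setL i x (y, b)) = if b then c * ψ y else 0 := by
    intro x
    obtain ⟨c, hc⟩ := Submodule.mem_span_singleton.1 (hv x)
    refine ⟨c, fun b y => ?_⟩
    rw [← slice_apply i v x, ← hc]
    cases b <;> simp [ketOne]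
  have hcol2 : ∀ x c, (∀ b y, v (setL i x (y, b)) = if b then c * ψ y else 0) → ∀ y b,
      col i v (setL i x (y, b)) = if b then c • ψ else 0 := by
    intro x c hc y b
    ext y'
    rw [col_eq_slice, slice_setL, slice_apply]
    have : (setL i x (y, b)).2.1 (some i) = b := by simp [setL]
    rw [this, hc]
    cases b <;> simp
  constructor
  · intro x
    obtain ⟨x, z, rfl⟩ := exists_addReg x
    obtain ⟨c, hc⟩ := hcol x
    obtain ⟨c', hc'⟩ := P.out_self h z
    refine Submodule.mem_span_singleton.2 ⟨c * c', ?_⟩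
    ext ⟨y, b⟩
    rw [slice_apply, setL_addReg, P.act_addReg, hcol2 x c hc]
    have : (setL i x (y, b)).1 i = y := by simp [setL]
    rw [this]
    cases b
    · simp [ketOne]
    · simp [ketOne, hc']; ring
  · intro x z hz
    obtain ⟨c, hc⟩ := hcol x
    have h1 := hcol2 x c hc (x.1 i) (x.2.1 (some i))
    rw [(lens_setL i).up_get x] at h1
    rw [P.act_addReg, h1]
    split_ifs
    · exact P.out_far h c hz _ _
    · rw [map_zero]; rfl

/-! ### Inversion -/

lemma applyOn_act (i : Fin r) (v : Basis d r (Qubits r) Λ E F n m → ℂ) :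
    applyOn P.matᴴ (Fin.last n) i (fun _ => true) (P.act i v) = adjReg P.init v := by
  funext x
  obtain ⟨x, z, rfl⟩ := exists_addReg x
  rw [adjReg_addReg]
  have h1 : ∀ y : Fin d × (Λ × E), P.act i v (Function.update x.1 i y.1, x.2.1,
      Function.update (Fin.snoc (α := fun _ => Λ) x.2.2.1 z.1) (Fin.last n) y.2.1,
      Function.update (Fin.snoc (α := fun _ => E) x.2.2.2.1 z.2) (Fin.last n) y.2.2, x.2.2.2.2) =
        P.out (col i v x) y := by
    intro y
    have : (Function.update x.1 i y.1, x.2.1,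
      Function.update (Fin.snoc (α := fun _ => Λ) x.2.2.1 z.1) (Fin.last n) y.2.1,
      Function.update (Fin.snoc (α := fun _ => E) x.2.2.2.1 z.2) (Fin.last n) y.2.2, x.2.2.2.2) =
        addReg (setC i x y.1) y.2 := by
      simp only [addReg, setC, Fin.update_snoc_last]
    rw [this, P.act_addReg, col_setC]
    simp [setC]
  simp only [applyOn, addReg, if_true, h1, Fin.snoc_last]
  change (P.matᴴ *ᵥ (P.mat *ᵥ withBasis (col i v x) P.init)) (x.1 i, z) = _
  rw [Matrix.mulVec_mulVec, ← Matrix.star_eq_conjTranspose,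
    Matrix.mem_unitaryGroup_iff'.1 P.unitary, Matrix.one_mulVec, withBasis]
  split_ifs
  · change v (setC i x (x.1 i)) = v x
    rw [(lens_setC i).up_get x]
  · rfl

lemma applyOn_adjReg (M : Matrix (Fin d × (Λ × E)) (Fin d × (Λ × E)) ℂ) (k : Fin n) (i : Fin r)
    (ι : Λ × E) (v : Basis d r (Qubits r) Λ E F n m → ℂ) :
    applyOn M k.castSucc i (fun _ => true) (adjReg ι v) =
      adjReg ι (applyOn M k i (fun _ => true) v) := by
  funext x
  obtain ⟨x, z, rfl⟩ := exists_addReg x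
  have h1 : ∀ y : Fin d × (Λ × E), (Function.update x.1 i y.1, x.2.1,
      Function.update (Fin.snoc (α := fun _ => Λ) x.2.2.1 z.1) k.castSucc y.2.1,
      Function.update (Fin.snoc (α := fun _ => E) x.2.2.2.1 z.2) k.castSucc y.2.2, x.2.2.2.2) =
        addReg (Function.update x.1 i y.1, x.2.1, Function.update x.2.2.1 k y.2.1,
          Function.update x.2.2.2.1 k y.2.2, x.2.2.2.2) z := by
    intro y
    simp only [addReg, ← Fin.snoc_update]
  rw [adjReg_addReg]
  simp only [applyOn, if_true, show addReg x z = (x.1, x.2.1,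
    Fin.snoc (α := fun _ => Λ) x.2.2.1 z.1, Fin.snoc (α := fun _ => E) x.2.2.2.1 z.2, x.2.2.2.2)
    from rfl, h1, adjReg_addReg, Fin.snoc_castSucc]
  split_ifs
  · rfl
  · simp

end Chains

/-! ### Chains of estimations of distinct systems -/

section Chains

variable {d r : ℕ} [NeZero r] {Λ E F : Type} [Fintype Λ] [DecidableEq Λ]
  [Fintype E] [DecidableEq E] [Fintype F] [DecidableEq F] {n m : ℕ} {β : Type}
  {U : Matrix (Fin d) (Fin d) ℂ} {φ Δ ρ : ℝ} {ψ χ : Ket d} {ph : Λ → ℝ}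

/-- The `j`-th system. -/
def cp (r : ℕ) [NeZero r] (j : ℕ) : Fin r := Fin.ofNat r j

lemma cp_val (i : Fin r) : cp r i = i := by
  ext; simp [cp]

lemma val_cp {j : ℕ} (h : j < r) : (cp r j : ℕ) = j := by simp [cp, Nat.mod_eq_of_lt h]

lemma cp_ne {i j : ℕ} (hi : i < r) (hj : j < r) (h : i ≠ j) : cp r i ≠ cp r j := fun h' =>
  h (by rw [← val_cp hi, h', val_cp hj])

variable (P : ℕ → PhaseEstimation U ρ ph E)

/-- Phase estimation of the first `J` systems. -/
def chain : (J : ℕ) → (Basis d r (Qubits r) Λ E F n m → ℂ) →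
    Basis d r (Qubits r) Λ E F (n + J) m → ℂ
  | 0, v => v
  | J + 1, v => (P J).act (cp r J) (chain J v)

lemma chain_succ (J : ℕ) (v : Basis d r (Qubits r) Λ E F n m → ℂ) :
    chain P (J + 1) v = (P J).act (cp r J) (chain P J v) := rfl

lemma chain_add (J : ℕ) (v v' : Basis d r (Qubits r) Λ E F n m → ℂ) :
    chain P J (v + v') = chain P J v + chain P J v' := by
  induction J with
  | zero => rfl
  | succ J ih => rw [chain_succ, ih, PhaseEstimation.act_add]; rfl

lemma normSq_chain (J : ℕ) (v : Basis d r (Qubits r) Λ E F n m → ℂ) :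
    normSq (chain P J v) = normSq v := by
  induction J with
  | zero => rfl
  | succ J ih => rw [chain_succ, PhaseEstimation.normSq_act, ih]

lemma chain_tloc {i J : ℕ} (hi : i < r) (hJ : J ≤ i) (T : Loc d →ₗ[ℂ] Loc d)
    (v : Basis d r (Qubits r) Λ E F n m → ℂ) :
    chain P J (tloc (cp r i) T v) = tloc (cp r i) T (chain P J v) := by
  induction J with
  | zero => rfl
  | succ J ih =>
    rw [chain_succ, ih (by omega), PhaseEstimation.act_tloc _ (cp_ne hi (by omega) (by omega))]
    rfl

lemma At.chain {i J : ℕ} (hi : i < r) (hJ : J ≤ i) {K : Submodule ℂ (Loc d)}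
    {v : Basis d r (Qubits r) Λ E F n m → ℂ} (hv : At (cp r i) K v) :
    At (cp r i) K (chain P J v) := by
  induction J with
  | zero => exact hv
  | succ J ih => exact At.act_ne (P J) (cp_ne hi (by omega) (by omega)) (ih (by omega))

/-! ### Qubits and estimated phases -/

/-- The qubits of the systems. -/
def wv (w : Qubits r) (j : ℕ) : Bool := w (some (cp r j))

/-- The phases in the registers from the `n`-th on. -/
def yv {k : ℕ} (ph : Λ → ℝ) (n : ℕ) (l : Fin k → Λ) (j : ℕ) : ℝ :=
  if h : n + j < k then ph (l ⟨n + j, h⟩) else 0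

lemma yv_addReg {J : ℕ} (x : Basis d r (Qubits r) Λ E F (n + J) m) (z : Λ × E) :
    yv ph n (addReg x z).2.2.1 = Function.update (yv ph n x.2.2.1) J (ph z.1) := by
  funext j
  rcases lt_trichotomy j J with h | rfl | h
  · rw [Function.update_of_ne h.ne, yv, yv, dif_pos (by omega), dif_pos (by omega)]
    congr 1
    exact Fin.snoc_castSucc (α := fun _ => Λ) z.1 x.2.2.1 ⟨n + j, by omega⟩
  · rw [Function.update_self, yv, dif_pos (by omega)]
    congr 1
    exact Fin.snoc_last (α := fun _ => Λ) z.1 x.2.2.1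
  · rw [Function.update_of_ne h.ne', yv, yv, dif_neg (by omega), dif_neg (by omega)]

open Classical in
/-- The systems with qubit `1` and estimated phase close to `φ`, among the first `J`. -/
def pat (φ ρ : ℝ) (J : ℕ) (w : ℕ → Bool) (y : ℕ → ℝ) (j : ℕ) : Bool :=
  decide (j < J ∧ w j = true ∧ angDist (y j) φ ≤ ρ)

lemma pat_succ (φ ρ : ℝ) (J : ℕ) (w : ℕ → Bool) (y : ℕ → ℝ) (t : ℝ) :
    pat φ ρ (J + 1) w (Function.update y J t) = Function.update (pat φ ρ J w y) J
      (pat φ ρ (J + 1) w (Function.update y J t) J) := by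
  funext j
  by_cases h : j = J
  · subst h; simp
  · rw [Function.update_of_ne h, pat, pat, Function.update_of_ne h]
    congr 1
    have : j < J + 1 ↔ j < J := by omega
    rw [this]

/-- The part of a state with a given pattern of qubits and estimated phases. -/
def sift (φ ρ : ℝ) (ph : Λ → ℝ) (J : ℕ) (G : (ℕ → Bool) → Bool)
    (v : Basis d r (Qubits r) Λ E F (n + J) m → ℂ) : Basis d r (Qubits r) Λ E F (n + J) m → ℂ :=
  fun x => if G (pat φ ρ J (wv x.2.1) (yv ph n x.2.2.1)) then v x else 0

/-- The part of a state with a given pattern of outcomes of the measurement of `B` on the first `J`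
systems. -/
def compo (B : Loc d) : (J : ℕ) → ((ℕ → Bool) → Bool) → (Basis d r (Qubits r) Λ E F n m → ℂ) →
    Basis d r (Qubits r) Λ E F n m → ℂ
  | 0, G, v => if G (fun _ => false) then v else 0
  | J + 1, G, v =>
    compo B J (fun b => G (Function.update b J true)) (tloc (cp r J) (pr B) v) +
    compo B J (fun b => G (Function.update b J false)) (tloc (cp r J) (LinearMap.id - pr B) v)

/-- `act_near` for one system after the other. Estimations of different systems commute with local
operators on the others, so selecting a pattern of close phases can be moved in front of the whole
chain. When estimation is then undone, only the effect of the projections remains on the systems. -/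
theorem sift_chain (h : IsGapped U φ ψ Δ) (hρ : 2 * ρ < Δ) {J : ℕ} (hJ : J ≤ r)
    (G : (ℕ → Bool) → Bool) (v : Basis d r (Qubits r) Λ E F n m → ℂ) :
    sift φ ρ ph J G (chain P J v) = chain P J (compo (ketOne ψ) J G v) := by
  induction J generalizing G v with
  | zero =>
    funext x
    have : pat φ ρ 0 (wv x.2.1) (yv ph n x.2.2.1) = fun _ => false := by funext j; simp [pat]
    rw [sift, this]
    simp only [chain, compo]
    split_ifs <;> rfl
  | succ J ih =>
    rw [compo, chain_add, chain_succ, chain_succ, chain_succ, ← ih (by omega), ← ih (by omega),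
      chain_tloc P (by omega) le_rfl, chain_tloc P (by omega) le_rfl]
    set u := chain P J v
    have hnear := (P J).act_near h hρ (cp r J) u
    have hfar : ∀ x z, (P J).act (cp r J) (tloc (cp r J) (LinearMap.id - pr (ketOne ψ)) u)
        (addReg x z) = (P J).act (cp r J) u (addReg x z) -
          (P J).act (cp r J) (tloc (cp r J) (pr (ketOne ψ)) u) (addReg x z) := by
      intro x z
      have h1 := (P J).act_add (cp r J) (tloc (cp r J) (LinearMap.id - pr (ketOne ψ)) u)
        (tloc (cp r J) (pr (ketOne ψ)) u)
      rw [tloc_sub_op, tloc_id, sub_add_cancel] at h1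
      rw [h1, tloc_sub_op, tloc_id]
      simp
    have hsift : ∀ (G : (ℕ → Bool) → Bool) (u : Basis d r (Qubits r) Λ E F (n + J) m → ℂ) x z,
        (P J).act (cp r J) (sift φ ρ ph J G u) (addReg x z) =
          if G (pat φ ρ J (wv x.2.1) (yv ph n x.2.2.1)) then (P J).act (cp r J) u (addReg x z)
          else 0 := by
      intro G u x z
      rw [(P J).act_addReg_sum, (P J).act_addReg_sum]
      have e : ∀ y, sift φ ρ ph J G u (setC (cp r J) x y) =
        if G (pat φ ρ J (wv x.2.1) (yv ph n x.2.2.1)) then u (setC (cp r J) x y) else 0 :=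
        fun _ => rfl
      simp only [e]
      split_ifs
      · rfl
      · exact Finset.sum_eq_zero fun _ _ => mul_zero _
    funext x
    obtain ⟨x, z, rfl⟩ := exists_addReg x
    simp only [Pi.add_apply, hsift, hfar, hnear]
    have e1 : (addReg x z).2.1 = x.2.1 := rfl
    have e2 : sift φ ρ ph (J + 1) G ((P J).act (cp r J) u) (addReg x z) =
      if G (pat φ ρ (J + 1) (wv (addReg x z).2.1) (yv ph n (addReg x z).2.2.1)) then
        (P J).act (cp r J) u (addReg x z) else 0 := rfl
    rw [e2, e1, yv_addReg, pat_succ]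
    by_cases hb : x.2.1 (some (cp r J)) = true ∧ angDist (ph z.1) φ ≤ ρ
    · have : pat φ ρ (J + 1) (wv x.2.1) (Function.update (yv ph n x.2.2.1) J (ph z.1)) J = true := by
        simp [pat, wv, hb]
      rw [this, if_pos hb]
      simp
    · have : pat φ ρ (J + 1) (wv x.2.1) (Function.update (yv ph n x.2.2.1) J (ph z.1)) J =
          false := by
        simpa [pat, wv] using hb
      rw [this, if_neg hb]
      simp

lemma compo_add (B : Loc d) (J : ℕ) (G : (ℕ → Bool) → Bool)
    (v v' : Basis d r (Qubits r) Λ E F n m → ℂ) :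
    compo B J G (v + v') = compo B J G v + compo B J G v' := by
  induction J generalizing G v v' with
  | zero => simp only [compo]; split_ifs <;> simp
  | succ J ih => simp only [compo, tloc_add, ih]; abel

lemma compo_false (B : Loc d) (J : ℕ) (v : Basis d r (Qubits r) Λ E F n m → ℂ) :
    compo B J (fun _ => false) v = 0 := by
  induction J generalizing v with
  | zero => simp [compo]
  | succ J ih => simp [compo, ih]

section

variable {B : Loc d} {J : ℕ} {G : (ℕ → Bool) → Bool} {v : Basis d r (Qubits r) Λ E F n m → ℂ}

lemma Ready.compo (hv : Ready v) : Ready (compo B J G v) := by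
  induction J generalizing G v with
  | zero =>
    simp only [EigenPaths.compo]
    split_ifs
    · exact hv
    · exact fun _ _ => rfl
  | succ J ih => exact (ih (hv.tloc _ _)).add (ih (hv.tloc _ _))

lemma At.compo {i : Fin r} {K : Submodule ℂ (Loc d)} (hK : ∀ u ∈ K, pr B u ∈ K) (hv : At i K v) :
    At i K (compo B J G v) := by
  induction J generalizing G v with
  | zero =>
    simp only [EigenPaths.compo]
    split_ifs
    · exact hv
    · exact .zero
  | succ J ih =>
    refine (ih ?_).add (ih ?_)
    · by_cases h : cp r J = i
      · subst h; exact hv.tloc hK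
      · exact hv.tloc_ne h _
    · by_cases h : cp r J = i
      · subst h; exact hv.tloc fun u hu => K.sub_mem hu (hK u hu)
      · exact hv.tloc_ne h _

/-- If `G` ignores the bit of a system, its two outcomes recombine coherently and the system is not
disturbed. -/
lemma At.compo_of_indep {i : ℕ} (hi : i < r) (hJ : J ≤ r) {K : Submodule ℂ (Loc d)}
    (hG : ∀ b c, G (Function.update b i c) = G b) (hv : At (cp r i) K v) :
    At (cp r i) K (EigenPaths.compo B J G v) := by
  induction J generalizing G v with
  | zero =>
    simp only [EigenPaths.compo]
    split_ifs
    · exact hv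
    · exact .zero
  | succ J ih =>
    rw [EigenPaths.compo]
    by_cases h : J = i
    · subst h
      simp only [hG]
      rw [← compo_add, tloc_sub_op, tloc_id, add_sub_cancel]
      exact ih (by omega) hG hv
    · have hG' : ∀ c' b c, G (Function.update (Function.update b i c) J c') =
          G (Function.update b J c') := by
        intro c' b c
        rw [Function.update_comm (Ne.symm h), hG]
      have hne := cp_ne (r := r) (by omega) hi h
      exact (ih (by omega) (hG' true) (hv.tloc_ne hne _)).add
        (ih (by omega) (hG' false) (hv.tloc_ne hne _))

/-- If `G` requires the bit of a system, only the branch survives in which the projection onto `B`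
was applied to it. -/
lemma At.compo_span {i : ℕ} (hi : i < J) (hJ : J ≤ r) (hG : ∀ b, G b = true → b i = true) :
    At (cp r i) (Submodule.span ℂ {B}) (EigenPaths.compo B J G v) := by
  have hB : ∀ u, pr B u ∈ Submodule.span ℂ {B} := fun u =>
    pr_mem (Submodule.mem_span_singleton_self B) u
  induction J generalizing G v with
  | zero => omega
  | succ J ih =>
    rw [EigenPaths.compo]
    by_cases h : J = i
    · subst h
      have : (fun b => G (Function.update b J false)) = fun _ => false := by
        funext b
        by_contra hb
        have h1 := hG _ (by simpa using hb)
        rw [Function.update_self] at h1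
        exact Bool.false_ne_true h1
      rw [this, compo_false, add_zero]
      refine At.compo (fun u _ => hB u) fun x => ?_
      rw [slice_tloc]
      exact hB _
    · have hG' : ∀ c b, G (Function.update b J c) = true → b i = true := by
        intro c b hb
        have := hG _ hb
        rwa [Function.update_of_ne (Ne.symm h)] at this
      exact (ih (by omega) (by omega) (hG' true)).add (ih (by omega) (by omega) (hG' false))

end

lemma chain_support (h : IsGapped U φ ψ Δ) {J : ℕ} {v : Basis d r (Qubits r) Λ E F n m → ℂ}
    {x : Basis d r (Qubits r) Λ E F (n + J) m} (hx : chain P J v x ≠ 0) {j : ℕ} (hj : j < J) :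
    angDist (yv ph n x.2.2.1 j) φ ≤ ρ ∨ Δ - ρ ≤ angDist (yv ph n x.2.2.1 j) φ := by
  induction J with
  | zero => omega
  | succ J ih =>
    obtain ⟨x, z, rfl⟩ := exists_addReg x
    rw [yv_addReg]
    by_cases hjJ : j = J
    · subst hjJ
      rw [Function.update_self]
      by_contra hn
      rw [not_or, not_le, not_le] at hn
      exact hx ((P j).act_mid h _ _ _ hn.1 hn.2)
    · rw [Function.update_of_ne hjJ]
      rw [chain_succ, (P J).act_addReg_sum] at hx
      obtain ⟨y, -, hy⟩ := Finset.exists_ne_zero_of_sum_ne_zero hx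
      exact ih (x := setC (cp r J) x y) (right_ne_zero_of_mul hy) (by omega)

lemma normSq_compo (h : IsGapped U φ ψ Δ) (hρ : 2 * ρ < Δ) {J : ℕ} (hJ : J ≤ r)
    (G : (ℕ → Bool) → Bool) (v : Basis d r (Qubits r) Λ E F n m → ℂ) :
    normSq (compo (ketOne ψ) J G v) = ∑ x, ‖chain P J v x‖ ^ 2 *
      if G (pat φ ρ J (wv x.2.1) (yv ph n x.2.2.1)) then 1 else 0 := by
  rw [← normSq_chain P J, ← sift_chain P h hρ hJ, normSq]
  refine Finset.sum_congr rfl fun x _ => ?_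
  rw [sift]
  split_ifs <;> simp

lemma sum_normSq_compo (P : ℕ → PhaseEstimation U ρ ph E) (h : IsGapped U φ ψ Δ)
    (hρ : 2 * ρ < Δ) {J : ℕ} (hJ : J ≤ r) {Z : Type} [Fintype Z] [DecidableEq Z]
    (g : (ℕ → Bool) → Z) (v : Basis d r (Qubits r) Λ E F n m → ℂ) :
    ∑ o, normSq (compo (ketOne ψ) J (fun b => decide (g b = o)) v) = normSq v := by
  simp only [normSq_compo P h hρ hJ, decide_eq_true_eq]
  rw [Finset.sum_comm, ← normSq_chain P J, normSq]
  refine Finset.sum_congr rfl fun x _ => ?_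
  rw [← Finset.mul_sum]
  simp

end Chains

/-! ## Statistics of estimated phases -/

section Statistics

variable {d r : ℕ} {Λ E F : Type} [Fintype Λ] [DecidableEq Λ]
  [Fintype E] [DecidableEq E] [Fintype F] [DecidableEq F] {n m : ℕ} {β : Type}
  {U : Matrix (Fin d) (Fin d) ℂ} {φ Δ ρ : ℝ} {ψ χ : Ket d} {ph : Λ → ℝ}

lemma ketMinus_apply (ψ : Ket d) (y : Fin d) (b : Bool) :
    ketMinus ψ (y, b) = hadamard b true * ψ y := by
  rw [ketMinus, hadOp_apply, Fintype.sum_bool]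
  simp [ketOne]

lemma norm_hadamard_sq (b c : Bool) : ‖hadamard b c‖ ^ 2 = 1 / 2 := by
  rw [hadamard, norm_mul, mul_pow, Complex.norm_real, Real.norm_eq_abs, sq_abs, inv_pow,
    Real.sq_sqrt (by norm_num)]
  split_ifs <;> norm_num

/-- A system in ψ ⊗ H|1⟩ yields either value of its qubit with probability 1/2, whence 2κ on the
right of `hκ`, and phases with the distribution of `P.out ψ`, independently of the other systems, on
which alone Ω and `f` depend. -/
lemma PhaseEstimation.sum_act_le (P : PhaseEstimation U ρ ph E) (hψ : ‖ψ‖ = 1) {i : Fin r}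
    {u : Basis d r (Qubits r) Λ E F n m → ℂ} (hu : At i (Submodule.span ℂ {ketMinus ψ}) u)
    {Ω : Basis d r (Qubits r) Λ E F n m → ℝ} (hΩ : ∀ x y, Ω (setL i x y) = Ω x)
    (hΩ0 : ∀ x, 0 ≤ Ω x)
    {f : Basis d r (Qubits r) Λ E F n m → Bool → Λ → ℝ} (hf : ∀ x y, f (setL i x y) = f x)
    {κ : ℝ} (hκ : ∀ x, ∑ b, ∑ p, ‖P.out ψ p‖ ^ 2 * f x b p.2.1 ≤ 2 * κ) :
    ∑ x, ∑ z, ‖P.act i u (addReg x z)‖ ^ 2 * (Ω x * f x (x.2.1 (some i)) z.1) ≤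
      κ * ∑ x, ‖u x‖ ^ 2 * Ω x := by
  rw [Finset.mul_sum]
  refine (lens_setL i).sum_le_sum fun x => ?_
  obtain ⟨c, hc⟩ := Submodule.mem_span_singleton.1 (hu x)
  have h1 : ∀ k b z, P.act i u (addReg (setL i x (k, b)) z) =
      c * hadamard b true * P.out ψ (k, z) := by
    intro k b z
    have e1 : (setL i x (k, b)).1 i = k := by simp [setL]
    have e2 : (setL i x (k, b)).2.1 (some i) = b := by simp [setL]
    have h2 : col i u (setL i x (k, b)) = (c * hadamard b true) • ψ := by
      ext y
      rw [col_eq_slice, slice_setL, e2, ← hc]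
      simp [ketMinus_apply, mul_assoc]
    rw [P.act_addReg, e1, h2, map_smul]
    rfl
  have h3 : ∑ y, ‖u (setL i x y)‖ ^ 2 = ‖c‖ ^ 2 := by
    have : ‖slice i u x‖ ^ 2 = ‖c‖ ^ 2 := by
      rw [← hc, norm_smul, norm_ketMinus, hψ, mul_one]
    rw [← this, EuclideanSpace.norm_sq_eq]
    rfl
  have h4 : ∑ y, κ * (‖u (setL i x y)‖ ^ 2 * Ω (setL i x y)) = ‖c‖ ^ 2 * Ω x * κ := by
    rw [← h3, Finset.sum_mul, Finset.sum_mul]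
    exact Finset.sum_congr rfl fun y _ => by rw [hΩ]; ring
  rw [h4]
  have h5 : ∑ y, ∑ z, ‖P.act i u (addReg (setL i x y) z)‖ ^ 2 * (Ω (setL i x y) *
      f (setL i x y) ((setL i x y).2.1 (some i)) z.1) =
        ‖c‖ ^ 2 * Ω x * (1 / 2 * ∑ b, ∑ p, ‖P.out ψ p‖ ^ 2 * f x b p.2.1) := by
    rw [Fintype.sum_prod_type, Finset.sum_comm, Finset.mul_sum, Finset.mul_sum]
    refine Finset.sum_congr rfl fun b _ => ?_
    rw [Fintype.sum_prod_type, Finset.mul_sum, Finset.mul_sum]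
    refine Finset.sum_congr rfl fun k _ => ?_
    rw [Finset.mul_sum, Finset.mul_sum]
    refine Finset.sum_congr rfl fun z _ => ?_
    have e2 : (setL i x (k, b)).2.1 (some i) = b := by simp [setL]
    rw [h1, hΩ, hf, e2, norm_mul, norm_mul, mul_pow, mul_pow, norm_hadamard_sq]
    ring
  rw [h5]
  exact mul_le_mul_of_nonneg_left (by linarith [hκ x]) (mul_nonneg (sq_nonneg _) (hΩ0 x))

lemma PhaseEstimation.sum_out (P : PhaseEstimation U ρ ph E) (hψ : ‖ψ‖ = 1) :
    ∑ p, ‖P.out ψ p‖ ^ 2 = 1 := by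
  have := P.normSq_out ψ
  rwa [hψ, one_pow] at this

open Classical in
lemma PhaseEstimation.sum_out_near (P : PhaseEstimation U ρ ph E) (h : IsGapped U φ χ Δ)
    (hρ : 2 * ρ < Δ) (ψ : Ket d) :
    ∑ p, ‖P.out ψ p‖ ^ 2 * (if angDist (ph p.2.1) φ ≤ ρ then 1 else 0) = ‖inner ℂ χ ψ‖ ^ 2 := by
  have h1 : ‖inner ℂ χ ψ‖ ^ 2 = normSq (P.out (inner ℂ χ ψ • χ)) := by
    rw [P.normSq_out, norm_smul, h.norm_eq, mul_one]
  rw [h1, normSq]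
  refine Finset.sum_congr rfl fun ⟨j, l, e⟩ _ => ?_
  dsimp only
  split_ifs with hl
  · rw [mul_one, ← P.out_near h _ (by linarith)]
  · rw [P.out_far h _ (not_le.1 hl)]
    simp

variable [NeZero r]

/-- A supermartingale bound: the weight of a system may depend on the phases found before, but its
conditional average is at most `κ j` whatever they are, so the systems are removed from the last one
down. Nothing is assumed about the first `h` systems. -/
theorem sum_chain_le (P : ℕ → PhaseEstimation U ρ ph E) (hψ : ‖ψ‖ = 1) {h J : ℕ} (hh : h ≤ J)
    (hJ : J ≤ r) {v : Basis d r (Qubits r) Λ E F n m → ℂ}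
    (hv : ∀ j, h ≤ j → j < J → At (cp r j) (Submodule.span ℂ {ketMinus ψ}) v)
    {ω : ℕ → Bool → (ℕ → ℝ) → ℝ} (hω0 : ∀ j b y, 0 ≤ ω j b y)
    (hω : ∀ j b y y', h ≤ j → (∀ i ≤ j, y i = y' i) → ω j b y = ω j b y') {κ : ℕ → ℝ}
    (hκ0 : ∀ j, 0 ≤ κ j) (hκ : ∀ j y, h ≤ j → ∑ b, ∑ p, ‖(P j).out ψ p‖ ^ 2 *
      ω j b (Function.update y j (ph p.2.1)) ≤ 2 * κ j) :
    ∑ x, ‖chain P J v x‖ ^ 2 * ∏ j ∈ Finset.Ico h J, ω j (wv x.2.1 j) (yv ph n x.2.2.1) ≤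
      (∏ j ∈ Finset.Ico h J, κ j) * normSq v := by
  induction J, hh using Nat.le_induction with
  | base => rw [← normSq_chain P h]; simp [normSq]
  | succ J hh ih =>
    have hcomm : ∀ (x : Basis d r (Qubits r) Λ E F (n + J) m) y, ∀ j < J,
        wv (setL (cp r J) x y).2.1 j = wv x.2.1 j := by
      intro x y j hj
      have : some (cp r j) ≠ some (cp r J) := by
        simpa using cp_ne (r := r) (by omega) (by omega) hj.ne
      simp only [wv, setL]
      rw [Function.update_of_ne this]
    have h1 := (P J).sum_act_le hψ
      (At.chain P (by omega) le_rfl (hv J hh (by omega)))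
      (Ω := fun x => ∏ j ∈ Finset.Ico h J, ω j (wv x.2.1 j) (yv ph n x.2.2.1))
      (fun x y => Finset.prod_congr rfl fun j hj => by
        rw [hcomm x y j (Finset.mem_Ico.1 hj).2]; rfl)
      (fun x => Finset.prod_nonneg fun j _ => hω0 _ _ _)
      (f := fun x b l => ω J b (Function.update (yv ph n x.2.2.1) J (ph l)))
      (fun x y => rfl) (fun x => hκ J _ hh)
    refine (sum_addReg (n := n + J) _).trans_le ?_
    rw [Finset.prod_Ico_succ_top hh, mul_comm _ (κ J), mul_assoc]
    refine le_trans (le_of_eq ?_) (h1.trans (mul_le_mul_of_nonneg_left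
      (ih (by omega) fun j hj hj' => hv j hj (by omega)) (hκ0 J)))
    refine Finset.sum_congr rfl fun x _ => Finset.sum_congr rfl fun z _ => ?_
    rw [chain_succ, Finset.prod_Ico_succ_top hh, yv_addReg]
    congr 2
    refine Finset.prod_congr rfl fun j hj => hω _ _ _ _ (Finset.mem_Ico.1 hj).1 fun i hi => ?_
    rw [Function.update_of_ne]
    have := (Finset.mem_Ico.1 hj).2
    omega

end Statistics

/-! ## Coherent measurements of estimated phases -/

section Blocks

variable {d r : ℕ} [NeZero r] {Λ E F : Type} [Fintype Λ] [DecidableEq Λ]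
  [Fintype E] [DecidableEq E] [Fintype F] [DecidableEq F] {n m : ℕ} {β : Type}
  {U : Matrix (Fin d) (Fin d) ℂ} {φ Δ ρ : ℝ} {ψ χ : Ket d} {ph : Λ → ℝ}

/-- Adjoin `J` phase registers and their environments in the states `ι`. -/
def pad (ι : ℕ → Λ × E) : (J : ℕ) → (Basis d r (Qubits r) Λ E F n m → ℂ) →
    Basis d r (Qubits r) Λ E F (n + J) m → ℂ
  | 0, v => v
  | J + 1, v => adjReg (ι J) (pad ι J v)

lemma normSq_pad (ι : ℕ → Λ × E) (J : ℕ) (v : Basis d r (Qubits r) Λ E F n m → ℂ) :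
    normSq (pad ι J v) = normSq v := by
  induction J with
  | zero => rfl
  | succ J ih => rw [pad, normSq_adjReg, ih]

lemma At.pad {i : Fin r} {K : Submodule ℂ (Loc d)} {v : Basis d r (Qubits r) Λ E F n m → ℂ}
    (hv : At i K v) (ι : ℕ → Λ × E) (J : ℕ) : At i K (pad ι J v) := by
  induction J with
  | zero => exact hv
  | succ J ih => exact ih.adjReg _

lemma Ready.pad {v : Basis d r (Qubits r) Λ E F n m → ℂ} (hv : Ready v) (ι : ℕ → Λ × E) (J : ℕ) :
    Ready (pad ι J v) := by
  induction J with
  | zero => exact hv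
  | succ J ih => exact ih.adjReg _

/-- The inverses of the instances `n, …, n + t - 1` of phase estimation applied to the systems
`0, …, t - 1`. -/
def undoOp {N : ℕ} (tab : Fin N → Matrix (Fin d × (Λ × E)) (Fin d × (Λ × E)) ℂ) (n : ℕ) :
    ℕ → (Basis d r (Qubits r) Λ E F N m → ℂ) → Basis d r (Qubits r) Λ E F N m → ℂ
  | 0, v => v
  | t + 1, v => if h : n + t < N then undoOp tab n t
      (applyOn (tab ⟨n + t, h⟩)ᴴ ⟨n + t, h⟩ (cp r t) (fun _ => true) v) else undoOp tab n t v

/-- The table of instances after phase estimation of `J` systems. -/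
def tabs (tab : Fin n → Matrix (Fin d × (Λ × E)) (Fin d × (Λ × E)) ℂ)
    (P : ℕ → PhaseEstimation U ρ ph E) :
    (J : ℕ) → Fin (n + J) → Matrix (Fin d × (Λ × E)) (Fin d × (Λ × E)) ℂ
  | 0 => tab
  | J + 1 => Fin.snoc (α := fun _ => Matrix (Fin d × (Λ × E)) (Fin d × (Λ × E)) ℂ)
      (tabs tab P J) (P J).mat

lemma UnitaryTab.tabs {tab : Fin n → Matrix (Fin d × (Λ × E)) (Fin d × (Λ × E)) ℂ}
    (h : UnitaryTab tab) (P : ℕ → PhaseEstimation U ρ ph E) (J : ℕ) :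
    UnitaryTab (tabs tab P J) := by
  induction J with
  | zero => exact h
  | succ J ih => exact ih.snoc (P J).unitary

lemma undoOp_adjReg {N : ℕ} (tab : Fin N → Matrix (Fin d × (Λ × E)) (Fin d × (Λ × E)) ℂ)
    (M : Matrix (Fin d × (Λ × E)) (Fin d × (Λ × E)) ℂ) (n : ℕ) {t : ℕ} (ht : n + t ≤ N)
    (ι : Λ × E) (v : Basis d r (Qubits r) Λ E F N m → ℂ) :
    undoOp (Fin.snoc (α := fun _ => Matrix (Fin d × (Λ × E)) (Fin d × (Λ × E)) ℂ) tab M) n t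
      (adjReg ι v) = adjReg ι (undoOp tab n t v) := by
  induction t generalizing v with
  | zero => rfl
  | succ t ih =>
    have e : (⟨n + t, by omega⟩ : Fin (N + 1)) = Fin.castSucc ⟨n + t, by omega⟩ := rfl
    rw [undoOp, undoOp, dif_pos (by omega), dif_pos (by omega), e, Fin.snoc_castSucc,
      applyOn_adjReg, ih (by omega)]

/-- The inverses act in the reverse order. Each cancels the outermost link and leaves its register
in the initial state, where it does not affect the remaining inverses. -/
theorem undoOp_chain (tab : Fin n → Matrix (Fin d × (Λ × E)) (Fin d × (Λ × E)) ℂ)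
    (P : ℕ → PhaseEstimation U ρ ph E) (J : ℕ) (v : Basis d r (Qubits r) Λ E F n m → ℂ) :
    undoOp (tabs tab P J) n J (chain P J v) = pad (fun j => (P j).init) J v := by
  induction J with
  | zero => rfl
  | succ J ih =>
    rw [undoOp, dif_pos (by omega)]
    have e : tabs tab P (J + 1) ⟨n + J, by omega⟩ = (P J).mat :=
      Fin.snoc_last (α := fun _ => Matrix (Fin d × (Λ × E)) (Fin d × (Λ × E)) ℂ) (n := n + J) _ _
    rw [e]
    refine Eq.trans ?_ ((undoOp_adjReg (tabs tab P J) (P J).mat n le_rfl (P J).init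
      (chain P J v)).trans (congrArg (adjReg (P J).init) ih))
    exact congrArg (undoOp (tabs tab P (J + 1)) n J) (applyOn_act (P J) (cp r J) (chain P J v))

/-- Phase estimation for `U s` of the first `J` systems. -/
def peTo (s : ℝ) : (J : ℕ) → Proc r (Qubits r) Λ β (n + J) → Proc r (Qubits r) Λ β n
  | 0, next => next
  | J + 1, next => peTo s J (.phaseEst s (cp r J) (fun _ => true) next)

/-- The inverse of phase estimation of the first `t` systems. -/
def undoTo (n : ℕ) {N : ℕ} : ℕ → Proc r (Qubits r) Λ β N → Proc r (Qubits r) Λ β N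
  | 0, next => next
  | t + 1, next => if h : n + t < N then
      .phaseEstInv ⟨n + t, h⟩ (cp r t) (fun _ => true) (undoTo n t next) else undoTo n t next

/-- The function `f` of the estimated phases of the first `J` systems and of the qubits is measured,
and phase estimation is undone. -/
def block (s : ℝ) (J : ℕ) {Z : Type} [Fintype Z] (f : Qubits r × (Fin (n + J) → Λ) → Z)
    (next : Z → Proc r (Qubits r) Λ β (n + J)) : Proc r (Qubits r) Λ β n :=
  peTo s J (measureTo f fun o => undoTo n J (next o))

lemma Proc.Bounded.peTo (s : ℝ) {J : ℕ} {next : Proc r (Qubits r) Λ β (n + J)} {A B : ℕ}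
    (h : next.Bounded A B) : (peTo s J next).Bounded (A + J) B := by
  induction J generalizing A with
  | zero => exact h
  | succ J ih =>
    have := ih (h.phaseEst s (cp r J) fun _ => true)
    rwa [add_assoc, add_comm 1] at this

lemma Proc.Bounded.undoTo (n : ℕ) {N : ℕ} {next : Proc r (Qubits r) Λ β N} {A B : ℕ}
    (h : next.Bounded A B) (t : ℕ) : (undoTo n t next).Bounded (A + t) B := by
  induction t with
  | zero => exact h
  | succ t ih =>
    rw [EigenPaths.undoTo]
    split_ifs
    · exact ih.phaseEstInv _ _ _
    · exact ih.mono (by omega) le_rfl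

lemma Proc.Bounded.block (s : ℝ) (J : ℕ) {Z : Type} [Fintype Z]
    (f : Qubits r × (Fin (n + J) → Λ) → Z) {next : Z → Proc r (Qubits r) Λ β (n + J)} {A B : ℕ}
    (h : ∀ o, (next o).Bounded A B) : (EigenPaths.block s J f next).Bounded (A + 2 * J) B := by
  have := Proc.Bounded.peTo s (Proc.Bounded.measureTo f fun o => (h o).undoTo n J)
  rwa [add_assoc, ← two_mul] at this

variable {V : ℝ → Matrix.unitaryGroup (Fin d) ℂ}
  (O : Oracles V ρ Δ ph E F) (S : Target d r (Qubits r) Λ E F β)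

lemma defectSq_peTo (s : ℝ) (J : ℕ) (next : Proc r (Qubits r) Λ β (n + J)) (hist : List ℕ)
    (tab : Fin n → Matrix (Fin d × (Λ × E)) (Fin d × (Λ × E)) ℂ) (q : ℕ)
    (v : Basis d r (Qubits r) Λ E F n m → ℂ) :
    defectSq O S (peTo s J next) hist tab q m v =
      defectSq O S next hist (tabs tab (fun j => O.pe hist (n + j) s) J) (q + J) m
        (chain (fun j => O.pe hist (n + j) s) J v) := by
  induction J with
  | zero => rfl
  | succ J ih => rw [peTo, ih, defectSq_phaseEst]; rfl

lemma defectSq_undoTo (n : ℕ) {N : ℕ} (t : ℕ) (next : Proc r (Qubits r) Λ β N) (hist : List ℕ)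
    (tab : Fin N → Matrix (Fin d × (Λ × E)) (Fin d × (Λ × E)) ℂ) (q : ℕ)
    (v : Basis d r (Qubits r) Λ E F N m → ℂ) : ∃ q',
    defectSq O S (undoTo n t next) hist tab q m v =
      defectSq O S next hist tab q' m (undoOp tab n t v) := by
  induction t generalizing q v with
  | zero => exact ⟨q, rfl⟩
  | succ t ih =>
    rw [undoTo, undoOp]
    split_ifs with h
    · rw [defectSq_phaseEstInv]
      exact ih _ _
    · exact ih _ _

/-- For each outcome the kept state is replaced by the chain of an ideal state `u o`, at the cost of
the difference. Undoing the estimation turns that chain back into `u o` with idle registers, from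
which the continuation is estimated by `B o`. Both kinds of error are combined by Minkowski's
inequality over the outcomes. -/
theorem defect_block_le (s : ℝ) (J : ℕ) {Z : Type} [Fintype Z]
    (f : Qubits r × (Fin (n + J) → Λ) → Z) (next : Z → Proc r (Qubits r) Λ β (n + J))
    (hist : List ℕ) {tab : Fin n → Matrix (Fin d × (Λ × E)) (Fin d × (Λ × E)) ℂ}
    (htab : UnitaryTab tab) (q : ℕ) (v : Basis d r (Qubits r) Λ E F n m → ℂ)
    (u : Z → Basis d r (Qubits r) Λ E F n m → ℂ) {B : Z → ℝ}
    (hB : ∀ o hist' (tab' : Fin (n + J) → Matrix (Fin d × (Λ × E)) (Fin d × (Λ × E)) ℂ) q' ι,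
      UnitaryTab tab' → defectSq O S (next o) hist' tab' q' m (pad ι J (u o)) ≤ B o) :
    defect O S (block s J f next) hist tab q m v ≤
      Real.sqrt (∑ o, normSq (keep f o (chain (fun j => O.pe hist (n + j) s) J v) -
        chain (fun j => O.pe hist (n + j) s) J (u o))) + Real.sqrt (∑ o, B o) := by
  set P : ℕ → PhaseEstimation (V s).1 ρ ph E := fun j => O.pe hist (n + j) s
  rw [defect, block, defectSq_peTo, defectSq_measureTo]
  have htab' := htab.tabs P J
  have h1 : ∀ o, defectSq O S (undoTo n J (next o)) ((Fintype.equivFin Z o).1 :: hist)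
      (tabs tab P J) (q + J) m (keep f o (chain P J v)) ≤
      (nrm (keep f o (chain P J v) - chain P J (u o)) + Real.sqrt (B o)) ^ 2 := by
    intro o
    rw [← defect_sq]
    refine pow_le_pow_left₀ (defect_nonneg _ _ _ _ _ _ _) ?_ 2
    have h2 := defect_add_le O S (undoTo n J (next o)) ((Fintype.equivFin Z o).1 :: hist)
      (tabs tab P J) (q + J) (keep f o (chain P J v) - chain P J (u o)) (chain P J (u o))
    rw [sub_add_cancel] at h2
    refine h2.trans (add_le_add (defect_le_nrm O S _ _ _ htab' _ _) (Real.sqrt_le_sqrt ?_))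
    obtain ⟨q', hq'⟩ := defectSq_undoTo O S n J (next o) ((Fintype.equivFin Z o).1 :: hist)
      (tabs tab P J) (q + J) (chain P J (u o))
    rw [hq', undoOp_chain]
    exact hB _ _ _ _ _ htab'
  have hB0 : ∀ o, Real.sqrt (B o) ^ 2 = B o := fun o =>
    Real.sq_sqrt ((defectSq_nonneg O S _ _ _ _ _).trans
      (hB o hist (tabs tab P J) 0 (fun j => (P j).init) htab'))
  refine (Real.sqrt_le_sqrt (Finset.sum_le_sum fun o _ => h1 o)).trans ?_
  refine (sqrt_sum_add_sq_le _ _ _).trans ?_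
  simp only [nrm_sq, hB0, le_refl]

end Blocks

/-! ## Windows of phases -/

lemma angDist_eq_abs {x y : ℝ} (h : |x - y| ≤ Real.pi) : angDist x y = |x - y| := by
  rw [angDist]
  have hp : (2 * Real.pi : ℝ) ≠ 0 := by positivity
  refine (AddCircle.norm_coe_eq_abs_iff (2 * Real.pi) hp).2 ?_
  rw [abs_of_pos Real.two_pi_pos]
  linarith

/-- The center is moved away from φ by δ - η, or only as far as the point opposite to φ, which is at
distance π > δ. Thus a window of radius η that misses φ lies in one of radius δ that also misses φ.
-/
lemma exists_shift {φ x δ η : ℝ} (hη : 0 ≤ η) (h : η < angDist φ x) (hδ : δ < Real.pi)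
    (hηδ : η ≤ δ) : ∃ x', angDist x x' ≤ δ - η ∧ δ < angDist φ x' := by
  set τ := ((φ - x : ℝ) : Real.Angle).toReal with hτ
  have h1 : ((φ - x : ℝ) : Real.Angle) = (τ : ℝ) := (Real.Angle.coe_toReal _).symm
  have h2 : |τ| ≤ Real.pi := Real.Angle.abs_toReal_le_pi _
  have h3 : angDist φ x = |τ| := by
    have := angDist_eq_abs (x := τ) (y := 0) (by simpa using h2)
    rw [angDist, sub_zero] at this
    rw [angDist, h1, this]
  set u := min (Real.pi - |τ|) (δ - η) with hu
  have hu0 : 0 ≤ u := le_min (by linarith) (by linarith)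
  have hu1 : δ < |τ| + u := by
    rcases min_choice (Real.pi - |τ|) (δ - η) with h4 | h4 <;> rw [hu, h4] <;> linarith
  have hu2 : |τ| + u ≤ Real.pi := by linarith [min_le_left (Real.pi - |τ|) (δ - η)]
  have key : ∀ s : ℝ, |s| = u → |τ + s| = |τ| + u →
      ∃ x', angDist x x' ≤ δ - η ∧ δ < angDist φ x' := by
    intro s hs hs'
    refine ⟨x - s, ?_, ?_⟩
    · rw [angDist_eq_abs (by rw [sub_sub_cancel, hs]; linarith [abs_nonneg τ]), sub_sub_cancel, hs]
      exact min_le_right _ _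
    · have h5 : ((φ - (x - s) : ℝ) : Real.Angle) = ((τ + s - 0 : ℝ) : Real.Angle) := by
        rw [sub_zero, Real.Angle.coe_add, ← h1, ← Real.Angle.coe_add]
        congr 1; ring
      rw [angDist, h5]
      change δ < angDist (τ + s) 0
      rw [angDist_eq_abs (by rw [sub_zero, hs']; exact hu2), sub_zero, hs']
      exact hu1
  rcases le_total 0 τ with h4 | h4
  · exact key u (abs_of_nonneg hu0) (by rw [abs_of_nonneg h4, abs_of_nonneg (by linarith)])
  · exact key (-u) (by rw [abs_neg, abs_of_nonneg hu0])
      (by rw [abs_of_nonpos h4, abs_of_nonpos (by linarith)]; ring)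

section Window

variable {d : ℕ} {U : Matrix (Fin d) (Fin d) ℂ} {φ Δ ρ δ g : ℝ} {ψ χ : Ket d}

lemma norm_starProjection_mono {K K' : Submodule ℂ (Ket d)} (h : K ≤ K') (u : Ket d) :
    ‖K.starProjection u‖ ≤ ‖K'.starProjection u‖ := by
  have := DFunLike.congr_fun (Submodule.starProjection_comp_starProjection_of_le h) u
  rw [← this]
  exact Submodule.norm_starProjection_apply_le _ _

/-- A window that contains φ has width 6ρ < Δ and so no other eigenphase; its probability is at most
the overlap. A window that misses φ is enlarged by `exists_shift` to radius δ, where dominance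
applies. -/
lemma norm_phaseSpace_le (h : IsGapped U φ χ Δ) (hψ : IsDominant U φ ψ g δ) (hρ : 0 < ρ)
    (hρΔ : 8 * ρ ≤ Δ) (hρδ : 4 * ρ ≤ δ) (hδ : δ < Real.pi) {g' : ℝ} (hg : g ≤ g')
    (hp : ‖inner ℂ χ ψ‖ ^ 2 ≤ g') (x : ℝ) :
    ‖(phaseSpace U x (3 * ρ)).starProjection ψ‖ ^ 2 ≤ g' := by
  by_cases hx : angDist φ x ≤ 3 * ρ
  · have h1 : phaseSpace U x (3 * ρ) ≤ Submodule.span ℂ {χ} := by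
      refine Submodule.span_le.2 ?_
      rintro η ⟨φ', hη, hφ'⟩
      by_cases h0 : η = 0
      · rw [h0]; exact Submodule.zero_mem _
      · rcases h.gap φ' η h0 hη with ⟨c, rfl⟩ | h2
        · exact Submodule.smul_mem _ _ (Submodule.mem_span_singleton_self _)
        · have := angDist_triangle φ' x φ
          rw [angDist_comm x φ] at this
          linarith
    refine le_trans (pow_le_pow_left₀ (norm_nonneg _) (norm_starProjection_mono h1 ψ) 2) ?_
    rwa [Submodule.starProjection_unit_singleton ℂ h.norm_eq, norm_smul, h.norm_eq, mul_one]
  · obtain ⟨x', h1, h2⟩ := exists_shift (by linarith) (not_le.1 hx) hδ (by linarith)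
    have h3 : phaseSpace U x (3 * ρ) ≤ phaseSpace U x' δ := by
      refine Submodule.span_mono ?_
      rintro η ⟨φ', hη, hφ'⟩
      exact ⟨φ', hη, by linarith [angDist_triangle φ' x x']⟩
    refine le_trans (pow_le_pow_left₀ (norm_nonneg _) (norm_starProjection_mono h3 ψ) 2) ?_
    by_contra h4
    exact (not_le.2 h2) (hψ x' (by linarith))

open Classical in
-- Estimates within 2ρ of `x` arise only from eigenphases within 3ρ of `x`.
lemma PhaseEstimation.sum_out_window {Λ E : Type} [Fintype Λ] [DecidableEq Λ] [Fintype E]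
    [DecidableEq E] {ph : Λ → ℝ} (P : PhaseEstimation U ρ ph E)
    (hU : U ∈ Matrix.unitaryGroup (Fin d) ℂ) (ψ : Ket d) (x : ℝ) :
    ∑ p, ‖P.out ψ p‖ ^ 2 * (if angDist (ph p.2.1) x ≤ 2 * ρ then 1 else 0) ≤
      ‖(phaseSpace U x (3 * ρ)).starProjection ψ‖ ^ 2 := by
  set u := (phaseSpace U x (3 * ρ)).starProjection ψ
  have h1 : ψ - u ∈ eigSpan U (fun φ => ¬ angDist φ x ≤ 3 * ρ) := by
    refine orthogonal_eigSpan_le hU (Q := fun φ => angDist φ x ≤ 3 * ρ) (fun a b hab hQ => ?_)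
      (Submodule.sub_starProjection_mem_orthogonal ψ)
    rwa [angDist_eq_of_exp_eq x hab.symm]
  rw [← P.normSq_out, normSq]
  refine Finset.sum_le_sum fun ⟨j, l, e⟩ _ => ?_
  dsimp only
  split_ifs with hl
  · have h2 := P.out_eq_zero h1 (l := l) (fun φ' hφ' => by
      have := angDist_triangle φ' (ph l) x
      rw [angDist_comm φ' (ph l)] at this
      linarith [not_le.1 hφ']) j e
    rw [map_sub, Pi.sub_apply, sub_eq_zero] at h2
    rw [mul_one, h2]
  · rw [mul_zero]; positivity

end Window

/-! ## Functions of the estimated phases -/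

section Hits

variable (ρ : ℝ) (h : ℕ)

open Classical in
/-- The systems whose estimated phases are close to those of more than half of the first `h`
systems. -/
def centers (y : ℕ → ℝ) : Set ℕ := {k | k < h ∧
  h < 2 * ((Finset.range h).filter fun i => angDist (y i) (y k) ≤ 2 * ρ).card}

/-- A phase close to more than half of the estimated phases of the first `h` systems. -/
def center (y : ℕ → ℝ) : ℝ := y (sInf (centers ρ h y))

open Classical in
/-- The systems with qubit `1` and estimated phase close to the center, among the first `J`. -/
def hits (J : ℕ) (w : ℕ → Bool) (y : ℕ → ℝ) (j : ℕ) : Bool :=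
  decide (j < J ∧ w j = true ∧ (centers ρ h y).Nonempty ∧ angDist (y j) (center ρ h y) ≤ 2 * ρ)

variable {ρ h}

/-- The center depends on the first `h` phases only. For the other systems it is a window fixed in
advance, as `sum_chain_le` requires. -/
lemma centers_congr {y y' : ℕ → ℝ} (hy : ∀ i < h, y i = y' i) :
    centers ρ h y = centers ρ h y' := by
  ext k
  refine and_congr_right fun hk => ?_
  rw [hy k hk]
  have : ∀ i ∈ Finset.range h, (angDist (y i) (y' k) ≤ 2 * ρ ↔ angDist (y' i) (y' k) ≤ 2 * ρ) :=
    fun i hi => by rw [hy i (Finset.mem_range.1 hi)]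
  rw [Finset.filter_congr this]

lemma center_congr {y y' : ℕ → ℝ} (hy : ∀ i < h, y i = y' i) (hne : (centers ρ h y).Nonempty) :
    center ρ h y = center ρ h y' := by
  rw [center, center, ← centers_congr hy]
  exact hy _ (Nat.sInf_mem hne).1

open Classical in
-- No estimates lie between ρ and Δ - ρ from φ, and 3ρ < Δ - ρ. So an estimate within 3ρ of φ is
-- already within ρ, which absorbs the inaccuracy of the center and of the windows of radius 2ρ.
lemma hits_eq_pat {φ Δ : ℝ} (hρ : 0 < ρ) (hρΔ : 8 * ρ ≤ Δ) {J : ℕ} (hJ : h ≤ J) {y : ℕ → ℝ}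
    (w : ℕ → Bool)
    (hmaj : h < 2 * ((Finset.range h).filter fun i => angDist (y i) φ ≤ ρ).card)
    (hsupp : ∀ j < J, angDist (y j) φ ≤ ρ ∨ Δ - ρ ≤ angDist (y j) φ) :
    hits ρ h J w y = pat φ ρ J w y := by
  have h1 : (centers ρ h y).Nonempty := by
    obtain ⟨k, hk⟩ : ((Finset.range h).filter fun i => angDist (y i) φ ≤ ρ).Nonempty := by
      rw [← Finset.card_pos]; omega
    rw [Finset.mem_filter, Finset.mem_range] at hk
    refine ⟨k, hk.1, hmaj.trans_le (Nat.mul_le_mul_left 2 (Finset.card_le_card fun i hi => ?_))⟩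
    rw [Finset.mem_filter] at hi ⊢
    refine ⟨hi.1, ?_⟩
    have := angDist_triangle (y i) φ (y k)
    rw [angDist_comm φ] at this
    linarith [hi.2, hk.2]
  have h2 := Nat.sInf_mem h1
  -- Two majorities of the same `h` estimates intersect: some estimate is close both to φ and to the
  -- center.
  have h3 : angDist (center ρ h y) φ ≤ ρ := by
    obtain ⟨i, hi⟩ : (((Finset.range h).filter fun i => angDist (y i) φ ≤ ρ) ∩
        ((Finset.range h).filter fun i => angDist (y i) (center ρ h y) ≤ 2 * ρ)).Nonempty := by
      rw [← Finset.card_pos]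
      have h4 := Finset.card_union_add_card_inter
        ((Finset.range h).filter fun i => angDist (y i) φ ≤ ρ)
        ((Finset.range h).filter fun i => angDist (y i) (center ρ h y) ≤ 2 * ρ)
      have h5 : (((Finset.range h).filter fun i => angDist (y i) φ ≤ ρ) ∪
        ((Finset.range h).filter fun i => angDist (y i) (center ρ h y) ≤ 2 * ρ)).card ≤ h := by
        conv_rhs => rw [← Finset.card_range h]
        exact Finset.card_le_card (Finset.union_subset (Finset.filter_subset _ _)
          (Finset.filter_subset _ _))
      have h6 : h < 2 * ((Finset.range h).filter fun i =>
        angDist (y i) (center ρ h y) ≤ 2 * ρ).card := h2.2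
      omega
    rw [Finset.mem_inter, Finset.mem_filter, Finset.mem_filter] at hi
    refine (hsupp _ (h2.1.trans_le hJ)).resolve_right fun h7 => ?_
    have h8 := angDist_triangle (center ρ h y) (y i) φ
    rw [angDist_comm (center ρ h y) (y i)] at h8
    have h9 : Δ - ρ ≤ angDist (center ρ h y) φ := h7
    linarith [hi.1.2, hi.2.2]
  funext j
  rw [hits, pat, decide_eq_decide]
  refine and_congr_right fun hj => and_congr_right fun _ => ?_
  constructor
  · rintro ⟨-, h4⟩
    refine (hsupp j hj).resolve_right fun h7 => ?_
    linarith [angDist_triangle (y j) (center ρ h y) φ]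
  · intro h4
    refine ⟨h1, ?_⟩
    have := angDist_triangle (y j) φ (center ρ h y)
    rw [angDist_comm φ] at this
    linarith

/-- Enough of the systems `h, …, r - 1` are marked. -/
def enough (γ : ℝ) (h r : ℕ) (b : ℕ → Bool) : Bool :=
  open Classical in
  decide ((1 - 2 * γ) / 2 * ((r : ℝ) - h) ≤ ((Finset.Ico h r).filter fun j => b j = true).card)

open Classical in
/-- The first of the marked systems among the first `h`. -/
def first {r : ℕ} [NeZero r] (h : ℕ) (b : ℕ → Bool) : Option (Fin r) :=
  if ∃ j < h, b j = true then some (cp r (sInf {j | j < h ∧ b j = true})) else none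

lemma first_eq_some {r : ℕ} [NeZero r] {h : ℕ} (hr : h ≤ r) {b : ℕ → Bool} {i : Fin r}
    (hi : first h b = some i) : (i : ℕ) < h ∧ b i = true := by
  rw [first] at hi
  split_ifs at hi with h1
  have h2 : sInf {j | j < h ∧ b j = true} ∈ {j | j < h ∧ b j = true} := Nat.sInf_mem h1
  rw [← Option.some.inj hi, val_cp (h2.1.trans_le hr)]
  exact h2

lemma first_eq_none {r : ℕ} [NeZero r] {h : ℕ} {b : ℕ → Bool}
    (hi : first (r := r) h b = none) : ∀ j < h, b j = false := by
  rw [first] at hi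
  split_ifs at hi with h1
  simpa using h1

end Hits

/-! ## Estimates for coherent measurements -/

section Estimates

lemma exp_sub_one_le {t : ℝ} (h0 : 0 ≤ t) (h1 : t ≤ 1) : Real.exp t - 1 ≤ t + t ^ 2 := by
  have := Real.abs_exp_sub_one_sub_id_le (x := t) (by rwa [abs_of_nonneg h0])
  linarith [le_of_abs_le this]

lemma one_sub_exp_neg_ge {t : ℝ} (h0 : 0 ≤ t) : t - t ^ 2 / 2 ≤ 1 - Real.exp (-t) := by
  have h1 := Real.quadratic_le_exp_of_nonneg h0
  have h2 : Real.exp (-t) ≤ (1 + t + t ^ 2 / 2)⁻¹ := by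
    rw [Real.exp_neg]
    exact inv_anti₀ (by positivity) h1
  have h3 : (1 + t + t ^ 2 / 2)⁻¹ ≤ 1 - t + t ^ 2 / 2 := by
    rw [inv_le_iff_one_le_mul₀ (by positivity)]
    nlinarith [sq_nonneg (t ^ 2)]
  linarith

/-- A marked system counts with probability s/2, and the threshold (1-2γ)/2 lies midway between the
means for s = 1-3γ and s = 1-γ. The parameter γ/2 gives an exponent of at most -γ²/8 - 3γ³/8. -/
lemma chernoff_upper {γ s : ℝ} (h0 : 0 ≤ γ) (h1 : γ ≤ 1 / 12) (hs : s ≤ 1 - 3 * γ) :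
    Real.exp (-(γ / 2 * ((1 - 2 * γ) / 2))) * (1 + s / 2 * (Real.exp (γ / 2) - 1)) ≤
      Real.exp (-(γ ^ 2 / 8)) := by
  have e1 := exp_sub_one_le (t := γ / 2) (by linarith) (by linarith)
  have e0 : 0 ≤ Real.exp (γ / 2) - 1 := by linarith [Real.add_one_le_exp (γ / 2)]
  have e2 : s / 2 * (Real.exp (γ / 2) - 1) ≤ (1 - 3 * γ) / 2 * (γ / 2 + (γ / 2) ^ 2) := by
    calc _ ≤ (1 - 3 * γ) / 2 * (Real.exp (γ / 2) - 1) :=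
          mul_le_mul_of_nonneg_right (by linarith) e0
      _ ≤ _ := mul_le_mul_of_nonneg_left e1 (by linarith)
  have e3 : 1 + s / 2 * (Real.exp (γ / 2) - 1) ≤
      Real.exp ((1 - 3 * γ) / 2 * (γ / 2 + (γ / 2) ^ 2)) := by
    linarith [Real.add_one_le_exp ((1 - 3 * γ) / 2 * (γ / 2 + (γ / 2) ^ 2))]
  refine (mul_le_mul_of_nonneg_left e3 (Real.exp_nonneg _)).trans ?_
  rw [← Real.exp_add]
  exact Real.exp_le_exp.2 (by nlinarith [pow_nonneg h0 3])

/-- The same for the other tail, with the parameter -γ/2; the exponent is at most -3γ²/16 - γ³/16.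
-/
lemma chernoff_lower {γ s : ℝ} (h0 : 0 ≤ γ) (h1 : γ ≤ 1 / 12) (hs : 1 - γ ≤ s) :
    Real.exp (γ / 2 * ((1 - 2 * γ) / 2)) * (1 - s / 2 * (1 - Real.exp (-(γ / 2)))) ≤
      Real.exp (-(γ ^ 2 / 8)) := by
  have e1 := one_sub_exp_neg_ge (t := γ / 2) (by linarith)
  have e0 : 0 ≤ 1 - Real.exp (-(γ / 2)) := by
    have : Real.exp (-(γ / 2)) ≤ 1 := Real.exp_le_one_iff.2 (by linarith)
    linarith
  have e2 : (1 - γ) / 2 * (γ / 2 - (γ / 2) ^ 2 / 2) ≤ s / 2 * (1 - Real.exp (-(γ / 2))) := by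
    calc _ ≤ (1 - γ) / 2 * (1 - Real.exp (-(γ / 2))) :=
          mul_le_mul_of_nonneg_left e1 (by linarith)
      _ ≤ _ := mul_le_mul_of_nonneg_right (by linarith) e0
  have e3 : 1 - s / 2 * (1 - Real.exp (-(γ / 2))) ≤
      Real.exp (-((1 - γ) / 2 * (γ / 2 - (γ / 2) ^ 2 / 2))) := by
    linarith [Real.add_one_le_exp (-((1 - γ) / 2 * (γ / 2 - (γ / 2) ^ 2 / 2)))]
  refine (mul_le_mul_of_nonneg_left e3 (Real.exp_nonneg _)).trans ?_
  rw [← Real.exp_add]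
  exact Real.exp_le_exp.2 (by nlinarith [pow_nonneg h0 3])

variable {d r : ℕ} [NeZero r] {Λ E F : Type} [Fintype Λ] [DecidableEq Λ]
  [Fintype E] [DecidableEq E] [Fintype F] [DecidableEq F] {n m : ℕ} {β : Type}
  {U : Matrix (Fin d) (Fin d) ℂ} {φ Δ ρ γ : ℝ} {ψ χ : Ket d} {ph : Λ → ℝ}
  (P : ℕ → PhaseEstimation U ρ ph E)

lemma PhaseEstimation.sum_out_ite (P : PhaseEstimation U ρ ph E) (hψ : ‖ψ‖ = 1) (Q : Λ → Prop)
    [DecidablePred Q] (a b : ℝ) : ∑ p, ‖P.out ψ p‖ ^ 2 * (if Q p.2.1 then a else b) =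
      b + (a - b) * ∑ p, ‖P.out ψ p‖ ^ 2 * (if Q p.2.1 then 1 else 0) := by
  have h1 : ∑ p, ‖P.out ψ p‖ ^ 2 * b = b := by rw [← Finset.sum_mul, P.sum_out hψ, one_mul]
  conv_rhs => rw [← h1]
  rw [Finset.mul_sum, ← Finset.sum_add_distrib]
  refine Finset.sum_congr rfl fun p _ => ?_
  rw [h1]
  split_ifs <;> ring

open Classical in
-- Close estimates get the weight 3/4 and all others 4/3. Without a majority of close ones the
-- product of weights is at least 1, while the average weight is at most (2/3)(3/4) + (1/3)(4/3) =
-- 17/18.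
theorem sum_not_majority_le (hg : IsGapped U φ χ Δ) (hρ : 2 * ρ < Δ) (hψ : ‖ψ‖ = 1)
    (hp : 2 / 3 ≤ ‖inner ℂ χ ψ‖ ^ 2) {h J : ℕ} (hh : h ≤ J) (hJ : J ≤ r)
    {v : Basis d r (Qubits r) Λ E F n m → ℂ}
    (hv : ∀ j < J, At (cp r j) (Submodule.span ℂ {ketMinus ψ}) v) :
    ∑ x, ‖chain P J v x‖ ^ 2 * (if h < 2 * ((Finset.range h).filter fun i =>
      angDist (yv ph n x.2.2.1 i) φ ≤ ρ).card then 0 else 1) ≤ (17 / 18) ^ h * normSq v := by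
  have h1 := sum_chain_le P hψ (Nat.zero_le J) hJ (fun j _ => hv j)
    (ω := fun j _ y => if j < h then (if angDist (y j) φ ≤ ρ then 3 / 4 else 4 / 3) else 1)
    (fun j b y => by split_ifs <;> norm_num)
    (fun j b y y' _ hy => by rw [hy j le_rfl])
    (κ := fun j => if j < h then 17 / 18 else 1)
    (fun j => by split_ifs <;> norm_num)
    (fun j y _ => by
      split_ifs
      · simp only [Function.update_self]
        rw [(P j).sum_out_ite hψ (fun l => angDist (ph l) φ ≤ ρ), (P j).sum_out_near hg hρ ψ,
          Fintype.sum_bool]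
        linarith
      · simp only [mul_one]
        rw [(P j).sum_out hψ]
        simp)
  have h2 : ∀ f : ℕ → ℝ, ∏ j ∈ Finset.Ico 0 J, (if j < h then f j else 1) =
      ∏ j ∈ Finset.range h, f j := by
    intro f
    rw [Finset.prod_ite, Finset.prod_const_one, mul_one]
    refine Finset.prod_congr ?_ fun _ _ => rfl
    ext j
    simp only [Finset.mem_filter, Finset.mem_Ico, Finset.mem_range]
    omega
  rw [h2, Finset.prod_const, Finset.card_range] at h1
  refine le_trans (Finset.sum_le_sum fun x _ => ?_) h1
  refine mul_le_mul_of_nonneg_left ?_ (sq_nonneg _)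
  rw [h2]
  split_ifs with hmaj
  · exact Finset.prod_nonneg fun j _ => by split_ifs <;> norm_num
  · rw [Finset.prod_ite, Finset.prod_const, Finset.prod_const]
    have h3 := Finset.card_filter_add_card_filter_not (s := Finset.range h)
      (fun i => angDist (yv ph n x.2.2.1 i) φ ≤ ρ)
    rw [Finset.card_range] at h3
    have h4 : (3 / 4 : ℝ) = (4 / 3)⁻¹ := by norm_num
    rw [h4, inv_pow, inv_mul_eq_div, one_le_div (by positivity)]
    exact pow_le_pow_right₀ (by norm_num) (by omega)

open Classical in
-- Each system is marked with probability at least (1/2)(2/3) = 1/3.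
theorem normSq_compo_first_le (P : ℕ → PhaseEstimation U ρ ph E)
    (hg : IsGapped U φ χ Δ) (hρ : 2 * ρ < Δ) (hψ : ‖ψ‖ = 1)
    (hp : 2 / 3 ≤ ‖inner ℂ χ ψ‖ ^ 2) {h : ℕ} (hh : h ≤ r)
    {v : Basis d r (Qubits r) Λ E F n m → ℂ}
    (hv : ∀ j < h, At (cp r j) (Submodule.span ℂ {ketMinus ψ}) v) :
    normSq (compo (ketOne χ) h (fun b => decide (first (r := r) h b = none)) v) ≤
      (2 / 3) ^ h * normSq v := by
  have h1 := sum_chain_le P hψ (Nat.zero_le h) hh (fun j _ => hv j)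
    (ω := fun j b y => if b = true ∧ angDist (y j) φ ≤ ρ then 0 else 1)
    (fun j b y => by split_ifs <;> norm_num)
    (fun j b y y' _ hy => by rw [hy j le_rfl])
    (κ := fun j => 2 / 3) (fun j => by norm_num)
    (fun j y _ => by
      simp only [Function.update_self]
      rw [Fintype.sum_bool]
      simp only [true_and, Bool.false_eq_true, false_and, if_false, mul_one]
      rw [(P j).sum_out_ite hψ (fun l => angDist (ph l) φ ≤ ρ), (P j).sum_out_near hg hρ ψ,
        (P j).sum_out hψ]
      linarith)
  rw [Finset.prod_const, Nat.card_Ico, Nat.sub_zero] at h1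
  rw [normSq_compo P hg hρ hh]
  refine le_trans (Finset.sum_le_sum fun x _ => ?_) h1
  refine mul_le_mul_of_nonneg_left ?_ (sq_nonneg _)
  split_ifs with hx
  · rw [Finset.prod_eq_one]
    intro j hj
    have := first_eq_none (of_decide_eq_true hx) j (Finset.mem_Ico.1 hj).2
    rw [pat, decide_eq_false_iff_not] at this
    rw [if_neg fun h' => this ⟨(Finset.mem_Ico.1 hj).2, h'⟩]
  · exact Finset.prod_nonneg fun j _ => by split_ifs <;> norm_num

lemma prod_exp_eq (t c : ℝ) {h r : ℕ} (hh : h ≤ r) (Q : ℕ → Prop)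
    [DecidablePred Q] :
    ∏ j ∈ Finset.Ico h r, Real.exp (t * (if Q j then 1 else 0) - t * c) =
      Real.exp (t * (((Finset.Ico h r).filter Q).card - c * ((r : ℝ) - h))) := by
  rw [← Real.exp_sum, Finset.sum_sub_distrib, ← Finset.mul_sum, Finset.sum_boole,
    Finset.sum_const, Nat.card_Ico, nsmul_eq_mul, Nat.cast_sub hh]
  congr 1; ring

lemma PhaseEstimation.sum_exp (P : PhaseEstimation U ρ ph E) (hψ : ‖ψ‖ = 1) (Q : Λ → Prop)
    [DecidablePred Q] (t c : ℝ) : ∑ b : Bool, ∑ p, ‖P.out ψ p‖ ^ 2 *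
      Real.exp (t * (if b = true ∧ Q p.2.1 then 1 else 0) - t * c) =
        2 * (Real.exp (-(t * c)) * (1 + (∑ p, ‖P.out ψ p‖ ^ 2 * (if Q p.2.1 then 1 else 0)) / 2 *
          (Real.exp t - 1))) := by
  have h1 : ∀ (b : Bool) (p : Fin d × (Λ × E)),
      Real.exp (t * (if b = true ∧ Q p.2.1 then 1 else 0) - t * c) =
      if b = true ∧ Q p.2.1 then Real.exp (-(t * c)) * Real.exp t else Real.exp (-(t * c)) := by
    intro b p
    rw [← Real.exp_add]
    split_ifs <;> congr 1 <;> ring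
  simp only [h1]
  rw [Fintype.sum_bool]
  simp only [true_and, Bool.false_eq_true, false_and, if_false]
  rw [P.sum_out_ite hψ, ← Finset.sum_mul, P.sum_out hψ]
  ring

open Classical in
-- Large overlap: too small a number of marked systems is excluded by `chernoff_lower`.
theorem normSq_compo_enough_le (P : ℕ → PhaseEstimation U ρ ph E)
    (hg : IsGapped U φ χ Δ) (hρ : 2 * ρ < Δ) (hψ : ‖ψ‖ = 1)
    (hγ : 0 ≤ γ) (hγ' : γ ≤ 1 / 12) (hp : 1 - γ ≤ ‖inner ℂ χ ψ‖ ^ 2) {h : ℕ} (hh : h ≤ r)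
    {v : Basis d r (Qubits r) Λ E F n m → ℂ}
    (hv : ∀ j < r, At (cp r j) (Submodule.span ℂ {ketMinus ψ}) v) :
    normSq (compo (ketOne χ) r (fun b => decide (enough γ h r b = false)) v) ≤
      Real.exp (-(γ ^ 2 / 8)) ^ (r - h) * normSq v := by
  have h1 := sum_chain_le P hψ hh le_rfl (fun j _ => hv j)
    (ω := fun j b y => Real.exp (-(γ / 2) * (if b = true ∧ angDist (y j) φ ≤ ρ then 1 else 0) -
      -(γ / 2) * ((1 - 2 * γ) / 2)))
    (fun j b y => Real.exp_nonneg _)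
    (fun j b y y' _ hy => by rw [hy j le_rfl])
    (κ := fun j => Real.exp (-(γ ^ 2 / 8))) (fun j => Real.exp_nonneg _)
    (fun j y _ => by
      simp only [Function.update_self]
      rw [(P j).sum_exp hψ (fun l => angDist (ph l) φ ≤ ρ), (P j).sum_out_near hg hρ ψ]
      refine mul_le_mul_of_nonneg_left (le_of_eq_of_le ?_ (chernoff_lower hγ hγ' hp)) zero_le_two
      rw [neg_mul, neg_neg]
      ring)
  rw [Finset.prod_const, Nat.card_Ico] at h1
  rw [normSq_compo P hg hρ le_rfl]
  refine le_trans (Finset.sum_le_sum fun x _ => ?_) h1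
  refine mul_le_mul_of_nonneg_left ?_ (sq_nonneg _)
  rw [prod_exp_eq _ _ hh]
  split_ifs with hx
  · have hx := of_decide_eq_false (of_decide_eq_true hx)
    rw [not_le] at hx
    rw [Real.one_le_exp_iff]
    refine mul_nonneg_of_nonpos_of_nonpos (by linarith) ?_
    have : (Finset.Ico h r).filter (fun j => pat φ ρ r (wv x.2.1) (yv ph n x.2.2.1) j = true) =
        (Finset.Ico h r).filter fun j =>
          wv x.2.1 j = true ∧ angDist (yv ph n x.2.2.1 j) φ ≤ ρ := by
      refine Finset.filter_congr fun j hj => ?_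
      rw [pat, decide_eq_true_eq]
      exact and_iff_right (Finset.mem_Ico.1 hj).2
    rw [this] at hx
    linarith
  · positivity

open Classical in
-- Small overlap: the center may have nothing to do with φ. By `hw` no window whatsoever is hit with
-- probability more than 1-3γ, so `chernoff_upper` applies conditionally on the first `h` phases.
theorem sum_enough_le (hψ : ‖ψ‖ = 1) (hγ : 0 ≤ γ) (hγ' : γ ≤ 1 / 12)
    (hw : ∀ j x, ∑ p, ‖(P j).out ψ p‖ ^ 2 * (if angDist (ph p.2.1) x ≤ 2 * ρ then 1 else 0) ≤
      1 - 3 * γ)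
    {h : ℕ} (hh : h ≤ r) {v : Basis d r (Qubits r) Λ E F n m → ℂ}
    (hv : ∀ j < r, At (cp r j) (Submodule.span ℂ {ketMinus ψ}) v) :
    ∑ x, ‖chain P r v x‖ ^ 2 * (if enough γ h r (hits ρ h r (wv x.2.1) (yv ph n x.2.2.1)) then 1
      else 0) ≤ Real.exp (-(γ ^ 2 / 8)) ^ (r - h) * normSq v := by
  have h1 := sum_chain_le P hψ hh le_rfl (fun j _ => hv j)
    (ω := fun j b y => Real.exp (γ / 2 * (if b = true ∧ ((centers ρ h y).Nonempty ∧
      angDist (y j) (center ρ h y) ≤ 2 * ρ) then 1 else 0) - γ / 2 * ((1 - 2 * γ) / 2)))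
    (fun j b y => Real.exp_nonneg _)
    (fun j b y y' hj hy => by
      have hy' : ∀ i < h, y i = y' i := fun i hi => hy i (by omega)
      have : ((centers ρ h y).Nonempty ∧ angDist (y j) (center ρ h y) ≤ 2 * ρ) ↔
          ((centers ρ h y').Nonempty ∧ angDist (y' j) (center ρ h y') ≤ 2 * ρ) := by
        rw [centers_congr hy']
        refine and_congr_right fun hne => ?_
        rw [← centers_congr hy'] at hne
        rw [hy j le_rfl, center_congr hy' hne]
      simp only [this])
    (κ := fun j => Real.exp (-(γ ^ 2 / 8))) (fun j => Real.exp_nonneg _)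
    (fun j y hj => by
      -- The new phase belongs to a system from `h` on and does not move the center.
      have hu : ∀ t, ∀ i < h, Function.update y j t i = y i := fun t i hi => by
        rw [Function.update_of_ne (by omega)]
      have : ∀ t, ((centers ρ h (Function.update y j t)).Nonempty ∧
          angDist t (center ρ h (Function.update y j t)) ≤ 2 * ρ) ↔
          ((centers ρ h y).Nonempty ∧ angDist t (center ρ h y) ≤ 2 * ρ) := fun t => by
        rw [centers_congr (hu t)]
        refine and_congr_right fun hne => ?_
        rw [← centers_congr (hu t)] at hne
        rw [center_congr (hu t) hne]
      simp only [Function.update_self, this]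
      rw [(P j).sum_exp hψ
        (fun l => (centers ρ h y).Nonempty ∧ angDist (ph l) (center ρ h y) ≤ 2 * ρ)]
      refine mul_le_mul_of_nonneg_left (chernoff_upper hγ hγ' ?_) zero_le_two
      refine (Finset.sum_le_sum fun p _ => ?_).trans (hw j (center ρ h y))
      refine mul_le_mul_of_nonneg_left ?_ (sq_nonneg _)
      split_ifs with h1 h2
      · exact le_rfl
      · exact absurd h1.2 h2
      · exact zero_le_one
      · exact le_rfl)
  rw [Finset.prod_const, Nat.card_Ico] at h1
  refine le_trans (Finset.sum_le_sum fun x _ => ?_) h1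
  refine mul_le_mul_of_nonneg_left ?_ (sq_nonneg _)
  rw [prod_exp_eq _ _ hh]
  split_ifs with hx
  · have hx := of_decide_eq_true hx
    rw [Real.one_le_exp_iff]
    refine mul_nonneg (by linarith) ?_
    have : (Finset.Ico h r).filter (fun j => hits ρ h r (wv x.2.1) (yv ph n x.2.2.1) j = true) =
        (Finset.Ico h r).filter fun j =>
          wv x.2.1 j = true ∧ ((centers ρ h (yv ph n x.2.2.1)).Nonempty ∧
            angDist (yv ph n x.2.2.1 j) (center ρ h (yv ph n x.2.2.1)) ≤ 2 * ρ) := by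
      refine Finset.filter_congr fun j hj => ?_
      rw [hits, decide_eq_true_eq]
      exact and_iff_right (Finset.mem_Ico.1 hj).2
    rw [this] at hx
    linarith
  · positivity

/-- By `hits_eq_pat` the actual and the ideal selection differ only at basis states without a
majority close to φ. There an amplitude appears in at most one outcome on either side, whence the
factor 2. -/
theorem sum_normSq_keep_sub_le (hg : IsGapped U φ χ Δ) (hρ : 0 < ρ) (hρΔ : 8 * ρ ≤ Δ)
    (hψ : ‖ψ‖ = 1) (hp : 2 / 3 ≤ ‖inner ℂ χ ψ‖ ^ 2) {h J : ℕ} (hh : h ≤ J) (hJ : J ≤ r)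
    {v : Basis d r (Qubits r) Λ E F n m → ℂ}
    (hv : ∀ j < J, At (cp r j) (Submodule.span ℂ {ketMinus ψ}) v)
    {Z : Type} [Fintype Z] [DecidableEq Z] (g : (ℕ → Bool) → Z) :
    ∑ o, normSq (keep (fun x => g (hits ρ h J (wv x.1) (yv ph n x.2))) o (chain P J v) -
      chain P J (compo (ketOne χ) J (fun b => decide (g b = o)) v)) ≤
        2 * (17 / 18) ^ h * normSq v := by
  rw [mul_assoc]
  refine le_trans ?_ (mul_le_mul_of_nonneg_left
    (sum_not_majority_le P hg (by linarith) hψ hp hh hJ hv) zero_le_two)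
  unfold normSq
  rw [Finset.sum_comm, Finset.mul_sum]
  refine Finset.sum_le_sum fun x _ => ?_
  simp only [← sift_chain P hg (by linarith : 2 * ρ < Δ) hJ, Pi.sub_apply, keep, sift,
    decide_eq_true_eq]
  set c := chain P J v x
  by_cases hc : c = 0
  · simp [hc]
  split_ifs with hmaj
  · simp [hits_eq_pat hρ hρΔ hh (wv x.2.1) hmaj fun j hj => chain_support P hg hc hj]
  · rw [mul_one]
    have h1 : ∀ (A B : Prop) (_ : Decidable A) (_ : Decidable B),
        ‖(if A then c else 0) - (if B then c else 0)‖ ^ 2 ≤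
        (if A then ‖c‖ ^ 2 else 0) + (if B then ‖c‖ ^ 2 else 0) := by
      intro A B _ _
      split_ifs <;> simp
    have h2 : ∀ (z : Z) (inst : ∀ o, Decidable (z = o)),
        ∑ o, @ite _ (z = o) (inst o) (‖c‖ ^ 2) 0 = ‖c‖ ^ 2 := fun z inst => by
      rw [Finset.sum_eq_single z (fun o _ ho => if_neg (Ne.symm ho))
        fun h => absurd (Finset.mem_univ _) h, if_pos rfl]
    refine (Finset.sum_le_sum fun o _ => h1 _ _ _ _).trans ?_
    rw [Finset.sum_add_distrib]
    exact (add_le_add (h2 _ _).le (h2 _ _).le).trans (two_mul _).ge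

end Estimates

/-! ## The one-step procedure -/

section Hadamards

variable {d r : ℕ} {Λ E F : Type} [Fintype Λ] [DecidableEq Λ]
  [Fintype E] [DecidableEq E] [Fintype F] [DecidableEq F] {n m : ℕ} {β : Type}

/-- Hadamard gates on the qubits of the systems in the list. -/
def hadamards : List (Fin r) → Proc r (Qubits r) Λ β n → Proc r (Qubits r) Λ β n
  | [], next => next
  | i :: L, next => .gate (qubitGate n Λ (some i) isInvolutive_hadamard) (hadamards L next)

/-- The action of Hadamard gates on the qubits of the systems in the list. -/
def hadList : List (Fin r) → (Basis d r (Qubits r) Λ E F n m → ℂ) →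
    Basis d r (Qubits r) Λ E F n m → ℂ
  | [], v => v
  | i :: L, v => hadList L (tloc i (hadOp d) v)

lemma Proc.Bounded.hadamards (L : List (Fin r)) {next : Proc r (Qubits r) Λ β n} {P A : ℕ}
    (h : next.Bounded P A) : (hadamards L next).Bounded P A := by
  induction L with
  | nil => exact h
  | cons i L ih => exact .gate _ ih

lemma normSq_tloc_hadOp (i : Fin r) (v : Basis d r (Qubits r) Λ E F n m → ℂ) :
    normSq (tloc i (hadOp d) v) = normSq v := by
  rw [← qapp_some, ← applyGate_qubitGate (some i) isInvolutive_hadamard, normSq_applyGate]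

lemma normSq_hadList (L : List (Fin r)) (v : Basis d r (Qubits r) Λ E F n m → ℂ) :
    normSq (hadList L v) = normSq v := by
  induction L generalizing v with
  | nil => rfl
  | cons i L ih => rw [hadList, ih, normSq_tloc_hadOp]

lemma Ready.hadList {v : Basis d r (Qubits r) Λ E F n m → ℂ} (hv : Ready v) (L : List (Fin r)) :
    Ready (hadList L v) := by
  induction L generalizing v with
  | nil => exact hv
  | cons i L ih => exact ih (hv.tloc _ _)

lemma At.hadList {χ χ' : Loc d} (hχ : hadOp d χ = χ') {L : List (Fin r)} (hL : L.Nodup)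
    {v : Basis d r (Qubits r) Λ E F n m → ℂ} (hv : ∀ i ∈ L, At i (Submodule.span ℂ {χ}) v)
    (hv' : ∀ i ∉ L, At i (Submodule.span ℂ {χ'}) v) (i : Fin r) :
    At i (Submodule.span ℂ {χ'}) (hadList L v) := by
  induction L generalizing v with
  | nil => exact hv' i (by simp)
  | cons k L ih =>
    obtain ⟨hk, hL⟩ := List.nodup_cons.1 hL
    refine ih hL (fun j hj => ?_) (fun j hj => ?_)
    · have hkj : k ≠ j := by rintro rfl; exact hk hj
      exact (hv j (List.mem_cons_of_mem _ hj)).tloc_ne hkj _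
    · by_cases hkj : k = j
      · subst hkj
        refine (hv k (by simp)).tloc fun u hu => ?_
        obtain ⟨c, rfl⟩ := Submodule.mem_span_singleton.1 hu
        rw [map_smul, hχ]
        exact Submodule.smul_mem _ _ (Submodule.mem_span_singleton_self _)
      · exact (hv' j (by rw [List.mem_cons, not_or]; exact ⟨Ne.symm hkj, hj⟩)).tloc_ne hkj _

/-- The measurement of the projection onto `ψ ⊗ H|1⟩` of system `i` and its qubit. -/
def projMinus (s φ₀ : ℝ) (i : Fin r) (next : Bool → Proc r (Qubits r) Λ β n) :
    Proc r (Qubits r) Λ β n :=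
  .gate (qubitGate n Λ (some i) isInvolutive_hadamard) <|
  projMeasure s φ₀ i fun ok => .gate (qubitGate n Λ (some i) isInvolutive_hadamard) (next ok)

lemma Proc.Bounded.projMinus (s φ₀ : ℝ) (i : Fin r) {next : Bool → Proc r (Qubits r) Λ β n}
    {P A : ℕ} (h : ∀ o, (next o).Bounded P A) :
    (EigenPaths.projMinus s φ₀ i next).Bounded P (A + 1) :=
  .gate _ (.projMeasure _ _ _ fun o => .gate _ (h o))

lemma hadOp_pr (ψ : Ket d) : hadOp d ∘ₗ pr (ketOne ψ) ∘ₗ hadOp d = pr (ketMinus ψ) := by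
  ext1 u
  simp only [LinearMap.comp_apply, map_smul, pr_apply, ketMinus, inner_hadOp]

variable {V : ℝ → Matrix.unitaryGroup (Fin d) ℂ} {ρ Δ φ : ℝ} {ph : Λ → ℝ} {ψ : Ket d}
  (O : Oracles V ρ Δ ph E F) (S : Target d r (Qubits r) Λ E F β)

lemma defectSq_hadamards (L : List (Fin r)) (next : Proc r (Qubits r) Λ β n) (hist : List ℕ)
    (tab : Fin n → Matrix (Fin d × (Λ × E)) (Fin d × (Λ × E)) ℂ) (q : ℕ)
    (v : Basis d r (Qubits r) Λ E F n m → ℂ) :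
    defectSq O S (hadamards L next) hist tab q m v =
      defectSq O S next hist tab q m (hadList L v) := by
  induction L generalizing v with
  | nil => rfl
  | cons i L ih => rw [hadamards, defectSq_gate, applyGate_qubitGate, qapp_some, ih]; rfl

lemma defectSq_projMinus {s φ₀ : ℝ} (h : IsGapped (V s).1 φ ψ Δ) (hφ : angDist φ₀ φ < Δ / 4)
    (i : Fin r) (next : Bool → Proc r (Qubits r) Λ β n)
    (hist : List ℕ) (tab : Fin n → Matrix (Fin d × (Λ × E)) (Fin d × (Λ × E)) ℂ) (q : ℕ)
    {v : Basis d r (Qubits r) Λ E F n m → ℂ} (hv : Ready v) :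
    ∃ (ι : F) (hist₁ hist₂ : List ℕ),
      defectSq O S (projMinus s φ₀ i next) hist tab q m v =
        defectSq O S (next true) hist₁ tab q (m + 1) (adjEnv ι (tloc i (pr (ketMinus ψ)) v)) +
        defectSq O S (next false) hist₂ tab q (m + 1)
          (adjEnv ι (v - tloc i (pr (ketMinus ψ)) v)) := by
  obtain ⟨ι, hist₁, hist₂, h1⟩ := defectSq_projMeasure O S h hφ i
    (fun ok => .gate (qubitGate n Λ (some i) isInvolutive_hadamard) (next ok)) hist tab q
    (hv.tloc i (hadOp d))
  refine ⟨ι, hist₁, hist₂, ?_⟩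
  have h2 : tloc i (hadOp d) (tloc i (pr (ketOne ψ)) (tloc i (hadOp d) v)) =
      tloc i (pr (ketMinus ψ)) v := by
    rw [tloc_tloc, tloc_tloc, ← hadOp_pr, LinearMap.comp_assoc]
  have h3 : tloc i (hadOp d) (tloc i (hadOp d) v - tloc i (pr (ketOne ψ)) (tloc i (hadOp d) v)) =
      v - tloc i (pr (ketMinus ψ)) v := by
    rw [← h2, eq_sub_iff_add_eq, ← tloc_add, sub_add_cancel, tloc_tloc]
    refine ext_slice i fun x => ?_
    rw [slice_tloc, LinearMap.comp_apply, hadOp_hadOp]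
  rw [projMinus, defectSq_gate, applyGate_qubitGate, qapp_some, h1, defectSq_gate,
    applyGate_qubitGate, qapp_some, tloc_adjEnv, h2, defectSq_gate,
    applyGate_qubitGate, qapp_some, tloc_adjEnv, h3]

end Hadamards

/-! ### Required states of a step; the procedure and its numbers of calls -/

section Target

variable {d r : ℕ} {Λ E F : Type} [Fintype Λ] [DecidableEq Λ]
  [Fintype E] [DecidableEq E] [Fintype F] [DecidableEq F] {n m : ℕ}

/-- States of the form `χ^{⊗ r}` with all qubits of the systems in the state `|1⟩`. -/
def copies (χ : Ket d) : Submodule ℂ (Basis d r (Qubits r) Λ E F n m → ℂ) where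
  carrier := {v | Ready v ∧ ∀ i, At i (Submodule.span ℂ {ketOne χ}) v}
  zero_mem' := ⟨fun _ _ => rfl, fun _ => .zero⟩
  add_mem' h h' := ⟨h.1.add h'.1, fun i => (h.2 i).add (h'.2 i)⟩
  smul_mem' c _ h := ⟨h.1.smul c, fun i => (h.2 i).smul c⟩

open Classical in
/-- The final states required of a one-step procedure. -/
def stepTarget (ψ χ : Ket d) (φχ γ Δ : ℝ) : Target d r (Qubits r) Λ E F (Option ℝ) :=
  fun _ _ _ res => match res with
    | none => if overlap ψ χ ≤ 1 - γ then copies ψ else ⊥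
    | some φ' => if angDist φ' φχ ≤ Δ / 5 ∧ 1 - 3 * γ < overlap ψ χ then copies χ else ⊥

end Target

section Step

variable {d r : ℕ} [NeZero r] {Λ E F : Type} [Fintype Λ] [DecidableEq Λ]
  [Fintype E] [DecidableEq E] [Fintype F] [DecidableEq F] {n m : ℕ}

/-- After phase estimation of system `i`, all systems are taken to the state at `b`. -/
def finish (ph : Λ → ℝ) (a φa b : ℝ) (i : Fin r) : Proc r (Qubits r) Λ (Option ℝ) n :=
  .phaseEst b i (fun _ => true) <| measureTo (fun x => x.2 (Fin.last n)) fun l =>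
    drive a φa b (ph l) (some (ph l)) none (4 * r) (List.finRange r)

/-- A system in the state at `b` is found, and all systems are taken to that state. -/
def advance (ph : Λ → ℝ) (ρ : ℝ) (a φa b : ℝ) : Proc r (Qubits r) Λ (Option ℝ) n :=
  block b (r / 2) (fun x => first (r / 2) (hits ρ (r / 2) (r / 2) (wv x.1) (yv ph n x.2)))
    fun o => match o with
    | none => .done none
    | some i => finish ph a φa b i

/-- The systems in the list are checked to be in the state at `a`. -/
def check (ph : Λ → ℝ) (ρ : ℝ) (a φa b : ℝ) : List (Fin r) → Proc r (Qubits r) Λ (Option ℝ) n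
  | [] => hadamards (List.finRange r) (.done none)
  | i :: L => projMinus a φa i fun ok =>
      if ok then check ph ρ a φa b L else advance ph ρ a φa b

/-- The systems from the `r / 2`-th on. -/
def upperHalf (r : ℕ) : List (Fin r) := (List.finRange r).filter fun i => r / 2 ≤ (i : ℕ)

/-- The part of the one-step procedure that follows the Hadamard gates. -/
def core (ph : Λ → ℝ) (ρ γ a φa b : ℝ) : Proc r (Qubits r) Λ (Option ℝ) n :=
  block b r (fun x => enough γ (r / 2) r (hits ρ (r / 2) r (wv x.1) (yv ph n x.2)))
    fun o => if o then advance ph ρ a φa b else check ph ρ a φa b (upperHalf r)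

/-- The one-step procedure for at least two systems. -/
def tStep (ph : Λ → ℝ) (ρ γ : ℝ) : StepProc r (Qubits r) Λ := fun n a b φa =>
  hadamards (List.finRange r) (core (n := n) ph ρ γ a φa b)

lemma finish_bounded (ph : Λ → ℝ) (a φa b : ℝ) (i : Fin r) :
    (finish (n := n) ph a φa b i).Bounded 1 (4 * r) :=
  .phaseEst _ _ _ (.measureTo _ fun _ => drive_bounded _ _ _ _ _ _ _ _)

lemma advance_bounded (ph : Λ → ℝ) (ρ a φa b : ℝ) :
    (advance (r := r) (n := n) ph ρ a φa b).Bounded (1 + 2 * (r / 2)) (4 * r) := by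
  refine .block _ _ _ fun o => ?_
  cases o with
  | none => exact .done _ _ _
  | some i => exact finish_bounded ph a φa b i

lemma check_bounded (ph : Λ → ℝ) (ρ a φa b : ℝ) (L : List (Fin r)) :
    (check (n := n) ph ρ a φa b L).Bounded (1 + 2 * (r / 2)) (4 * r + L.length) := by
  induction L with
  | nil => exact .hadamards _ (.done _ _ _)
  | cons i L ih =>
    refine .projMinus _ _ _ fun o => ?_
    cases o
    · exact (advance_bounded ph ρ a φa b).mono le_rfl (Nat.le_add_right _ _)
    · exact ih

theorem tStep_bounded (hr : 2 ≤ r) (ph : Λ → ℝ) (ρ γ a φa b : ℝ) :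
    (tStep (r := r) ph ρ γ n a b φa).Bounded (4 * r) (5 * r) := by
  have h1 : (upperHalf r).length ≤ r :=
    (List.length_filter_le _ _).trans (List.length_finRange).le
  -- Phase estimation: 2r for the count, 2⌊r/2⌋ for the search and 1 for the phase. Reflections: at
  -- most r for the checks and 4r for driving.
  refine Proc.Bounded.mono (P := 1 + 2 * (r / 2) + 2 * r) (A := 5 * r)
    (.hadamards _ (.block _ _ _ fun o => ?_)) (by omega) le_rfl
  cases o
  · exact (check_bounded ph ρ a φa b (upperHalf r)).mono le_rfl (by omega)
  · exact (advance_bounded ph ρ a φa b).mono le_rfl (by omega)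

variable {V : ℝ → Matrix.unitaryGroup (Fin d) ℂ} {ρ Δ φ φ' γ : ℝ} {ph : Λ → ℝ} {ψ χ : Ket d}
  (O : Oracles V ρ Δ ph E F)

/-- The qubits contribute |⟨1|H|1⟩|² = 1/2. This puts the overlap into the range needed in
`defectSq_drive_le`. -/
lemma norm_inner_ketMinus_sq (ψ χ : Ket d) :
    ‖inner ℂ (ketMinus ψ) (ketOne χ)‖ ^ 2 = overlap ψ χ / 2 := by
  have h1 : (WithLp.toLp 2 fun j => ketMinus ψ (j, true) : Ket d) = hadamard true true • ψ := by
    ext j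
    simp [ketMinus_apply]
  rw [norm_inner_symm, inner_ketOne, h1, inner_smul_right, norm_mul, mul_pow, norm_hadamard_sq,
    norm_inner_symm, overlap]
  ring

lemma overlap_le_one (hψ : ‖ψ‖ = 1) (hχ : ‖χ‖ = 1) : overlap ψ χ ≤ 1 := by
  have := norm_inner_le_norm (𝕜 := ℂ) ψ χ
  rw [hψ, hχ, one_mul] at this
  exact pow_le_one₀ (norm_nonneg _) this

section Keep

open Classical in
lemma slice_keep {Z : Type} [Fintype Z] {f : Qubits r × (Fin n → Λ) → Z} {o : Z} (i : Fin r)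
    (hf : ∀ w w' l, f (w, l) = f (w', l)) (v : Basis d r (Qubits r) Λ E F n m → ℂ)
    (x : Basis d r (Qubits r) Λ E F n m) :
    slice i (keep f o v) x = if f (x.2.1, x.2.2.1) = o then slice i v x else 0 := by
  ext y
  rw [slice_apply]
  have : f ((setL i x y).2.1, (setL i x y).2.2.1) = f (x.2.1, x.2.2.1) := hf _ _ _
  simp only [keep, this]
  split_ifs <;> rfl

lemma At.keep {Z : Type} [Fintype Z] {f : Qubits r × (Fin n → Λ) → Z} (o : Z) {i : Fin r}
    {K : Submodule ℂ (Loc d)} {v : Basis d r (Qubits r) Λ E F n m → ℂ} (hv : At i K v)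
    (hf : ∀ w w' l, f (w, l) = f (w', l)) : At i K (keep f o v) := fun x => by
  rw [slice_keep i hf]
  split_ifs
  · exact hv x
  · exact K.zero_mem

lemma Ready.keep {Z : Type} [Fintype Z] (f : Qubits r × (Fin n → Λ) → Z) (o : Z)
    {v : Basis d r (Qubits r) Λ E F n m → ℂ} (hv : Ready v) : Ready (keep f o v) := fun x hx => by
  rw [EigenPaths.keep, hv x hx, ite_self]

end Keep

end Step

/-! ### Advancing to the target state when the overlap is large -/

section StepCorrect

variable {d r : ℕ} [NeZero r] {Λ E F : Type} [Fintype Λ] [DecidableEq Λ]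
  [Fintype E] [DecidableEq E] [Fintype F] [DecidableEq F] {n m : ℕ}

/-- The situation of one step from `a` to `b`. -/
structure Stepping (V : ℝ → Matrix.unitaryGroup (Fin d) ℂ) (ρ Δ γ : ℝ) (ψ χ : Ket d)
    (φa b φχ : ℝ) (a : ℝ) (φ : ℝ) : Prop where
  source : IsGapped (V a).1 φ ψ Δ
  target : IsGapped (V b).1 φχ χ Δ
  phase : angDist φa φ < Δ / 4
  res_pos : 0 < ρ
  res_le : 8 * ρ ≤ Δ
  gamma_pos : 0 < γ
  gamma_le : γ ≤ 1 / 12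

variable {V : ℝ → Matrix.unitaryGroup (Fin d) ℂ} {ρ Δ φ φχ γ a φa b e : ℝ} {ph : Λ → ℝ}
  {ψ χ : Ket d} (O : Oracles V ρ Δ ph E F)

section Good

variable (H : Stepping V ρ Δ γ ψ χ φa b φχ a φ) (hp : 1 - 3 * γ < overlap ψ χ)

include H hp

lemma Stepping.two_thirds_le : 2 / 3 ≤ ‖inner ℂ χ ψ‖ ^ 2 := by
  have := H.gamma_le
  rw [norm_inner_symm]
  rw [overlap] at hp
  linarith

/-- System `i` is at χ, so its estimate is within ρ ≤ Δ/8 of `φχ`: accurate enough for the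
reflections at `b` and for the report. Driving r systems with 4r reflections leaves 4^r (2/3)^(4r) =
(64/81)^r. Estimates farther than ρ have amplitude zero. -/
theorem defectSq_finish_le (hist : List ℕ)
    {tab : Fin n → Matrix (Fin d × (Λ × E)) (Fin d × (Λ × E)) ℂ} (htab : UnitaryTab tab) (q : ℕ)
    {v : Basis d r (Qubits r) Λ E F n m → ℂ} (hv : Ready v)
    (hv' : ∀ i, At i (span2 (ketMinus ψ) (ketOne χ)) v) (i : Fin r)
    (hi : At i (Submodule.span ℂ {ketOne χ}) v) :
    defectSq O (stepTarget ψ χ φχ γ Δ) (finish ph a φa b i) hist tab q m v ≤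
      (64 / 81) ^ r * normSq v := by
  rw [finish, defectSq_phaseEst, defectSq_measureTo]
  set P := O.pe hist n b
  set u := applyPE P.mat P.init i (fun _ => true) v with hu
  obtain ⟨hact, hfar⟩ := hi.act_ketOne P H.target
  have hns : normSq u = normSq v := P.normSq_act i v
  rw [← hns, ← sum_normSq_keep (fun x : Qubits r × (Fin (n + 1) → Λ) => x.2 (Fin.last n)) u,
    Finset.mul_sum]
  refine Finset.sum_le_sum fun l _ => ?_
  have htab' := htab.snoc P.unitary
  by_cases hl : angDist (ph l) φχ ≤ ρ
  · have hδ := H.res_le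
    have hδ' := H.res_pos
    have hS : ∀ (m : ℕ) (v : Basis d r (Qubits r) Λ E F (n + 1) m → ℂ), Ready v →
        (∀ i, At i (Submodule.span ℂ {ketOne χ}) v) →
        v ∈ stepTarget ψ χ φχ γ Δ (n + 1) m (q + 1) (some (ph l)) := by
      intro m v h1 h2
      rw [stepTarget, if_pos ⟨by linarith, hp⟩]
      exact ⟨h1, h2⟩
    have h1 : Driving (ketMinus ψ) (ketOne χ) (List.finRange r)
        (keep (fun x : Qubits r × (Fin (n + 1) → Λ) => x.2 (Fin.last n)) l u) := by
      refine ⟨(hv.act P i).keep _ _, fun j _ => ?_, fun j hj => absurd (List.mem_finRange j) hj⟩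
      refine At.keep _ ?_ fun _ _ _ => rfl
      by_cases hj : j = i
      · subst hj
        exact hact.mono (Submodule.span_mono (by simp))
      · exact (hv' j).act_ne P hj
    have h2 := (defectSq_drive_le O (stepTarget ψ χ φχ γ Δ) (a := a) (b := b) (abort := none)
      H.source H.phase H.target (φb := ph l)
      (by linarith) (by rw [norm_inner_ketMinus_sq]; linarith [H.gamma_le])
      (by rw [norm_inner_ketMinus_sq]
          linarith [overlap_le_one H.source.norm_eq H.target.norm_eq])
      htab' hS (4 * r) (List.finRange r) m ((Fintype.equivFin Λ l).1 :: hist) _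
      (List.nodup_finRange r) h1).1
    refine h2.trans (le_of_eq ?_)
    rw [List.length_finRange, pow_mul, ← mul_pow]
    norm_num
  · have h0 : keep (fun x : Qubits r × (Fin (n + 1) → Λ) => x.2 (Fin.last n)) l u = 0 := by
      funext x
      obtain ⟨x, z, rfl⟩ := exists_addReg x
      rw [keep]
      split_ifs with hz
      · refine hfar x z ?_
        have : z.1 = l := by rw [← hz]; exact (Fin.snoc_last (α := fun _ => Λ) z.1 x.2.2.1).symm
        rw [this]
        exact not_le.1 hl
      · rfl
    have h2 := defectSq_le_normSq O (stepTarget ψ χ φχ γ Δ)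
      ((Fintype.equivFin Λ l).1 :: hist) _ (q + 1) htab'
      (drive a φa b (ph l) (some (ph l)) none (4 * r) (List.finRange r))
      (keep (fun x : Qubits r × (Fin (n + 1) → Λ) => x.2 (Fin.last n)) l u)
    refine h2.trans ?_
    rw [h0, normSq_zero, mul_zero]

/-- Three sources of error: a missing majority (at most 2e²), no marked system (e²), and incomplete
driving (e²). The amplitudes √2 e for the first and √2 e for the other two add, and (2√2 e)² = 8e².
Only the first half has to be at A exactly; the others need only be in the plane of A and B. -/
theorem defectSq_advance_le (he1 : (17 / 18) ^ (r / 2) ≤ e ^ 2)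
    (he2 : (2 / 3) ^ (r / 2) ≤ e ^ 2) (he3 : (64 / 81) ^ r ≤ e ^ 2) (hist : List ℕ)
    {tab : Fin n → Matrix (Fin d × (Λ × E)) (Fin d × (Λ × E)) ℂ} (htab : UnitaryTab tab) (q : ℕ)
    {v : Basis d r (Qubits r) Λ E F n m → ℂ} (hv : Ready v)
    (hv' : ∀ i, At i (span2 (ketMinus ψ) (ketOne χ)) v)
    (hvA : ∀ j < r / 2, At (cp r j) (Submodule.span ℂ {ketMinus ψ}) v) :
    defectSq O (stepTarget ψ χ φχ γ Δ) (advance ph ρ a φa b) hist tab q m v ≤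
      8 * e ^ 2 * normSq v := by
  classical
  set P : ℕ → PhaseEstimation (V b).1 ρ ph E := fun j => O.pe hist (n + j) b
  have hψ := H.source.norm_eq
  have hp' := H.two_thirds_le hp
  have hρ : 2 * ρ < Δ := by linarith [H.res_le, H.res_pos]
  have hh : r / 2 ≤ r := Nat.div_le_self _ _
  set u : Option (Fin r) → Basis d r (Qubits r) Λ E F n m → ℂ := fun o =>
    compo (ketOne χ) (r / 2) (fun b => decide (first (r := r) (r / 2) b = o)) v with hu
  have h1 := defect_block_le O (stepTarget ψ χ φχ γ Δ) b (r / 2)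
    (fun x => first (r / 2) (hits ρ (r / 2) (r / 2) (wv x.1) (yv ph n x.2)))
    (fun o => match o with
      | none => .done none
      | some i => finish ph a φa b i) hist htab q v u
    (B := fun o => match o with
      | none => normSq (u none)
      | some i => (64 / 81) ^ r * normSq (u (some i))) (by
      intro o hist' tab' q' ι htab'
      cases o with
      | none =>
        dsimp only
        rw [← normSq_pad ι (r / 2) (u none)]
        exact defectSq_le_normSq O _ _ _ _ htab' _ _
      | some i =>
        dsimp only
        rw [← normSq_pad ι (r / 2) (u (some i))]
        refine defectSq_finish_le O H hp hist' htab' q' (hv.compo.pad _ _) (fun k => ?_) i ?_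
        · exact ((hv' k).compo fun w _ => pr_mem right_mem_span2 w).pad _ _
        · by_cases hi : (i : ℕ) < r / 2
          · have := At.compo_span (B := ketOne χ) (v := v)
              (G := fun b => decide (first (r := r) (r / 2) b = some i)) hi hh
              (fun b hb => (first_eq_some hh (of_decide_eq_true hb)).2)
            rw [cp_val] at this
            exact this.pad _ _
          · have h0 : (fun b => decide (first (r := r) (r / 2) b = some i)) = fun _ => false := by
              funext b
              rw [decide_eq_false_iff_not]
              exact fun hb => hi (first_eq_some hh hb).1
            have : u (some i) = 0 := by
              simp only [hu]
              rw [h0, compo_false]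
            change At i _ (pad ι (r / 2) (u (some i)))
            rw [this]
            exact At.zero.pad _ _)
  have h2 := sum_normSq_keep_sub_le P H.target H.res_pos H.res_le hψ hp' (le_refl (r / 2)) hh hvA
    (first (r := r) (r / 2))
  have h3 := normSq_compo_first_le P H.target hρ hψ hp' hh hvA
  have h4 := sum_normSq_compo P H.target hρ hh (first (r := r) (r / 2)) v
  have hN := normSq_nonneg v
  rw [← defect_sq]
  have hB : ∑ o : Option (Fin r), (match o with
      | none => normSq (u none)
      | some i => (64 / 81) ^ r * normSq (u (some i))) ≤ 2 * e ^ 2 * normSq v := by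
    rw [Fintype.sum_option]
    rw [Fintype.sum_option] at h4
    dsimp only
    rw [← Finset.mul_sum]
    have h5 : normSq (u none) ≤ e ^ 2 * normSq v :=
      h3.trans (mul_le_mul_of_nonneg_right he2 hN)
    have h6 : ∑ i, normSq (u (some i)) ≤ normSq v := by
      rw [← h4]
      have := normSq_nonneg (u none)
      simp only [hu] at this ⊢
      linarith
    have h7 : (64 / 81) ^ r * ∑ i, normSq (u (some i)) ≤ e ^ 2 * normSq v :=
      mul_le_mul he3 h6 (Finset.sum_nonneg fun i _ => normSq_nonneg _) (sq_nonneg e)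
    linarith
  have h8 : ∑ o, normSq (keep (fun x => first (r / 2) (hits ρ (r / 2) (r / 2) (wv x.1)
      (yv ph n x.2))) o (chain P (r / 2) v) - chain P (r / 2) (u o)) ≤ 2 * e ^ 2 * normSq v :=
    h2.trans (mul_le_mul_of_nonneg_right (mul_le_mul_of_nonneg_left he1 zero_le_two) hN)
  have h9 := h1.trans (add_le_add (Real.sqrt_le_sqrt h8) (Real.sqrt_le_sqrt hB))
  refine (pow_le_pow_left₀ (defect_nonneg _ _ _ _ _ _ _) h9 2).trans (le_of_eq ?_)
  rw [← two_mul, mul_pow, Real.sq_sqrt (by positivity)]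
  ring

end Good

end StepCorrect

/-! ### Checking that the systems are still at the source state -/

section Check

variable {d r : ℕ} [NeZero r] {Λ E F : Type} [Fintype Λ] [DecidableEq Λ]
  [Fintype E] [DecidableEq E] [Fintype F] [DecidableEq F] {n m : ℕ}
  {V : ℝ → Matrix.unitaryGroup (Fin d) ℂ} {ρ Δ φ φχ γ a φa b e : ℝ} {ph : Λ → ℝ}
  {ψ χ : Ket d} (O : Oracles V ρ Δ ph E F)

lemma hadOp_ketMinus (ψ : Ket d) : hadOp d (ketMinus ψ) = ketOne ψ := hadOp_hadOp _

lemma defectSq_check_nil (hp : overlap ψ χ ≤ 1 - γ) (hist : List ℕ)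
    (tab : Fin n → Matrix (Fin d × (Λ × E)) (Fin d × (Λ × E)) ℂ) (q : ℕ)
    {v : Basis d r (Qubits r) Λ E F n m → ℂ} (hv : Ready v)
    (hvA : ∀ i, At i (Submodule.span ℂ {ketMinus ψ}) v) :
    defectSq O (stepTarget ψ χ φχ γ Δ) (check ph ρ a φa b []) hist tab q m v = 0 := by
  rw [check, defectSq_hadamards, defectSq_done, resid_eq_zero, zero_pow two_ne_zero]
  simp only [stepTarget, if_pos hp]
  exact ⟨hv.hadList _, At.hadList (hadOp_ketMinus ψ) (List.nodup_finRange r) (fun i _ => hvA i)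
    fun i hi => absurd (List.mem_finRange i) hi⟩

lemma defectSq_eq_zero_of_normSq (S : Target d r (Qubits r) Λ E F (Option ℝ))
    (hist : List ℕ) {tab : Fin n → Matrix (Fin d × (Λ × E)) (Fin d × (Λ × E)) ℂ}
    (htab : UnitaryTab tab) (q : ℕ) (p : Proc r (Qubits r) Λ (Option ℝ) n)
    {v : Basis d r (Qubits r) Λ E F n m → ℂ} (hv : normSq v = 0) :
    defectSq O S p hist tab q m v = 0 :=
  le_antisymm ((defectSq_le_normSq O S hist tab q htab p v).trans hv.le)
    (defectSq_nonneg O S hist tab q p v)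

/-- Systems at A pass every check with certainty, and the Hadamard gates restore the qubits. -/
theorem defectSq_check_eq_zero (H : Stepping V ρ Δ γ ψ χ φa b φχ a φ)
    (hp : overlap ψ χ ≤ 1 - γ) (hist : List ℕ)
    {tab : Fin n → Matrix (Fin d × (Λ × E)) (Fin d × (Λ × E)) ℂ} (htab : UnitaryTab tab) (q : ℕ)
    (L : List (Fin r)) {v : Basis d r (Qubits r) Λ E F n m → ℂ} (hv : Ready v)
    (hvA : ∀ i, At i (Submodule.span ℂ {ketMinus ψ}) v) :
    defectSq O (stepTarget ψ χ φχ γ Δ) (check ph ρ a φa b L) hist tab q m v = 0 := by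
  induction L generalizing m hist v with
  | nil => exact defectSq_check_nil O hp hist tab q hv hvA
  | cons i L ih =>
    obtain ⟨ι, hist₁, hist₂, h1⟩ := defectSq_projMinus O (stepTarget ψ χ φχ γ Δ) H.source H.phase
      i (fun ok => if ok then check ph ρ a φa b L else advance ph ρ a φa b) hist tab q hv
    have hA : ‖ketMinus ψ‖ = 1 := (norm_ketMinus ψ).trans H.source.norm_eq
    have h2 : tloc i (pr (ketMinus ψ)) v = v := by
      have := tloc_congr i (T := pr (ketMinus ψ)) (T' := LinearMap.id) (hvA i) fun u hu => by
        obtain ⟨c, rfl⟩ := Submodule.mem_span_singleton.1 hu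
        rw [map_smul, pr_apply, inner_self_of_unit hA, one_smul, LinearMap.id_apply]
      rw [this, tloc_id]
    rw [check, h1, h2, sub_self, if_pos rfl,
      ih _ (hv.adjEnv _) fun i => (hvA i).adjEnv _,
      defectSq_eq_zero_of_normSq O _ _ htab _ _ (by rw [normSq_adjEnv, normSq_zero]), add_zero]

/-- Each check splits the state orthogonally, so the relative bound 8e² of `defectSq_advance_le`
does not accumulate. If all checks pass, every system is at A, and failure is a permitted report. If
one fails, the unchecked first half is still at A for the search. -/
theorem defectSq_check_le (H : Stepping V ρ Δ γ ψ χ φa b φχ a φ)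
    (hp : 1 - 3 * γ < overlap ψ χ) (hp' : overlap ψ χ ≤ 1 - γ)
    (he1 : (17 / 18) ^ (r / 2) ≤ e ^ 2) (he2 : (2 / 3) ^ (r / 2) ≤ e ^ 2)
    (he3 : (64 / 81) ^ r ≤ e ^ 2) (hist : List ℕ)
    {tab : Fin n → Matrix (Fin d × (Λ × E)) (Fin d × (Λ × E)) ℂ} (htab : UnitaryTab tab) (q : ℕ)
    (L : List (Fin r)) (hL : ∀ i ∈ L, r / 2 ≤ (i : ℕ))
    {v : Basis d r (Qubits r) Λ E F n m → ℂ} (hv : Ready v)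
    (hv' : ∀ i, At i (span2 (ketMinus ψ) (ketOne χ)) v)
    (hvA : ∀ i ∉ L, At i (Submodule.span ℂ {ketMinus ψ}) v) :
    defectSq O (stepTarget ψ χ φχ γ Δ) (check ph ρ a φa b L) hist tab q m v ≤
      8 * e ^ 2 * normSq v := by
  induction L generalizing m hist v with
  | nil =>
    rw [defectSq_check_nil O hp' hist tab q hv fun i => hvA i (by simp)]
    have := normSq_nonneg v
    positivity
  | cons i L ih =>
    obtain ⟨ι, hist₁, hist₂, h1⟩ := defectSq_projMinus O (stepTarget ψ χ φχ γ Δ) H.source H.phase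
      i (fun ok => if ok then check ph ρ a φa b L else advance ph ρ a φa b) hist tab q hv
    have hA : ‖ketMinus ψ‖ = 1 := (norm_ketMinus ψ).trans H.source.norm_eq
    have hP : ∀ k, At k (span2 (ketMinus ψ) (ketOne χ)) (tloc i (pr (ketMinus ψ)) v) := fun k => by
      by_cases hk : i = k
      · subst hk
        exact (hv' i).tloc fun u _ => pr_mem left_mem_span2 u
      · exact (hv' k).tloc_ne hk _
    have h2 := ih (hist := hist₁) (fun k hk => hL k (List.mem_cons_of_mem _ hk))
      ((hv.tloc i (pr (ketMinus ψ))).adjEnv ι) (fun k => (hP k).adjEnv ι) (fun k hk => by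
        refine At.adjEnv ?_ ι
        by_cases hik : i = k
        · subst hik
          exact (hv' i).tloc fun u _ => pr_mem (Submodule.mem_span_singleton_self _) u
        · refine (hvA k ?_).tloc_ne hik _
          rw [List.mem_cons, not_or]
          exact ⟨Ne.symm hik, hk⟩)
    have h3 := defectSq_advance_le O H hp he1 he2 he3 hist₂ htab q (ph := ph)
      ((hv.sub (hv.tloc i (pr (ketMinus ψ)))).adjEnv ι)
      (fun k => ((hv' k).sub (hP k)).adjEnv ι) (fun j hj => by
        have hji : i ≠ cp r j := by
          rintro rfl
          have := hL (cp r j) (by simp)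
          rw [val_cp (by omega)] at this
          omega
        have hjL : cp r j ∉ i :: L := fun h => by
          have := hL _ h
          rw [val_cp (by omega)] at this
          omega
        exact ((hvA _ hjL).sub ((hvA _ hjL).tloc_ne hji _)).adjEnv ι)
    rw [check, h1, if_pos rfl, ← normSq_tloc_pr_add i hA v, mul_add]
    rw [normSq_adjEnv] at h2 h3
    exact add_le_add h2 h3

end Check

/-! ### The error of a step for small and for large overlap -/

section Step

variable {d r : ℕ} [NeZero r] {Λ E F : Type} [Fintype Λ] [DecidableEq Λ]
  [Fintype E] [DecidableEq E] [Fintype F] [DecidableEq F] {n m : ℕ}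
  {V : ℝ → Matrix.unitaryGroup (Fin d) ℂ} {ρ Δ φ φχ γ δ a φa b e : ℝ} {ph : Λ → ℝ}
  {ψ χ : Ket d} (O : Oracles V ρ Δ ph E F)

lemma chain_zero {U : Matrix (Fin d) (Fin d) ℂ} (P : ℕ → PhaseEstimation U ρ ph E) (J : ℕ) :
    chain P J (0 : Basis d r (Qubits r) Λ E F n m → ℂ) = 0 := by
  have := chain_add (P := P) J (0 : Basis d r (Qubits r) Λ E F n m → ℂ) 0
  rwa [add_zero, left_eq_add] at this

lemma enough_congr {γ : ℝ} {h r : ℕ} {b b' : ℕ → Bool} (hb : ∀ j, h ≤ j → b j = b' j) :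
    enough γ h r b = enough γ h r b' := by
  have : (Finset.Ico h r).filter (fun j => b j = true) =
      (Finset.Ico h r).filter fun j => b' j = true :=
    Finset.filter_congr fun j hj => by rw [hb j (Finset.mem_Ico.1 hj).1]
  rw [enough, enough, this]

lemma le_of_mem_upperHalf {i : Fin r} (hi : i ∈ upperHalf r) : r / 2 ≤ (i : ℕ) := by
  simpa using (List.mem_filter.1 hi).2

lemma lt_of_notMem_upperHalf {i : Fin r} (hi : i ∉ upperHalf r) : (i : ℕ) < r / 2 := by
  by_contra h
  exact hi (List.mem_filter.2 ⟨List.mem_finRange i, by simpa using h⟩)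

/-- Ideally the count always answers "no" and leaves the state alone. The part that answers "yes"
has squared norm at most e² relative to `v`. It is missing in one outcome and superfluous in the
other, which gives the error √2 e. -/
theorem defect_core_far_le (H : Stepping V ρ Δ γ ψ χ φa b φχ a φ)
    (hψ : IsDominant (V b).1 φχ ψ (1 - 4 * γ) δ) (hρδ : 4 * ρ ≤ δ) (hδ : δ < Real.pi)
    (hp : overlap ψ χ ≤ 1 - 3 * γ) (he : 0 ≤ e)
    (he4 : Real.exp (-(γ ^ 2 / 8)) ^ (r - r / 2) ≤ e ^ 2) (hist : List ℕ)
    {tab : Fin n → Matrix (Fin d × (Λ × E)) (Fin d × (Λ × E)) ℂ} (htab : UnitaryTab tab) (q : ℕ)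
    {v : Basis d r (Qubits r) Λ E F n m → ℂ} (hv : Ready v)
    (hvA : ∀ i, At i (Submodule.span ℂ {ketMinus ψ}) v) :
    defect O (stepTarget ψ χ φχ γ Δ) (core ph ρ γ a φa b) hist tab q m v ≤ 6 * e * nrm v := by
  set P : ℕ → PhaseEstimation (V b).1 ρ ph E := fun j => O.pe hist (n + j) b
  have hγ := H.gamma_pos
  have hw : ∀ j x, ∑ p, ‖(P j).out ψ p‖ ^ 2 * (if angDist (ph p.2.1) x ≤ 2 * ρ then 1 else 0) ≤
      1 - 3 * γ := fun j x =>
    ((P j).sum_out_window H.target.unitary ψ x).trans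
      (norm_phaseSpace_le H.target hψ H.res_pos H.res_le hρδ hδ (by linarith)
        (by rwa [norm_inner_symm]) x)
  have h1 := defect_block_le O (stepTarget ψ χ φχ γ Δ) b r
    (fun x => enough γ (r / 2) r (hits ρ (r / 2) r (wv x.1) (yv ph n x.2)))
    (fun o => if o then advance ph ρ a φa b else check ph ρ a φa b (upperHalf r)) hist htab q v
    (fun o => if o then 0 else v) (B := fun _ => 0) (by
      intro o hist' tab' q' ι htab'
      cases o with
      | true =>
        refine (defectSq_eq_zero_of_normSq O _ _ htab' _ _ ?_).le
        rw [normSq_pad, if_pos rfl, normSq_zero]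
      | false =>
        simp only [Bool.false_eq_true, if_false]
        exact (defectSq_check_eq_zero O H (by linarith) hist' htab' q' _ (hv.pad _ _)
          fun i => (hvA i).pad _ _).le)
  have h2 := sum_enough_le (P := P) H.source.norm_eq hγ.le H.gamma_le hw
    (Nat.div_le_self r 2) (fun j _ => hvA (cp r j))
  have h3 : ∑ o : Bool, normSq (keep (fun x => enough γ (r / 2) r (hits ρ (r / 2) r (wv x.1)
      (yv ph n x.2))) o (chain P r v) - chain P r (if o then 0 else v)) ≤
      2 * (e ^ 2 * normSq v) := by
    refine le_trans (le_of_eq ?_) (mul_le_mul_of_nonneg_left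
      (h2.trans (mul_le_mul_of_nonneg_right he4 (normSq_nonneg v))) zero_le_two)
    rw [Fintype.sum_bool, if_pos rfl, if_neg (by simp), chain_zero, sub_zero, two_mul]
    unfold normSq
    congr 1 <;> refine Finset.sum_congr rfl fun x _ => ?_
    · rw [keep]
      split_ifs <;> simp
    · rw [Pi.sub_apply, keep]
      cases enough γ (r / 2) r (hits ρ (r / 2) r (wv x.2.1) (yv ph n x.2.2.1)) <;> simp
  refine h1.trans ?_
  rw [Finset.sum_const_zero, Real.sqrt_zero, add_zero]
  refine (Real.sqrt_le_sqrt h3).trans ?_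
  refine Real.sqrt_le_iff.2 ⟨mul_nonneg (by positivity) (nrm_nonneg v), ?_⟩
  rw [mul_pow, nrm_sq]
  have := mul_nonneg (sq_nonneg e) (normSq_nonneg v)
  nlinarith

/-- The ideal states `u o` result from counting exact projections onto B. The count ignores the bits
of the first half, so these systems remain at A (`At.compo_of_indep`). Replacing the actual count
costs at most 2e. The continuations contribute 8e² in total, plus e² for the outcome "no" when the
overlap exceeds 1-γ and failure is not permitted; the root is 3e. -/
theorem defect_core_near_le (H : Stepping V ρ Δ γ ψ χ φa b φχ a φ)
    (hp : 1 - 3 * γ < overlap ψ χ) (he : 0 ≤ e)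
    (he1 : (17 / 18) ^ (r / 2) ≤ e ^ 2) (he2 : (2 / 3) ^ (r / 2) ≤ e ^ 2)
    (he3 : (64 / 81) ^ r ≤ e ^ 2)
    (he4 : Real.exp (-(γ ^ 2 / 8)) ^ (r - r / 2) ≤ e ^ 2) (hist : List ℕ)
    {tab : Fin n → Matrix (Fin d × (Λ × E)) (Fin d × (Λ × E)) ℂ} (htab : UnitaryTab tab) (q : ℕ)
    {v : Basis d r (Qubits r) Λ E F n m → ℂ} (hv : Ready v)
    (hvA : ∀ i, At i (Submodule.span ℂ {ketMinus ψ}) v) :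
    defect O (stepTarget ψ χ φχ γ Δ) (core ph ρ γ a φa b) hist tab q m v ≤ 6 * e * nrm v := by
  set P : ℕ → PhaseEstimation (V b).1 ρ ph E := fun j => O.pe hist (n + j) b
  have hψ := H.source.norm_eq
  have hp' := H.two_thirds_le hp
  have hρ : 2 * ρ < Δ := by linarith [H.res_le, H.res_pos]
  have hh : r / 2 ≤ r := Nat.div_le_self _ _
  have hN := normSq_nonneg v
  set u : Bool → Basis d r (Qubits r) Λ E F n m → ℂ := fun o =>
    compo (ketOne χ) r (fun b => decide (enough γ (r / 2) r b = o)) v with hu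
  have hu1 : ∀ o, Ready (u o) := fun o => hv.compo
  have hu2 : ∀ o i, At i (span2 (ketMinus ψ) (ketOne χ)) (u o) := fun o i =>
    ((hvA i).mono (Submodule.span_mono (by simp))).compo fun w _ => pr_mem right_mem_span2 w
  have hu3 : ∀ o j, j < r / 2 → At (cp r j) (Submodule.span ℂ {ketMinus ψ}) (u o) := fun o j hj =>
    At.compo_of_indep (hj.trans_le hh) le_rfl (fun b c => by
      have : enough γ (r / 2) r (Function.update b j c) = enough γ (r / 2) r b :=
        enough_congr fun k hk => Function.update_of_ne (by omega) _ _
      rw [this]) (hvA _)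
  have hfalse : 1 - γ < overlap ψ χ → normSq (u false) ≤ e ^ 2 * normSq v := fun h =>
    (normSq_compo_enough_le P H.target hρ hψ H.gamma_pos.le H.gamma_le
      (by rw [norm_inner_symm]; exact h.le) hh (fun j _ => hvA (cp r j))).trans
      (mul_le_mul_of_nonneg_right he4 hN)
  have h1 := defect_block_le O (stepTarget ψ χ φχ γ Δ) b r
    (fun x => enough γ (r / 2) r (hits ρ (r / 2) r (wv x.1) (yv ph n x.2)))
    (fun o => if o then advance ph ρ a φa b else check ph ρ a φa b (upperHalf r)) hist htab q v
    u (B := fun o => 8 * e ^ 2 * normSq (u o) + if o then 0 else e ^ 2 * normSq v) (by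
      intro o hist' tab' q' ι htab'
      rw [← normSq_pad ι r (u o)]
      cases o with
      | true =>
        simp only [if_true, add_zero]
        exact defectSq_advance_le O H hp he1 he2 he3 hist' htab' q' ((hu1 _).pad _ _)
          (fun i => (hu2 _ i).pad _ _) fun j hj => (hu3 _ j hj).pad _ _
      | false =>
        simp only [Bool.false_eq_true, if_false]
        by_cases hγ : overlap ψ χ ≤ 1 - γ
        · refine (defectSq_check_le O H hp hγ he1 he2 he3 hist' htab' q' _
            (fun i => le_of_mem_upperHalf) ((hu1 _).pad _ _)
            (fun i => (hu2 _ i).pad _ _) fun i hi => ?_).trans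
            (le_add_of_nonneg_right (by positivity))
          have := hu3 false i (lt_of_notMem_upperHalf hi)
          rw [cp_val] at this
          exact this.pad _ _
        · refine (defectSq_le_normSq O _ hist' tab' q' htab' _ _).trans ?_
          have h0 := normSq_nonneg (pad ι r (u false))
          rw [normSq_pad] at h0 ⊢
          exact (hfalse (not_le.1 hγ)).trans (le_add_of_nonneg_left (by positivity)))
  have h2 := sum_normSq_keep_sub_le P H.target H.res_pos H.res_le hψ hp' hh le_rfl
    (fun j _ => hvA (cp r j)) (enough γ (r / 2) r)
  have h4 := sum_normSq_compo P H.target hρ le_rfl (enough γ (r / 2) r) v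
  have h5 : ∑ o : Bool, (8 * e ^ 2 * normSq (u o) + if o then 0 else e ^ 2 * normSq v) =
      (3 * (e * nrm v)) ^ 2 := by
    rw [Finset.sum_add_distrib, ← Finset.mul_sum, h4, Fintype.sum_bool, if_pos rfl,
      if_neg (by simp), mul_pow, mul_pow, nrm_sq]
    ring
  have h6 : ∑ o, normSq (keep (fun x => enough γ (r / 2) r (hits ρ (r / 2) r (wv x.1)
      (yv ph n x.2))) o (chain P r v) - chain P r (u o)) ≤ (2 * (e * nrm v)) ^ 2 := by
    refine h2.trans ?_
    rw [mul_pow, mul_pow, nrm_sq]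
    have := mul_le_mul_of_nonneg_right he1 hN
    have := mul_nonneg (sq_nonneg e) hN
    linarith
  have hen := mul_nonneg he (nrm_nonneg v)
  refine h1.trans ?_
  rw [h5, Real.sqrt_sq (by positivity)]
  have := Real.sqrt_le_sqrt h6
  rw [Real.sqrt_sq (by positivity)] at this
  linarith

end Step

/-! ### From conditions on single systems to product states -/

section Copies

variable {d r : ℕ} {Λ E F : Type} [Fintype Λ] [DecidableEq Λ]
  [Fintype E] [DecidableEq E] [Fintype F] [DecidableEq F] {n m : ℕ}

/-- The dependence on system `i` is proportional to χ. Cross-multiplication expresses this without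
division. -/
lemma At.exchange {χ : Ket d} {i : Fin r} {v : Basis d r (Qubits r) Λ E F n m → ℂ}
    (hv : At i (Submodule.span ℂ {ketOne χ}) v) (x : Basis d r (Qubits r) Λ E F n m) (y : Fin d) :
    v x * χ y = χ (x.1 i) * v (Function.update x.1 i y, x.2) := by
  obtain ⟨k, hk⟩ := Submodule.mem_span_singleton.1 (hv x)
  have h1 : ∀ z b, k * (if b = true then χ z else 0) = v (setL i x (z, b)) := fun z b => by
    rw [← slice_apply i v x (z, b), ← hk]; rfl
  have h2 := h1 (x.1 i) (x.2.1 (some i))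
  have h3 := h1 y (x.2.1 (some i))
  rw [(lens_setL i).up_get x] at h2
  have h4 : setL i x (y, x.2.1 (some i)) = (Function.update x.1 i y, x.2) := by simp [setL]
  rw [h4] at h3
  rw [← h2, ← h3]
  split_ifs <;> ring

theorem isCopies_of_mem {χ : Ket d} (hχ : ‖χ‖ = 1) {v : Basis d r (Qubits r) Λ E F n m → ℂ}
    (hv : v ∈ copies χ) : IsCopies χ v := by
  obtain ⟨y, hy⟩ : ∃ y, χ y ≠ 0 := by
    by_contra! h
    have : χ = 0 := by ext y; exact h y
    rw [this, norm_zero] at hχ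
    exact zero_ne_one hχ
  -- The coordinates of all systems are moved one at a time to a fixed `y` with χ y ≠ 0; finally all
  -- powers of χ y are divided out.
  have key : ∀ (s : Finset (Fin r)) (c : Fin r → Fin d) x, v (c, x) * χ y ^ s.card =
      (∏ i ∈ s, χ (c i)) * v (s.piecewise (fun _ => y) c, x) := by
    intro s
    induction s using Finset.induction_on with
    | empty => intro c x; simp
    | insert j s hj ih =>
      intro c x
      have h1 := (hv.2 j).exchange (s.piecewise (fun _ => y) c, x) y
      rw [Finset.card_insert_of_notMem hj, pow_succ, ← mul_assoc, ih, mul_assoc, h1,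
        Finset.prod_insert hj, Finset.piecewise_insert]
      simp only [Finset.piecewise_eq_of_notMem _ _ _ hj]
      ring
  refine ⟨fun x => v (fun _ => y, x) / χ y ^ r, fun c x => ?_⟩
  have h1 := key Finset.univ c x
  rw [Finset.card_univ, Fintype.card_fin, Finset.piecewise_univ] at h1
  rw [mul_div_assoc', eq_div_iff (pow_ne_zero _ hy), h1]

/-- The initial state of the qubits. -/
def qubitsStart (r : ℕ) : Qubits r := fun k => k.isSome

lemma startState_mem (ψ : Ket d) :
    (startState ψ (qubitsStart r) : Basis d r (Qubits r) Λ E F 0 0 → ℂ) ∈ copies ψ := by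
  refine ⟨fun x hx => ?_, fun i x => ?_⟩
  · refine if_neg fun h => ?_
    rw [h] at hx
    exact Bool.false_ne_true hx
  · refine Submodule.mem_span_singleton.2
      ⟨(if Function.update x.2.1 (some i) true = qubitsStart r then
        ∏ j ∈ Finset.univ.erase i, ψ (x.1 j) else 0), ?_⟩
    ext ⟨y, b⟩
    rw [slice_apply]
    simp only [startState, setL, ketOne, PiLp.smul_apply, smul_eq_mul]
    have h1 : ∏ j, ψ (Function.update x.1 i y j) = ψ y * ∏ j ∈ Finset.univ.erase i, ψ (x.1 j) := by
      rw [← Finset.mul_prod_erase _ _ (Finset.mem_univ i), Function.update_self]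
      congr 1
      refine Finset.prod_congr rfl fun j hj => ?_
      rw [Function.update_of_ne (Finset.ne_of_mem_erase hj)]
    cases b with
    | true => rw [h1]; simp only [if_true]; split_ifs <;> ring
    | false =>
      have h2 : Function.update x.2.1 (some i) false ≠ qubitsStart r := fun h => by
        have := congrFun h (some i)
        simp [qubitsStart] at this
      simp [h2]

lemma normSq_startState {ψ : Ket d} (hψ : ‖ψ‖ = 1) :
    normSq (startState ψ (qubitsStart r) : Basis d r (Qubits r) Λ E F 0 0 → ℂ) = 1 := by
  rw [EuclideanSpace.norm_eq, Real.sqrt_eq_one] at hψ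
  have h1 : ∏ _i : Fin r, ∑ c, ‖ψ c‖ ^ 2 = 1 := by simp [hψ]
  rw [← h1, Finset.prod_univ_sum, normSq, Fintype.sum_prod_type, Fintype.piFinset_univ]
  refine Finset.sum_congr rfl fun c _ => ?_
  rw [Fintype.sum_prod_type, Finset.sum_eq_single (qubitsStart r)]
  · rw [Fintype.sum_eq_single (default : (Fin 0 → Λ) × (Fin 0 → E) × (Fin 0 → F))
      fun x hx => absurd (Subsingleton.elim x default) hx]
    simp [startState, norm_prod, Finset.prod_pow]
  · intro w _ hw
    refine Finset.sum_eq_zero fun x _ => ?_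
    simp [startState, hw]
  · simp

end Copies

/-! ### Averages from bounds that hold in every run -/

section Cost

variable {d r : ℕ} {W Λ E F β : Type} [Fintype W] [Fintype Λ] [Fintype E] [Fintype F]

/-- A function bounded by a constant wherever the weight is nonzero has average at most that
constant, as the weights sum to at most 1. The weights may be probabilities or squared norms of an
error-free part. -/
lemma CostAtMost.of_le {runs : List (Run d r W Λ E F β)} {wt : Run d r W Λ E F β → ℝ}
    {P A B : ℝ} (h0 : ∀ R ∈ runs, 0 ≤ wt R) (h1 : (runs.map wt).sum ≤ 1)
    (h : ∀ R ∈ runs, wt R ≠ 0 → (R.peCount : ℝ) ≤ P ∧ (R.m : ℝ) ≤ A) (hA : 0 ≤ A) (hAB : A ≤ B) :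
    CostAtMost runs wt P A B := by
  have key : ∀ (f : ℕ → ℝ) (K : ℝ), 0 ≤ K → (∀ m : ℕ, (m : ℝ) ≤ A → f m ≤ K) →
      (runs.map fun R => wt R * f R.m).sum ≤ K := by
    intro f K hK hf
    have h2 : (runs.map fun R => wt R * f R.m).sum ≤ (runs.map fun R => wt R * K).sum := by
      refine List.sum_le_sum fun R hR => ?_
      by_cases hw : wt R = 0
      · rw [hw, zero_mul, zero_mul]
      · exact mul_le_mul_of_nonneg_left (hf _ (h R hR hw).2) (h0 R hR)
    rw [List.sum_map_mul_right] at h2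
    exact h2.trans ((mul_le_mul_of_nonneg_right h1 hK).trans_eq (one_mul K))
  refine ⟨fun R hR hw => (h R hR hw).1, key (fun m => (m : ℝ)) A hA fun m hm => hm, ?_⟩
  intro Γ hΓ _
  refine key (fun m => Γ ^ m) (Γ ^ B) (Real.rpow_nonneg (by linarith) B) fun m hm => ?_
  rw [← Real.rpow_natCast]
  exact Real.rpow_le_rpow_of_exponent_le hΓ (hm.trans hAB)

end Cost

/-! ### The one-step procedure for arbitrary numbers of systems -/

section Step

variable {d r : ℕ} {Λ E F : Type} [Fintype Λ] [DecidableEq Λ]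
  [Fintype E] [DecidableEq E] [Fintype F] [DecidableEq F] {n m : ℕ}
  {V : ℝ → Matrix.unitaryGroup (Fin d) ℂ} {ρ Δ φ φχ γ δ a φa b e : ℝ} {ph : Λ → ℝ}
  {ψ χ : Ket d} (O : Oracles V ρ Δ ph E F)

lemma exp_pow_le_of_le {γ y c : ℝ} {k : ℕ}
    (hy : 0 ≤ y) (hyc : y ≤ Real.exp (-c)) (hk : r * γ ^ 2 / 18 ≤ k * c) :
    y ^ k ≤ Real.exp (-(r * γ ^ 2 / 36)) ^ 2 := by
  refine (pow_le_pow_left₀ hy hyc k).trans ?_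
  rw [← Real.exp_nat_mul, ← Real.exp_nat_mul, Real.exp_le_exp]
  push_cast
  linarith

theorem defect_tStep_le [NeZero r] (hr : 2 ≤ r) (H : Stepping V ρ Δ γ ψ χ φa b φχ a φ)
    (hψ : IsDominant (V b).1 φχ ψ (1 - 4 * γ) δ) (hρδ : 4 * ρ ≤ δ) (hδ : δ < Real.pi)
    (hist : List ℕ)
    {tab : Fin n → Matrix (Fin d × (Λ × E)) (Fin d × (Λ × E)) ℂ} (htab : UnitaryTab tab) (q : ℕ)
    {v : Basis d r (Qubits r) Λ E F n m → ℂ} (hv : v ∈ copies ψ) :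
    defect O (stepTarget ψ χ φχ γ Δ) (tStep ph ρ γ n a b φa) hist tab q m v ≤
      6 * Real.exp (-(r * γ ^ 2 / 36)) * nrm v := by
  have hγ := H.gamma_pos
  have hγ' := H.gamma_le
  have h1 : nrm (hadList (List.finRange r) v) = nrm v := by
    rw [nrm_eq_sqrt, nrm_eq_sqrt, normSq_hadList]
  have h2 := hv.1.hadList (List.finRange r)
  have h3 : ∀ i, At i (Submodule.span ℂ {ketMinus ψ}) (hadList (List.finRange r) v) := fun i =>
    At.hadList rfl (List.nodup_finRange r) (fun i _ => hv.2 i)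
      (fun i hi => absurd (List.mem_finRange i) hi) i
  -- The floor loses most at r = 3.
  have hk : (r : ℝ) / 3 ≤ ((r / 2 : ℕ) : ℝ) := by
    have : r ≤ 3 * (r / 2) := by omega
    have : (r : ℝ) ≤ 3 * ((r / 2 : ℕ) : ℝ) := by exact_mod_cast this
    linarith
  have hr0 : (0 : ℝ) ≤ r := Nat.cast_nonneg r
  have hγ2 : γ ^ 2 ≤ 1 / 144 := by nlinarith
  have hrγ : r * γ ^ 2 ≤ r * (1 / 144) := mul_le_mul_of_nonneg_left hγ2 hr0
  have e18 : (17 / 18 : ℝ) ≤ Real.exp (-(1 / 18)) := by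
    have := Real.add_one_le_exp (-(1 / 18 : ℝ))
    linarith
  -- Here e² = exp(-rγ²/18). The first three errors decay at rates independent of γ and are far
  -- smaller, since γ² ≤ 1/144; the Chernoff error, at most exp(-rγ²/16), sets the constant.
  have he1 : (17 / 18 : ℝ) ^ (r / 2) ≤ Real.exp (-(r * γ ^ 2 / 36)) ^ 2 :=
    exp_pow_le_of_le (by norm_num) e18 (by linarith)
  have he2 : (2 / 3 : ℝ) ^ (r / 2) ≤ Real.exp (-(r * γ ^ 2 / 36)) ^ 2 :=
    exp_pow_le_of_le (by norm_num) (le_trans (by norm_num) e18) (by linarith)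
  have he3 : (64 / 81 : ℝ) ^ r ≤ Real.exp (-(r * γ ^ 2 / 36)) ^ 2 :=
    exp_pow_le_of_le (by norm_num) (le_trans (by norm_num) e18) (by linarith)
  have he4 : Real.exp (-(γ ^ 2 / 8)) ^ (r - r / 2) ≤ Real.exp (-(r * γ ^ 2 / 36)) ^ 2 := by
    refine exp_pow_le_of_le (Real.exp_nonneg _) le_rfl ?_
    have : r ≤ 2 * (r - r / 2) := by omega
    have : (r : ℝ) ≤ 2 * ((r - r / 2 : ℕ) : ℝ) := by exact_mod_cast this
    have := mul_le_mul_of_nonneg_right this (sq_nonneg γ)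
    have := mul_nonneg hr0 (sq_nonneg γ)
    linarith
  rw [tStep, defect, defectSq_hadamards, ← defect, ← h1]
  by_cases hp : overlap ψ χ ≤ 1 - 3 * γ
  · exact defect_core_far_le O H hψ hρδ hδ hp (Real.exp_nonneg _) he4 hist htab q h2 h3
  · exact defect_core_near_le O H (not_le.1 hp) (Real.exp_nonneg _) he1 he2 he3 he4 hist htab q
      h2 h3

/-- The one-step procedure. -/
def stepProc (ph : Λ → ℝ) (ρ γ : ℝ) : StepProc r (Qubits r) Λ := fun n a b φa =>
  if hr : 2 ≤ r then
    haveI : NeZero r := ⟨by omega⟩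
    tStep ph ρ γ n a b φa
  else .done none

theorem stepProc_bounded (ph : Λ → ℝ) (ρ γ a φa b : ℝ) :
    (stepProc (r := r) ph ρ γ n a b φa).Bounded (4 * r) (5 * r) := by
  rw [stepProc]
  split_ifs with hr
  · have : NeZero r := ⟨by omega⟩
    exact tStep_bounded hr ph ρ γ a φa b
  · exact .done _ _ _

theorem defect_stepProc_le (H : Stepping V ρ Δ γ ψ χ φa b φχ a φ)
    (hψ : IsDominant (V b).1 φχ ψ (1 - 4 * γ) δ) (hρδ : 4 * ρ ≤ δ) (hδ : δ < Real.pi)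
    (hist : List ℕ)
    {tab : Fin n → Matrix (Fin d × (Λ × E)) (Fin d × (Λ × E)) ℂ} (htab : UnitaryTab tab) (q : ℕ)
    {v : Basis d r (Qubits r) Λ E F n m → ℂ} (hv : v ∈ copies ψ) :
    defect O (stepTarget ψ χ φχ γ Δ) (stepProc ph ρ γ n a b φa) hist tab q m v ≤
      6 * Real.exp (-(r * γ ^ 2 / 36)) * nrm v := by
  rw [stepProc]
  split_ifs with hr
  · have : NeZero r := ⟨by omega⟩
    exact defect_tStep_le O hr H hψ hρδ hδ hist htab q hv
  -- For r ≤ 1 the claimed bound exceeds the norm of the state, so any result is admissible.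
  · refine (defect_le_nrm O _ hist tab q htab _ v).trans
      (le_mul_of_one_le_left (nrm_nonneg v) ?_)
    have h1 := Real.add_one_le_exp (-(r * γ ^ 2 / 36))
    have h2 : (r : ℝ) ≤ 1 := by exact_mod_cast (by omega : r ≤ 1)
    have h3 : γ ^ 2 ≤ 1 := by nlinarith [H.gamma_pos, H.gamma_le]
    have h4 : r * γ ^ 2 ≤ 1 := mul_le_one₀ h2 (sq_nonneg γ) h3
    linarith

/-- The error-free part consists of the projections of the final states onto the required subspaces;
these are ⊥ for reports that are not permitted. -/
theorem stepCorrect_of_defect_le {T : Proc r (Qubits r) Λ (Option ℝ) 0} (hψ : ‖ψ‖ = 1)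
    (hχ : ‖χ‖ = 1) {ε : ℝ}
    (h : defect O (stepTarget ψ χ φχ γ Δ) T [] Fin.elim0 0 0
      (startState ψ (qubitsStart r)) ≤ ε) :
    StepCorrect (T.runsOn O ψ (qubitsStart r)) ψ χ φχ γ Δ ε := by
  refine ⟨fun R => proj (stepTarget ψ χ φχ γ Δ R.n R.m R.peCount R.result) R.state, ?_, ?_⟩
  · simpa only [errorAmplitude, Proc.runsOn, defect, defectSq, resid, nrm_sq] using h
  · intro R _ hR
    have h1 := proj_mem (stepTarget ψ χ φχ γ Δ R.n R.m R.peCount R.result) R.state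
    dsimp only at hR ⊢
    generalize proj (stepTarget ψ χ φχ γ Δ R.n R.m R.peCount R.result) R.state = u at *
    cases hres : R.result with
    | none =>
      rw [hres] at h1
      simp only [stepTarget] at h1
      split_ifs at h1 with hp
      · exact Or.inl ⟨rfl, isCopies_of_mem hψ h1, hp⟩
      · exact absurd ((Submodule.mem_bot ℂ).1 h1) hR
    | some φ' =>
      rw [hres] at h1
      simp only [stepTarget] at h1
      split_ifs at h1 with hp
      · exact Or.inr ⟨φ', rfl, hp.1, isCopies_of_mem hχ h1, hp.2⟩
      · exact absurd ((Submodule.mem_bot ℂ).1 h1) hR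

lemma costAtMost_runsOn {β : Type} {T : Proc r (Qubits r) Λ β 0} (hψ : ‖ψ‖ = 1) {P A : ℕ}
    (h : T.Bounded P A) {P' A' B : ℝ} (hP : (P : ℝ) ≤ P') (hA : (A : ℝ) ≤ A') (hB : A' ≤ B) :
    CostAtMost (T.runsOn O ψ (qubitsStart r)) Run.prob P' A' B := by
  refine .of_le (fun R _ => normSq_nonneg _) ?_ (fun R hR _ => ?_)
    ((Nat.cast_nonneg A).trans hA) hB
  · have := sum_prob O T [] Fin.elim0 (fun k => k.elim0) 0 (startState ψ (qubitsStart r))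
    rw [normSq_startState hψ] at this
    exact this.le
  · have := h.runs_le O [] Fin.elim0 0 (startState ψ (qubitsStart r)) hR
    rw [zero_add, zero_add] at this
    exact ⟨le_trans (by exact_mod_cast this.1) hP, le_trans (by exact_mod_cast this.2) hA⟩

end Step

/-! ## Recursive binary subdivision -/

section Subdivide

variable {d r : ℕ} {Λ E F : Type} [Fintype Λ] [DecidableEq Λ]
  [Fintype E] [DecidableEq E] [Fintype F] [DecidableEq F] {n m : ℕ}

/-- At most `k` attempts are needed to pass from `a` through the points of the list to `1` if
attempts with overlap probability more than `1 - γ` do not fail. -/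
inductive Attempts (ψ : ℝ → Ket d) (γ : ℝ) : ℝ → List ℝ → ℕ → Prop
  | nil (k : ℕ) : Attempts ψ γ 1 [] k
  | cons {a b : ℝ} {rest : List ℝ} {k : ℕ} (ha : 0 ≤ a) (hab : a < b) (hb : b ≤ 1)
      (h : Attempts ψ γ b rest k)
      (h' : overlap (ψ a) (ψ b) ≤ 1 - γ → Attempts ψ γ a ((a + b) / 2 :: b :: rest) k) :
      Attempts ψ γ a (b :: rest) (k + 1)

lemma Attempts.mono {ψ : ℝ → Ket d} {γ a : ℝ} {l : List ℝ} {k : ℕ} (h : Attempts ψ γ a l k) :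
    ∀ {k' : ℕ}, k ≤ k' → Attempts ψ γ a l k' := by
  induction h with
  | nil k => exact fun _ => .nil _
  | cons ha hab hb _ _ ih ih' =>
    intro k' hk
    obtain ⟨k', rfl⟩ : ∃ j, k' = j + 1 := ⟨k' - 1, by omega⟩
    exact .cons ha hab hb (ih (by omega)) fun h => ih' h (by omega)

lemma Proc.Bounded.subdivide {T : StepProc r (Qubits r) Λ} {P A : ℕ}
    (hT : ∀ n a b φa, (T n a b φa).Bounded P A) (M : ℕ) (a φa : ℝ) (l : List ℝ) (n : ℕ) :
    (subdivide T M a φa l n).Bounded (P * M) (A * M) := by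
  induction M generalizing a φa l n with
  | zero => cases l <;> exact .done _ _ _
  | succ M ih =>
    cases l with
    | nil => exact .done _ _ _
    | cons b rest =>
      refine ((hT n a b φa).bind (P' := P * M) (A' := A * M) fun n' res => ?_).mono
        (by rw [mul_add, mul_one, add_comm]) (by rw [mul_add, mul_one, add_comm])
      cases res <;> exact ih _ _ _ _

open Classical in
/-- The final states required of recursive binary subdivision. -/
def endTarget (χ : Ket d) (Q A : ℕ) : Target d r (Qubits r) Λ E F Bool :=
  fun _ m q res => if res = true ∧ q ≤ Q ∧ m ≤ A then copies χ else ⊥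

variable {V : ℝ → Matrix.unitaryGroup (Fin d) ℂ} {ρ Δ γ ε : ℝ} {ph : Λ → ℝ}
  (O : Oracles V ρ Δ ph E F) {ψ : ℝ → Ket d} {φ : ℝ → ℝ}

/-- Induction along `Attempts`, with `defect_bind_le` adding ε for every step. In the error-free
part a step fails only if the overlap is at most 1-γ, which is the case that `Attempts` provides
for. The number of steps counted is `k`, whatever the limit `M`. -/
theorem defect_subdivide_le {T : StepProc r (Qubits r) Λ} {P A : ℕ} (hΔ : 0 < Δ) (hε : 0 ≤ ε)
    (hTb : ∀ n a b φa, (T n a b φa).Bounded P A)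
    (hT : ∀ (a b φa : ℝ), 0 ≤ a → a < b → b ≤ 1 → angDist φa (φ a) < Δ / 4 →
      ∀ (n m : ℕ) (hist : List ℕ) (tab : Fin n → Matrix (Fin d × (Λ × E)) (Fin d × (Λ × E)) ℂ)
        (q : ℕ) (v : Basis d r (Qubits r) Λ E F n m → ℂ), UnitaryTab tab → v ∈ copies (ψ a) →
      defect O (stepTarget (ψ a) (ψ b) (φ b) γ Δ) (T n a b φa) hist tab q m v ≤ ε * nrm v)
    {Q N : ℕ} {a : ℝ} {l : List ℝ} {k : ℕ} (h : Attempts ψ γ a l k) {M : ℕ} (hM : k ≤ M)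
    {φa : ℝ} (hφa : angDist φa (φ a) < Δ / 4) (hist : List ℕ)
    {tab : Fin n → Matrix (Fin d × (Λ × E)) (Fin d × (Λ × E)) ℂ} (htab : UnitaryTab tab) {q : ℕ}
    (hq : q + P * k ≤ Q) (hm : m + A * k ≤ N)
    {v : Basis d r (Qubits r) Λ E F n m → ℂ} (hv : v ∈ copies (ψ a)) :
    defect O (endTarget (ψ 1) Q N) (subdivide T M a φa l n) hist tab q m v ≤ k * ε * nrm v := by
  induction h generalizing M φa n m hist q with
  | nil k =>
    have h0 : subdivide T M 1 φa [] n = .done true := by cases M <;> rfl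
    rw [h0, defect, defectSq_done, resid_eq_zero, zero_pow two_ne_zero, Real.sqrt_zero]
    · exact mul_nonneg (mul_nonneg (Nat.cast_nonneg _) hε) (nrm_nonneg v)
    · rw [endTarget, if_pos ⟨rfl, by omega, by omega⟩]
      exact hv
  | @cons a b rest k ha hab hb _ _ ih ih' =>
    obtain ⟨M, rfl⟩ : ∃ j, M = j + 1 := ⟨M - 1, by omega⟩
    rw [mul_add, mul_one] at hq hm
    rw [subdivide]
    refine (defect_bind_le O (stepTarget (ψ a) (ψ b) (φ b) γ Δ) (endTarget (ψ 1) Q N)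
      (hTb n a b φa) (Q := q + P) (M := m + A) _ (ε := k * ε)
      (mul_nonneg (Nat.cast_nonneg _) hε) ?_ hist tab htab q le_rfl le_rfl v).trans ?_
    · intro n' res hist' tab' q' m' v' htab' hq' hm' hv'
      -- A report that is not permitted has no error-free part to be continued.
      have h0 : v' ∈ (⊥ : Submodule ℂ (Basis d r (Qubits r) Λ E F n' m' → ℂ)) →
          ∀ p : Proc r (Qubits r) Λ Bool n', defect O (endTarget (ψ 1) Q N) p hist' tab' q' m' v' ≤
            k * ε * nrm v' := fun h p => by
        refine (defect_le_nrm O _ hist' tab' q' htab' p v').trans (le_of_eq ?_)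
        rw [(Submodule.mem_bot ℂ).1 h, nrm_zero, mul_zero]
      cases res with
      | none =>
        simp only [stepTarget] at hv'
        split_ifs at hv' with hp
        · exact ih' hp (by omega) hφa hist' htab' (by omega) (by omega) hv'
        · exact h0 hv' _
      | some φb =>
        simp only [stepTarget] at hv'
        split_ifs at hv' with hp
        -- The reported phase is within Δ/5 < Δ/4 and can serve as input of the next step.
        · exact ih (by omega) (by linarith [hp.1]) hist' htab' (by omega) (by omega) hv'
        · exact h0 hv' _
    · have := hT a b φa ha hab hb hφa n m hist tab q v htab hv
      push_cast
      linarith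

/-- `endTarget` is ⊥ for runs that exceed the numbers of calls, so the error-free part satisfies the
cost bounds by construction, even if the procedure itself may run longer. -/
theorem exists_good_of_defect_le {T : Proc r (Qubits r) Λ Bool 0} {ψ χ : Ket d} (hψ : ‖ψ‖ = 1)
    (hχ : ‖χ‖ = 1) {Q N : ℕ}
    (h : defect O (endTarget χ Q N) T [] Fin.elim0 0 0 (startState ψ (qubitsStart r)) ≤ ε)
    {P' A' B' : ℝ} (hP : (Q : ℝ) ≤ P') (hA : (N : ℝ) ≤ A') (hB : A' ≤ B') :
    ∃ good : (R : Run d r (Qubits r) Λ E F Bool) → Basis d r (Qubits r) Λ E F R.n R.m → ℂ,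
      errorAmplitude (T.runsOn O ψ (qubitsStart r)) good ≤ ε ∧
      (∀ R ∈ T.runsOn O ψ (qubitsStart r), good R ≠ 0 → R.result = true ∧ IsCopies χ (good R)) ∧
      CostAtMost (T.runsOn O ψ (qubitsStart r)) (fun R => normSq (good R)) P' A' B' := by
  have key : ∀ R : Run d r (Qubits r) Λ E F Bool,
      proj (endTarget χ Q N R.n R.m R.peCount R.result) R.state ≠ 0 →
      (R.result = true ∧ R.peCount ≤ Q ∧ R.m ≤ N) ∧
        IsCopies χ (proj (endTarget χ Q N R.n R.m R.peCount R.result) R.state) := fun R hR => by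
    have h1 := proj_mem (endTarget χ Q N R.n R.m R.peCount R.result) R.state
    generalize proj (endTarget χ Q N R.n R.m R.peCount R.result) R.state = u at *
    simp only [endTarget] at h1
    split_ifs at h1 with hp
    · exact ⟨hp, isCopies_of_mem hχ h1⟩
    · exact absurd ((Submodule.mem_bot ℂ).1 h1) hR
  refine ⟨fun R => proj (endTarget χ Q N R.n R.m R.peCount R.result) R.state, ?_,
    fun R _ hR => ⟨(key R hR).1.1, (key R hR).2⟩,
    .of_le (fun R _ => normSq_nonneg _) ?_ (fun R _ hR => ?_) ((Nat.cast_nonneg N).trans hA) hB⟩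
  · simpa only [errorAmplitude, Proc.runsOn, defect, defectSq, resid, nrm_sq] using h
  · have h1 := sum_prob O T [] Fin.elim0 (fun k => k.elim0) 0 (startState ψ (qubitsStart r))
    rw [normSq_startState hψ] at h1
    rw [← h1]
    exact List.sum_le_sum fun R _ => normSq_proj_le _ _
  · have h1 := (key R fun h0 => hR ((congrArg normSq h0).trans normSq_zero)).1
    exact ⟨le_trans (by exact_mod_cast h1.2.1) hP, le_trans (by exact_mod_cast h1.2.2) hA⟩

end Subdivide

/-! ### Superadditivity of angular length -/

section Length

variable {d : ℕ} {ψ : ℝ → Ket d} {θ : ℝ}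

/-- Partitions of `[a, b]`. -/
abbrev Partition (a b : ℝ) :=
  {p : Σ n : ℕ, Fin (n + 1) → ℝ // StrictMono p.2 ∧ p.2 0 = a ∧ p.2 (Fin.last p.1) = b}

/-- The angular length of a polygon inscribed in the path. -/
def polygonLength (ψ : ℝ → Ket d) (p : Σ n : ℕ, Fin (n + 1) → ℝ) : ℝ≥0∞ :=
  ∑ j : Fin p.1,
    ENNReal.ofReal (Real.arccos ‖inner ℂ (ψ (p.2 j.succ)) (ψ (p.2 j.castSucc))‖)

lemma pathLength_eq (ψ : ℝ → Ket d) (a b : ℝ) :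
    pathLength ψ a b = ⨆ p : Partition a b, polygonLength ψ p.1 := by
  rw [iSup_subtype, iSup_sigma]; rfl

lemma Partition.nonempty {a b : ℝ} (h : a ≤ b) : Nonempty (Partition a b) := by
  rcases h.eq_or_lt with rfl | h
  · exact ⟨⟨⟨0, fun _ => a⟩, Subsingleton.strictMono (α := Fin 1) _, rfl, rfl⟩⟩
  · refine ⟨⟨⟨1, ![a, b]⟩, ?_, rfl, rfl⟩⟩
    intro i j hij
    fin_cases i <;> fin_cases j <;> simp_all

/-- The two partitions are concatenated, with the common point `m` listed once. -/
lemma polygonLength_add_le {a m b : ℝ} (p : Partition a m) (p' : Partition m b) :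
    polygonLength ψ p.1 + polygonLength ψ p'.1 ≤ pathLength ψ a b := by
  obtain ⟨⟨n, t⟩, ht, h0, h1⟩ := p
  obtain ⟨⟨n', t'⟩, ht', h0', h1'⟩ := p'
  change StrictMono t at ht
  change StrictMono t' at ht'
  change t 0 = a at h0
  change t (Fin.last n) = m at h1
  change t' 0 = m at h0'
  change t' (Fin.last n') = b at h1'
  set s : Fin (n + n' + 1) → ℝ := fun i =>
    if h : (i : ℕ) ≤ n then t ⟨i, by omega⟩ else t' ⟨i - n, by omega⟩ with hs
  -- At the index `n` both pieces apply and agree, as both equal `m`.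
  have hs' : ∀ i : Fin (n + n' + 1), (hi : n ≤ (i : ℕ)) → s i = t' ⟨i - n, by omega⟩ := by
    intro i hi
    simp only [hs]
    split_ifs with h
    · have : (i : ℕ) = n := le_antisymm h hi
      have e1 : (⟨i, by omega⟩ : Fin (n + 1)) = Fin.last n := Fin.ext this
      have e2 : (⟨i - n, by omega⟩ : Fin (n' + 1)) = 0 := Fin.ext (by simp [this])
      rw [e1, e2, h1, h0']
    · rfl
  have hs0 : ∀ i : Fin (n + n' + 1), (hi : (i : ℕ) ≤ n) → s i = t ⟨i, by omega⟩ := fun i hi =>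
    dif_pos hi
  have hmono : StrictMono s := by
    refine Fin.strictMono_iff_lt_succ.2 fun i => ?_
    by_cases hi : (i : ℕ) < n
    · rw [hs0 _ (by simpa using hi.le), hs0 _ (by simpa using hi)]
      exact ht (by simp [Fin.lt_def])
    · rw [hs' _ (by simpa using hi), hs' _ (by simp; omega)]
      exact ht' (by simp [Fin.lt_def]; omega)
  rw [pathLength_eq]
  refine le_trans (le_of_eq ?_) (le_iSup (fun p : Partition a b => polygonLength ψ p.1)
    ⟨⟨n + n', s⟩, hmono, ?_, ?_⟩)
  · simp only [polygonLength]
    rw [Fin.sum_univ_add]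
    congr 1
    · refine Finset.sum_congr rfl fun j _ => ?_
      rw [hs0 _ (by simp), hs0 _ (by simp)]
      rfl
    · refine Finset.sum_congr rfl fun j _ => ?_
      rw [hs' _ (by simp only [Fin.val_succ, Fin.val_natAdd]; omega), hs' _ (by simp)]
      have e1 : j.succ = (⟨((Fin.natAdd n j).succ : Fin (n + n' + 1)) - n, by
          simp only [Fin.val_succ, Fin.val_natAdd]; omega⟩ :
          Fin (n' + 1)) := Fin.ext (by
        simp only [Fin.val_succ, Fin.val_natAdd]; omega)
      have e2 : j.castSucc = (⟨((Fin.natAdd n j).castSucc : Fin (n + n' + 1)) - n, by simp⟩ :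
          Fin (n' + 1)) := Fin.ext (by simp)
      rw [e1, e2]
  · exact (hs0 0 (Nat.zero_le n)).trans h0
  · rw [← h1']
    exact (hs' (Fin.last _) (by simp)).trans (congrArg t' (Fin.ext (by simp)))

lemma pathLength_add_le {a m b : ℝ} (h : a ≤ m) (h' : m ≤ b) :
    pathLength ψ a m + pathLength ψ m b ≤ pathLength ψ a b := by
  have := Partition.nonempty h
  have := Partition.nonempty h'
  rw [pathLength_eq ψ a m, pathLength_eq ψ m b]
  exact ENNReal.iSup_add_iSup_le fun p p' => polygonLength_add_le p p'

lemma pathLength_mono {a b : ℝ} (ha : 0 ≤ a) (hab : a ≤ b) (hb : b ≤ 1) :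
    pathLength ψ a b ≤ pathLength ψ 0 1 :=
  calc pathLength ψ a b ≤ pathLength ψ 0 a + pathLength ψ a b := le_add_self
    _ ≤ pathLength ψ 0 b := pathLength_add_le ha hab
    _ ≤ pathLength ψ 0 b + pathLength ψ b 1 := le_self_add
    _ ≤ pathLength ψ 0 1 := pathLength_add_le (ha.trans hab) hb

variable (hL : pathLength ψ 0 1 ≠ ⊤)

include hL

lemma len_mono {a b : ℝ} (ha : 0 ≤ a) (hab : a ≤ b) (hb : b ≤ 1) : len ψ a b ≤ len ψ 0 1 :=
  ENNReal.toReal_mono hL (pathLength_mono ha hab hb)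

lemma len_add_le {a m b : ℝ} (ha : 0 ≤ a) (ham : a ≤ m) (hmb : m ≤ b) (hb : b ≤ 1) :
    len ψ a m + len ψ m b ≤ len ψ a b := by
  have h1 : ∀ {a b : ℝ}, 0 ≤ a → a ≤ b → b ≤ 1 → pathLength ψ a b ≠ ⊤ := fun ha hab hb =>
    ne_top_of_le_ne_top hL (pathLength_mono ha hab hb)
  rw [len, len, len, ← ENNReal.toReal_add (h1 ha ham (hmb.trans hb)) (h1 (ha.trans ham) hmb hb)]
  exact ENNReal.toReal_mono (h1 ha (ham.trans hmb) hb) (pathLength_add_le ham hmb)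

lemma arccos_le_len {a b : ℝ} (ha : 0 ≤ a) (hab : a < b) (hb : b ≤ 1) :
    Real.arccos ‖inner ℂ (ψ b) (ψ a)‖ ≤ len ψ a b := by
  have h1 : ENNReal.ofReal (Real.arccos ‖inner ℂ (ψ b) (ψ a)‖) ≤ pathLength ψ a b := by
    rw [pathLength_eq]
    refine le_trans (le_of_eq ?_) (le_iSup (fun p : Partition a b => polygonLength ψ p.1)
      ⟨⟨1, ![a, b]⟩, ?_, rfl, rfl⟩)
    · simp [polygonLength]
    · intro i j hij
      fin_cases i <;> fin_cases j <;> simp_all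
  have h2 := ENNReal.toReal_mono (ne_top_of_le_ne_top hL (pathLength_mono ha hab.le hb)) h1
  rwa [ENNReal.toReal_ofReal (Real.arccos_nonneg _)] at h2

/-- A permitted failure certifies a long interval: its end points alone are at an angle of more than
θ. -/
lemma lt_len_of_overlap_le {γ : ℝ} (hθ : θ < Real.arccos (Real.sqrt (1 - γ)))
    {a b : ℝ} (ha : 0 ≤ a) (hab : a < b) (hb : b ≤ 1) (h : overlap (ψ a) (ψ b) ≤ 1 - γ) :
    θ < len ψ a b := by
  refine hθ.trans_le (le_trans ?_ (arccos_le_len hL ha hab hb))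
  refine Real.arccos_le_arccos ?_
  rw [norm_inner_symm]
  exact Real.le_sqrt_of_sq_le h

end Length

/-! ## The number of attempts -/

section Count

variable {d : ℕ} {ψ : ℝ → Ket d} {θ γ : ℝ}

open Classical in
/-- The number of intervals of length more than `θ` among those that arise from `[a, b]` by
repeated bisection of such intervals, up to depth `N`. -/
def longCount (ψ : ℝ → Ket d) (θ : ℝ) : ℕ → ℝ → ℝ → ℕ
  | 0, _, _ => 0
  | N + 1, a, b => if θ < len ψ a b then
      longCount ψ θ N a ((a + b) / 2) + longCount ψ θ N ((a + b) / 2) b + 1 else 0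

lemma longCount_eq_zero {N : ℕ} {a b : ℝ} (h : len ψ a b ≤ θ) : longCount ψ θ N a b = 0 := by
  cases N with
  | zero => rfl
  | succ N => exact if_neg (not_lt.2 h)

lemma longCount_succ {N : ℕ} {a b : ℝ} (h : θ < len ψ a b) : longCount ψ θ (N + 1) a b =
    longCount ψ θ N a ((a + b) / 2) + longCount ψ θ N ((a + b) / 2) b + 1 := if_pos h

/-- Failing intervals are long and have two children each, so a tree with c failing nodes has at
most 2c + 1 nodes. `hN` guarantees that bisection has ended at depth `N`. -/
theorem attempts_of_longCount
    (hγ : ∀ a b : ℝ, 0 ≤ a → a < b → b ≤ 1 → overlap (ψ a) (ψ b) ≤ 1 - γ → θ < len ψ a b)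
    {N : ℕ} {a b : ℝ} (ha : 0 ≤ a) (hab : a < b) (hb : b ≤ 1)
    (hN : ∀ a' b' : ℝ, 0 ≤ a' → a' < b' → b' ≤ 1 → θ < len ψ a' b' → (b - a) / 2 ^ N < b' - a')
    {rest : List ℝ} {k : ℕ} (h : Attempts ψ γ b rest k) :
    Attempts ψ γ a (b :: rest) (2 * longCount ψ θ N a b + k + 1) := by
  induction N generalizing a b rest k with
  | zero =>
    refine .cons ha hab hb (h.mono (by omega)) fun hp => ?_
    -- At depth 0 the interval itself would have to be wider than b - a.
    have := hN a b ha hab hb (hγ a b ha hab hb hp)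
    simp at this
  | succ N ih =>
    refine .cons ha hab hb (h.mono (by omega)) fun hp => ?_
    have hN1 : (b - a) / 2 ^ (N + 1) = (b - a) / 2 / 2 ^ N := by rw [pow_succ]; field_simp
    have e1 : b - (a + b) / 2 = (b - a) / 2 := by ring
    have e2 : (a + b) / 2 - a = (b - a) / 2 := by ring
    have h1 := ih (a := (a + b) / 2) (b := b) (by linarith) (by linarith) hb
      (by rw [e1, ← hN1]; exact hN) h
    have h2 := ih (a := a) (b := (a + b) / 2) ha (by linarith) (by linarith)
      (by rw [e2, ← hN1]; exact hN) h1
    rw [longCount_succ (hγ a b ha hab hb hp)]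
    exact h2.mono (by omega)

/-- The inequality log t ≤ t - 1 at t = y/(2x), sharp if half of the length y falls into the half
interval. It serves the case of two long halves. -/
lemma mul_log_half_le {x y z : ℝ} (hx : 0 < x) (hy : 0 < y) (hz : 0 < z) :
    x * Real.log (z / 2 / x) ≤ x * Real.log (z / y) + y / 2 - x := by
  have h1 : Real.log (z / 2 / x) = Real.log (z / y) + Real.log (y / (2 * x)) := by
    rw [← Real.log_mul (by positivity) (by positivity)]
    congr 1
    field_simp
  have h2 := Real.log_le_sub_one_of_pos (x := y / (2 * x)) (by positivity)
  have h3 := mul_le_mul_of_nonneg_left h2 hx.le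
  have h4 : x * (y / (2 * x) - 1) = y / 2 - x := by field_simp
  rw [h1, mul_add]
  linarith

/-- The same at t = y/x, sharp if all of the length falls into one half. The gain x log 2 comes from
the halved width. -/
lemma mul_log_half_le' {x y z : ℝ} (hx : 0 < x) (hy : 0 < y) (hz : 0 < z) :
    x * Real.log (z / 2 / x) ≤ x * Real.log (z / y) + y - x - x * Real.log 2 := by
  have h1 : Real.log (z / 2 / x) = Real.log (z / y) + Real.log (y / x) - Real.log 2 := by
    rw [← Real.log_mul (by positivity) (by positivity), ← Real.log_div (by positivity) two_ne_zero]
    congr 1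
    field_simp
  have h2 := Real.log_le_sub_one_of_pos (x := y / x) (by positivity)
  have h3 := mul_le_mul_of_nonneg_left h2 hx.le
  have h4 : x * (y / x - 1) = y - x := by field_simp
  rw [h1, mul_sub, mul_add]
  linarith

/-- With ℓ the length and w the width of an interval, (ℓ/θ)(log(Kw/ℓ) + 3 log 2) is a potential
whose logarithm is nonnegative by `hK`. Bisection concentrates length at most until ℓ = Kw, and each
concentration by a factor 2 uses up log 2. The term 3 log 2 covers length lost to short halves and
the last long intervals; the final -log 2 pays for the joining node when both halves are long. -/
theorem longCount_le (hL : pathLength ψ 0 1 ≠ ⊤) (hθ : 0 < θ) {K : ℝ}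
    (hK : ∀ a b : ℝ, 0 ≤ a → a < b → b ≤ 1 → θ < len ψ a b → len ψ a b ≤ K * (b - a))
    (N : ℕ) {a b : ℝ} (ha : 0 ≤ a) (hab : a < b) (hb : b ≤ 1) (h : θ < len ψ a b) :
    longCount ψ θ N a b * Real.log 2 ≤
      len ψ a b / θ * (Real.log (K * (b - a) / len ψ a b) + 3 * Real.log 2) - Real.log 2 := by
  have hln := Real.log_two_gt_d9
  induction N generalizing a b with
  | zero =>
    have h0 : 0 < len ψ a b := hθ.trans h
    have h1 : 0 ≤ Real.log (K * (b - a) / len ψ a b) :=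
      Real.log_nonneg ((one_le_div h0).2 (hK a b ha hab hb h))
    have h2 : 1 ≤ len ψ a b / θ := (one_le_div hθ).2 h.le
    simp only [longCount, Nat.cast_zero, zero_mul]
    nlinarith
  | succ N ih =>
    set m := (a + b) / 2 with hm
    have h0 : 0 < len ψ a b := hθ.trans h
    set z := K * (b - a) with hz
    have hle : len ψ a b ≤ z := hK a b ha hab hb h
    have hz0 : 0 < z := h0.trans_le hle
    have hG : 0 ≤ Real.log (z / len ψ a b) := Real.log_nonneg ((one_le_div h0).2 hle)
    have hadd : len ψ a m + len ψ m b ≤ len ψ a b :=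
      len_add_le hL ha (by linarith) (by linarith) hb
    have e1 : K * (m - a) = z / 2 := by rw [hz, hm]; ring
    have e2 : K * (b - m) = z / 2 := by rw [hz, hm]; ring
    have i1 := fun h' => ih (a := a) (b := m) ha (by linarith) (by linarith) h'
    have i2 := fun h' => ih (a := m) (b := b) (by linarith) (by linarith) hb h'
    rw [e1] at i1
    rw [e2] at i2
    set G := Real.log (z / len ψ a b) with hGdef
    set l := Real.log 2 with hl
    set X := len ψ a b / θ with hX
    have scale : ∀ {x c : ℝ}, x * c / θ = x / θ * c := fun {x c} => by ring
    have b1 : ∀ {x : ℝ}, 0 < x → x / θ * Real.log (z / 2 / x) ≤ x / θ * G + X / 2 - x / θ := by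
      intro x hx
      have := div_le_div_of_nonneg_right (mul_log_half_le hx h0 hz0) hθ.le
      rw [← scale, ← scale, hX]
      refine this.trans (le_of_eq ?_)
      ring
    have b2 : ∀ {x : ℝ}, 0 < x →
        x / θ * Real.log (z / 2 / x) ≤ x / θ * G + X - x / θ - x / θ * l := by
      intro x hx
      have := div_le_div_of_nonneg_right (mul_log_half_le' hx h0 hz0) hθ.le
      rw [← scale, hX]
      refine this.trans (le_of_eq ?_)
      ring
    -- With one long half, the loss X - x/θ is covered by 3(X - x/θ) log 2, and the gain (x/θ) log 2
    -- ≥ log 2 from the halved width pays for the node.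
    have single : ∀ {x : ℝ} {c : ℝ}, θ < x → x ≤ len ψ a b →
        c ≤ x / θ * (Real.log (z / 2 / x) + 3 * l) - l → c + l ≤ X * (G + 3 * l) - l := by
      intro x c hx hx' hc
      have h1 := b2 (hθ.trans hx)
      have h2 : 1 ≤ x / θ := (one_le_div hθ).2 hx.le
      have h3 : x / θ ≤ X := div_le_div_of_nonneg_right hx' hθ.le
      nlinarith [mul_nonneg (sub_nonneg.2 h3) hG]
    have hX1 : 1 ≤ X := (one_le_div hθ).2 h.le
    rw [longCount_succ h]
    push_cast
    rw [add_mul, add_mul, one_mul]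
    have n1 : 0 ≤ len ψ a m := ENNReal.toReal_nonneg
    have n2 : 0 ≤ len ψ m b := ENNReal.toReal_nonneg
    by_cases h1 : θ < len ψ a m
    · by_cases h2 : θ < len ψ m b
      · have j1 := i1 h1
        have j2 := i2 h2
        have k1 := b1 (hθ.trans h1)
        have k2 := b1 (hθ.trans h2)
        -- With two long halves, one of the two terms -log 2 pays for the node, and length that is
        -- lost costs at most 1 < 3 log 2 per unit.
        have k3 : len ψ a m / θ + len ψ m b / θ ≤ X := by
          rw [← add_div]; exact div_le_div_of_nonneg_right hadd hθ.le
        nlinarith [mul_nonneg (sub_nonneg.2 k3) hG]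
      · rw [longCount_eq_zero (not_lt.1 h2), Nat.cast_zero, zero_mul, add_zero]
        exact single h1 (by linarith) (i1 h1)
    · rw [longCount_eq_zero (not_lt.1 h1), Nat.cast_zero, zero_mul, zero_add]
      by_cases h2 : θ < len ψ m b
      · exact single h2 (by linarith) (i2 h2)
      · rw [longCount_eq_zero (not_lt.1 h2), Nat.cast_zero, zero_mul, zero_add]
        nlinarith

/-- It suffices to bound 2 `longCount` + 1 at a depth where no long intervals are left;
`longCount_le` with K = `vMax` does so. -/
theorem attempts_floor_costBound (hL : pathLength ψ 0 1 ≠ ⊤) (hθ : 0 < θ)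
    (hθγ : θ < Real.arccos (Real.sqrt (1 - γ))) (hv : BddAbove (velocities ψ θ)) :
    1 ≤ costBound ψ θ ∧ Attempts ψ γ 0 [1] ⌊costBound ψ θ⌋₊ := by
  have hγ : ∀ a b : ℝ, 0 ≤ a → a < b → b ≤ 1 → overlap (ψ a) (ψ b) ≤ 1 - γ → θ < len ψ a b :=
    fun a b ha hab hb => lt_len_of_overlap_le hL hθγ ha hab hb
  suffices h : ∃ N : ℕ, (∀ a' b' : ℝ, 0 ≤ a' → a' < b' → b' ≤ 1 → θ < len ψ a' b' →
      (1 - 0 : ℝ) / 2 ^ N < b' - a') ∧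
      2 * (longCount ψ θ N 0 1 : ℝ) + 1 ≤ costBound ψ θ by
    obtain ⟨N, hN, hC⟩ := h
    refine ⟨by linarith [Nat.cast_nonneg (α := ℝ) (longCount ψ θ N 0 1)], ?_⟩
    refine (attempts_of_longCount hγ le_rfl zero_lt_one le_rfl hN (.nil 0)).mono ?_
    refine Nat.le_floor ?_
    push_cast
    linarith
  have hvavg : vAvg ψ = len ψ 0 1 := by rw [vAvg, sub_zero, div_one]
  by_cases hLθ : len ψ 0 1 ≤ θ
  · refine ⟨0, fun a b ha hab hb h => ?_, ?_⟩
    · linarith [len_mono hL ha hab.le hb]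
    · rw [longCount_eq_zero hLθ, costBound, vMax, if_pos hLθ]
      -- For a path of length 0 the quotient 0/0 is 0 by convention, and so is its logarithm.
      have h1 : Real.logb 2 (vAvg ψ / vAvg ψ) = 0 := by
        by_cases h0 : vAvg ψ = 0
        · rw [h0, div_zero, Real.logb_zero]
        · rw [div_self h0, Real.logb_one]
      have h2 : 0 ≤ len ψ 0 1 := ENNReal.toReal_nonneg
      rw [h1]
      have : 0 ≤ 2 * len ψ 0 1 * (0 + 3) / θ := by positivity
      push_cast
      linarith
  · have hLθ' := not_le.1 hLθ
    set K := vMax ψ θ with hKdef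
    have hK' : ∀ a b : ℝ, 0 ≤ a → a < b → b ≤ 1 → θ < len ψ a b → len ψ a b / (b - a) ≤ K := by
      intro a b ha hab hb h
      rw [hKdef, vMax, if_neg hLθ]
      exact le_csSup hv ⟨a, b, ha, hab, hb, h, rfl⟩
    have hK : ∀ a b : ℝ, 0 ≤ a → a < b → b ≤ 1 → θ < len ψ a b → len ψ a b ≤ K * (b - a) :=
      fun a b ha hab hb h => (div_le_iff₀ (sub_pos.2 hab)).1 (hK' a b ha hab hb h)
    have hL0 : 0 < len ψ 0 1 := hθ.trans hLθ'
    have hK0 : 0 < K := by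
      have := hK 0 1 le_rfl zero_lt_one le_rfl hLθ'
      linarith
    -- A long interval is wider than θ/K, since its average velocity is at most K.
    obtain ⟨N, hN⟩ := exists_pow_lt_of_lt_one (div_pos hθ hK0) (by norm_num : (1 / 2 : ℝ) < 1)
    refine ⟨N, fun a b ha hab hb h => ?_, ?_⟩
    · have h1 : θ / K < b - a := by
        rw [div_lt_iff₀ hK0, mul_comm]
        exact h.trans_le (hK a b ha hab hb h)
      have h2 : (1 - 0 : ℝ) / 2 ^ N = (1 / 2) ^ N := by rw [sub_zero, div_pow, one_pow]
      rw [h2]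
      exact hN.trans h1
    · have h1 := longCount_le hL hθ hK N le_rfl zero_lt_one le_rfl hLθ'
      have hln := Real.log_pos one_lt_two
      rw [sub_zero, mul_one] at h1
      rw [costBound, hvavg, Real.logb, ← hKdef]
      have h2 : (longCount ψ θ N 0 1 : ℝ) ≤ len ψ 0 1 / θ *
          (Real.log (K / len ψ 0 1) / Real.log 2 + 3) - 1 := by
        rw [← mul_le_mul_iff_left₀ hln]
        refine h1.trans (le_of_eq ?_)
        field_simp
      have h3 : 2 * len ψ 0 1 * (Real.log (K / len ψ 0 1) / Real.log 2 + 3) / θ =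
          2 * (len ψ 0 1 / θ * (Real.log (K / len ψ 0 1) / Real.log 2 + 3)) := by ring
      rw [h3]
      linarith

end Count

lemma EigenPath.isGapped {d : ℕ} {Δ : ℝ} (path : EigenPath d Δ) {s : ℝ}
    (h0 : 0 ≤ s) (h1 : s ≤ 1) :
    IsGapped (path.U s).1 (path.φ s) (path.ψ s) Δ :=
  ⟨(path.U s).2, path.norm_ψ s ⟨h0, h1⟩, path.isEig s ⟨h0, h1⟩, path.gap s ⟨h0, h1⟩⟩

end EigenPaths

end

/-! ### The main theorem -/

theorem mainTheorem1 (r : ℕ) (γ δ Δ : ℝ) (hγ : 0 < γ) (hγ' : 2 / 3 ≤ 1 - 4 * γ)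
    (hδ : 0 < δ) (hδπ : δ < Real.pi) (hΔ : 0 < Δ) (hΔπ : Δ ≤ Real.pi)
    (Λ : Type) [Fintype Λ] [DecidableEq Λ] (ph : Λ → ℝ) :
    ∃ (W : Type) (_ : Fintype W) (_ : DecidableEq W) (w₀ : W) (T : EigenPaths.StepProc r W Λ),
      ∀ (d : ℕ) (path : EigenPaths.EigenPath d Δ),
        (∀ a b : ℝ, 0 ≤ a → a < b → b ≤ 1 →
          EigenPaths.IsDominant (path.U b).1 (path.φ b) (path.ψ a) (1 - 4 * γ) δ) →
      ∀ (E F : Type) [Fintype E] [DecidableEq E] [Fintype F] [DecidableEq F]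
        (O : EigenPaths.Oracles path.U (min (δ / 2) (Δ / 4) / 2) Δ ph E F),
        -- the one-step procedure
        (∀ a b φa : ℝ, 0 ≤ a → a < b → b ≤ 1 → EigenPaths.angDist φa (path.φ a) < Δ / 4 →
          EigenPaths.StepCorrect ((T 0 a b φa).runsOn O (path.ψ a) w₀)
            (path.ψ a) (path.ψ b) (path.φ b) γ Δ (6 * Real.exp (-(r * γ ^ 2 / 36))) ∧
          EigenPaths.CostAtMost ((T 0 a b φa).runsOn O (path.ψ a) w₀)
            EigenPaths.Run.prob (4 * r) (5 * r) (7 * r)) ∧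
        -- recursive binary subdivision
        ∀ φ₀ θ : ℝ, EigenPaths.angDist φ₀ (path.φ 0) < Δ / 4 →
          0 < θ → θ < Real.arccos (Real.sqrt (1 - γ)) →
          EigenPaths.pathLength path.ψ 0 1 ≠ ⊤ → BddAbove (EigenPaths.velocities path.ψ θ) →
          ∀ C : ℝ, C = EigenPaths.costBound path.ψ θ →
          (∀ M : ℕ, ⌊C⌋₊ ≤ M →
            ∃ good : (R : EigenPaths.Run d r W Λ E F Bool) →
                EigenPaths.Basis d r W Λ E F R.n R.m → ℂ,
              EigenPaths.errorAmplitude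
                ((EigenPaths.subdivide T M 0 φ₀ [1] 0).runsOn O (path.ψ 0) w₀) good
                  ≤ 6 * C * Real.exp (-(r * γ ^ 2 / 36)) ∧
              (∀ R ∈ (EigenPaths.subdivide T M 0 φ₀ [1] 0).runsOn O (path.ψ 0) w₀,
                good R ≠ 0 → R.result = true ∧ EigenPaths.IsCopies (path.ψ 1) (good R)) ∧
              EigenPaths.CostAtMost
                ((EigenPaths.subdivide T M 0 φ₀ [1] 0).runsOn O (path.ψ 0) w₀)
                (fun R => EigenPaths.normSq (good R)) (4 * r * C) (5 * r * C) (7 * r * C)) ∧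
          EigenPaths.CostAtMost
            ((EigenPaths.subdivide T ⌊C⌋₊ 0 φ₀ [1] 0).runsOn O (path.ψ 0) w₀)
            EigenPaths.Run.prob (4 * r * C) (5 * r * C) (7 * r * C) := by
  -- The two roles of the resolution: 4ρ ≤ δ lets windows of radius 3ρ fit into those of the
  -- dominance condition, and 8ρ ≤ Δ separates φ_b from the other eigenphases.
  set ρ := min (δ / 2) (Δ / 4) / 2 with hρ
  have hρ0 : 0 < ρ := half_pos (lt_min (half_pos hδ) (by linarith))
  have hρδ : 4 * ρ ≤ δ := by
    have := min_le_left (δ / 2) (Δ / 4)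
    linarith
  have hρΔ : 8 * ρ ≤ Δ := by
    have := min_le_right (δ / 2) (Δ / 4)
    linarith
  refine ⟨EigenPaths.Qubits r, inferInstance, inferInstance, EigenPaths.qubitsStart r,
    EigenPaths.stepProc ph ρ γ, ?_⟩
  intro d path hdom E F _ _ _ _ O
  have hstep : ∀ a b φa : ℝ, 0 ≤ a → a < b → b ≤ 1 → EigenPaths.angDist φa (path.φ a) < Δ / 4 →
      ∀ (n m : ℕ) (hist : List ℕ)
        (tab : Fin n → Matrix (Fin d × (Λ × E)) (Fin d × (Λ × E)) ℂ) (q : ℕ)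
        (v : EigenPaths.Basis d r (EigenPaths.Qubits r) Λ E F n m → ℂ),
      EigenPaths.UnitaryTab tab → v ∈ EigenPaths.copies (path.ψ a) →
      EigenPaths.defect O (EigenPaths.stepTarget (path.ψ a) (path.ψ b) (path.φ b) γ Δ)
        (EigenPaths.stepProc ph ρ γ n a b φa) hist tab q m v ≤
          6 * Real.exp (-(r * γ ^ 2 / 36)) * EigenPaths.nrm v := by
    intro a b φa ha hab hb hφa n m hist tab q v htab hv
    exact EigenPaths.defect_stepProc_le O
      ⟨path.isGapped ha (hab.le.trans hb), path.isGapped (ha.trans hab.le) hb, hφa, hρ0, hρΔ,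
        hγ, by linarith⟩ (hdom a b ha hab hb) hρδ hδπ hist htab q hv
  have hbound := fun n a b φa =>
    EigenPaths.stepProc_bounded (r := r) (n := n) ph ρ γ a φa b
  have hr : (0 : ℝ) ≤ r := Nat.cast_nonneg r
  have hnrm : ∀ s, 0 ≤ s → s ≤ 1 → EigenPaths.nrm (EigenPaths.startState (path.ψ s)
      (EigenPaths.qubitsStart r) : EigenPaths.Basis d r _ Λ E F 0 0 → ℂ) = 1 := fun s h0 h1 => by
    rw [EigenPaths.nrm_eq_sqrt, EigenPaths.normSq_startState (path.norm_ψ s ⟨h0, h1⟩),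
      Real.sqrt_one]
  have htab0 : EigenPaths.UnitaryTab
      (Fin.elim0 : Fin 0 → Matrix (Fin d × (Λ × E)) (Fin d × (Λ × E)) ℂ) := fun k => k.elim0
  refine ⟨fun a b φa ha hab hb hφa => ⟨?_, ?_⟩, ?_⟩
  · have ha1 := hab.le.trans hb
    refine EigenPaths.stepCorrect_of_defect_le O (path.norm_ψ a ⟨ha, ha1⟩)
      (path.norm_ψ b ⟨ha.trans hab.le, hb⟩) ?_
    refine (hstep a b φa ha hab hb hφa 0 0 [] _ 0 _ htab0
      (EigenPaths.startState_mem (path.ψ a))).trans ?_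
    rw [hnrm a ha ha1, mul_one]
  · refine EigenPaths.costAtMost_runsOn O (path.norm_ψ a ⟨ha, hab.le.trans hb⟩)
      (hbound 0 a b φa) ?_ ?_ (by linarith) <;> push_cast <;> exact le_rfl
  · intro φ₀ θ hφ₀ hθ hθγ hL hv C hC
    obtain ⟨hC1, hatt⟩ := EigenPaths.attempts_floor_costBound hL hθ hθγ hv
    rw [← hC] at hC1 hatt
    have hfloor : (⌊C⌋₊ : ℝ) ≤ C := Nat.floor_le (by linarith)
    have hrC := mul_nonneg hr (by linarith : 0 ≤ C)
    have hrf := mul_le_mul_of_nonneg_left hfloor hr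
    have h0 := path.norm_ψ 0 ⟨le_rfl, zero_le_one⟩
    have h1 := path.norm_ψ 1 ⟨zero_le_one, le_rfl⟩
    refine ⟨fun M hM => ?_, ?_⟩
    · refine EigenPaths.exists_good_of_defect_le O (Q := 4 * r * ⌊C⌋₊) (N := 5 * r * ⌊C⌋₊) h0 h1
        ?_ ?_ ?_ (by linarith)
      · refine (EigenPaths.defect_subdivide_le O (φ := path.φ) hΔ
          (by positivity : 0 ≤ 6 * Real.exp (-(r * γ ^ 2 / 36)))
          hbound hstep hatt hM hφ₀ [] htab0 (by rw [zero_add]) (by rw [zero_add])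
          (EigenPaths.startState_mem (path.ψ 0))).trans ?_
        rw [hnrm 0 le_rfl zero_le_one, mul_one]
        have := mul_le_mul_of_nonneg_right hfloor
          (by positivity : 0 ≤ 6 * Real.exp (-(r * γ ^ 2 / 36)))
        linarith
      · push_cast
        linarith
      · push_cast
        linarith
    · refine EigenPaths.costAtMost_runsOn O h0
        (EigenPaths.Proc.Bounded.subdivide hbound ⌊C⌋₊ 0 φ₀ [1] 0) ?_ ?_ (by linarith) <;>
      push_cast <;> linarith
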